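/- Let $H^2_{\mathrm{odd}}(-\pi,\pi)$ be the space of odd functions on $(-\pi,\pi)$ whose $2\pi$-periodic extension to $\mathbb{R}$ belongs to $H^2_{\mathrm{loc}}(\mathbb{R})$, with the norm $\|u\|_{H^2_{\mathrm{odd}}}=\|u_{xx}\|_{L^2(-\pi,\pi)}$. For $u=\sum_{k\ge1}u_k\sin(kx)$ put $(-\Delta)^\alpha u=\sum_{k\ge1}k^{2\alpha}u_k\sin(kx)$ and $e^{-t(-\Delta)^\alpha}u=\sum_{k\ge1}e^{-tk^{2\alpha}}u_k\sin(kx)$. Let $\alpha=\frac12+\frac{i}{64}$ with an integer $11\le i\le 32$, and consider the forced fractional Burgers equation with odd $2\pi$-periodic conditions in $x$, $$u_t=-(-\Delta)^\alpha u+\tfrac12(u^2)_x+g(t,x),\qquad g(t,x)=\left(\tfrac12\sin(2\pi t)+1\right)\sin x .$$ A solution on $[t_0,\infty)$ with $u(t_0)=u^0\in H^2_{\mathrm{odd}}(-\pi,\pi)$ is a continuous function $u:[t_0,\infty)\to H^2_{\mathrm{odd}}(-\pi,\pi)$ such that, for all $t\ge t_0$, $$u(t)=e^{-(t-t_0)(-\Delta)^\alpha}u^0+\int_{t_0}^{t}e^{-(t-s)(-\Delta)^\alpha}\left(\tfrac12(u(s)^2)_x+g(s,\cdot)\right)ds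 ,$$ where the integral converges absolutely in $H^2_{\mathrm{odd}}(-\pi,\pi)$. Then there is a periodic orbit of period $1$: a function $u^*:\mathbb{R}\to H^2_{\mathrm{odd}}(-\pi,\pi)$ with $u^*(t+1)=u^*(t)$ for all $t\in\mathbb{R}$ whose restriction to $[t_0,\infty)$ is a solution for every $t_0\in\mathbb{R}$. Moreover, there exist $\delta>0$, $D>0$ and $\kappa>0$ such that for every $t_0\in\mathbb{R}$ and every $u^0\in H^2_{\mathrm{odd}}(-\pi,\pi)$ with $\|u^*(t_0)-u^0\|_{H^2_{\mathrm{odd}}}\le\delta$ there exists a solution $u:[t_0,\infty)\to H^2_{\mathrm{odd}}(-\pi,\pi)$ with $u(t_0)=u^0$ such that $$\|u^*(t)-u(t)\|_{H^2_{\mathrm{odd}}}\le De^{-\kappa(t-t_0)}\,\|u^*(t_0)-u(t_0)\|_{H^2_{\mathrm{odd}}}\qquad\text{for all }t\ge t_0 .$$ -/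

import Mathlib

open scoped Real Topology ContDiff

noncomputable section

namespace FracBurgers

/-- `v` is the weak (distributional) derivative of `u` on the real line. -/
def IsWeakDeriv (u v : ℝ → ℝ) : Prop :=
  MeasureTheory.LocallyIntegrable u ∧ MeasureTheory.LocallyIntegrable v ∧
    ∀ φ : ℝ → ℝ, ContDiff ℝ ∞ φ → HasCompactSupport φ →
      ∫ x, u x * deriv φ x = -∫ x, v x * φ x

/-- A choice of the weak derivative; it is unique up to a null set whenever it exists. -/
def weakDeriv (u : ℝ → ℝ) : ℝ → ℝ := Classical.epsilon (IsWeakDeriv u)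

/-- The space `L²_loc(ℝ)`. -/
def MemL2Loc (u : ℝ → ℝ) : Prop :=
  ∀ K : Set ℝ, IsCompact K → MeasureTheory.MemLp u 2 (MeasureTheory.volume.restrict K)

/-- The space `H²_loc(ℝ)`. -/
def MemH2Loc (u : ℝ → ℝ) : Prop :=
  MemL2Loc u ∧ ∃ v w : ℝ → ℝ,
    IsWeakDeriv u v ∧ MemL2Loc v ∧ IsWeakDeriv v w ∧ MemL2Loc w

/-- The space `H²_odd(-π, π)`: odd functions whose `2π`-periodic extension to the line is in
`H²_loc(ℝ)`. An element is represented by its periodic extension and, among the almost everywhere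
equal functions, by the unique continuous one, so that equality in the space is equality of
functions. -/
structure MemH2Odd (u : ℝ → ℝ) : Prop where
  continuous : Continuous u
  odd : Function.Odd u
  periodic : Function.Periodic u (2 * π)
  memH2Loc : MemH2Loc u

/-- The norm of `H²_odd(-π, π)`, namely `‖u_xx‖` in `L²(-π, π)`. -/
def normH2 (u : ℝ → ℝ) : ℝ :=
  Real.sqrt (∫ x in (-π)..π, weakDeriv (weakDeriv u) x ^ 2)

/-- The coefficient `u_k` in the sine expansion `u = ∑ u_k sin (k x)` of an odd function on
`(-π, π)`. -/
def sineCoeff (u : ℝ → ℝ) (k : ℕ) : ℝ :=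
  (1 / π) * ∫ x in (-π)..π, u x * Real.sin (k * x)

/-- The semigroup `e^{tL}` generated by `L = -(-Δ)^α`, where
`(-Δ)^α u = ∑ k^{2α} u_k sin (k x)`. The term `k = 0` vanishes. -/
def semigroup (α t : ℝ) (u : ℝ → ℝ) : ℝ → ℝ := fun x =>
  ∑' k : ℕ, Real.exp (-t * (k : ℝ) ^ (2 * α)) * sineCoeff u k * Real.sin (k * x)

/-- The term `f(t, u) = ν (u²)_x + g(t, ·)`. For `u` in `H²_odd` the continuous representative is
continuously differentiable, so the derivative is the classical one. -/
def nonlinearity (ν : ℝ) (g : ℝ → ℝ → ℝ) (t : ℝ) (u : ℝ → ℝ) : ℝ → ℝ := fun x =>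
  ν * deriv (fun y => u y ^ 2) x + g t x

/-- The function `u : [t₀, ∞) → H²_odd(-π, π)` is a (mild, Duhamel) solution of
`u_t = -(-Δ)^α u + ν (u²)_x + g` with `u(t₀) = u₀`: it is continuous in the norm of `H²_odd` and
`u(t) = e^{(t-t₀)L} u₀ + ∫_{t₀}^t e^{(t-s)L} f(s, u(s)) ds` for every `t ≥ t₀`, where the integral
converges absolutely in `H²_odd`. Point evaluations are continuous on `H²_odd`, so the
`H²_odd`-valued integral is computed pointwise in `x`. The values of `u` before `t₀` play
no role. -/
structure IsSolution (α ν : ℝ) (g : ℝ → ℝ → ℝ) (t₀ : ℝ) (u₀ : ℝ → ℝ) (u : ℝ → ℝ → ℝ) :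
    Prop where
  mem : ∀ t, t₀ ≤ t → MemH2Odd (u t)
  continuous : ∀ t, t₀ ≤ t →
    Filter.Tendsto (fun s => normH2 (u s - u t)) (𝓝[Set.Ici t₀] t) (𝓝 0)
  integrand_mem : ∀ t s, t₀ ≤ s → s < t →
    MemH2Odd (semigroup α (t - s) (nonlinearity ν g s (u s)))
  integrand_integrable : ∀ t, t₀ ≤ t →
    IntervalIntegrable (fun s => normH2 (semigroup α (t - s) (nonlinearity ν g s (u s))))
      MeasureTheory.volume t₀ t
  initial : u t₀ = u₀
  duhamel : ∀ t, t₀ ≤ t → ∀ x,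
    u t x = semigroup α (t - t₀) u₀ x
      + ∫ s in t₀..t, semigroup α (t - s) (nonlinearity ν g s (u s)) x

/-- A global solution `u : ℝ → H²_odd(-π, π)` that is periodic in time with period `T`. -/
def IsPeriodicOrbit (α ν : ℝ) (g : ℝ → ℝ → ℝ) (T : ℝ) (u : ℝ → ℝ → ℝ) : Prop :=
  (∀ t₀, IsSolution α ν g t₀ (u t₀) u) ∧ ∀ t, u (t + T) = u t

/-- The forcing `g(t, x) = (½ sin (2πt) + 1) sin x`. -/
def forcing (t x : ℝ) : ℝ := (1 / 2 * Real.sin (2 * π * t) + 1) * Real.sin x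

end FracBurgers

end

namespace FracBurgers

open Filter

/-! ### A fixed point theorem for a weighted supremum distance -/

/-! Write s = 2α - 1 = i/32, so 11/32 ≤ s ≤ 1, and extend the sine coefficients oddly to the
integers. The equation becomes u_k' = -|k|^(1+s) u_k + (k/4)(u * u)_k + g_k. The kernel
exp(-|k|^(1+s) t) has mass |k|^(-1-s), so after integration in time the factor k of the derivative
cancels and the nonlinearity is governed by (u * u)_k / (4|k|^s). Everything then reduces to
explicit inequalities between convolutions. The lower bounds for |k|^s that enter are those for s =
11/32; only the lower bound on mode two also needs s ≤ 1.

The orbit is a fixed point of `orbitMap`, which sends u to the period-one response to its own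
source. `OrbitBox` prescribes one-sided bounds for modes 1 to 4, absolute bounds for modes 5 to 9,
and a weighted ℓ¹ bound on the suprema of the remaining modes. Sup bounds alone would ignore that a
fast forcing is averaged out, so the explicit harmonic response of mode one and its leading effect
on mode two are split off as `oscOne` and `oscTwo`. The box is invariant (`OrbitBox.orbitMap_mem`):
the first four modes use sign information, the others use `IsBoxed.conv_le_mid` and
`IsBoxed.conv_tail_le`. On the box the map contracts by 0.98 in a supremum distance weighted by
`testSeq` (`OrbitBox.abs_orbitMap_sub_le`). The reason is the row estimate
`IsBoxed.conv_testSeq_le`, a * P ≤ 2 · 0.98 · |k|^s P for every majorant a from the box.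

The same row estimate gives stability. A perturbation is written as exp(-t/1000) z. The linear part
of the equation for z is bounded by y ↦ (2|k|^s)⁻¹ (A * y). Schur's test (`schur_conv`) with the
comparison sequence P bounds this operator by 0.98 in ℓ² with weight |k|^s, and a submultiplicative
weight lifts the bound to a norm equivalent to that of H² (`energy_perturbationMap_le`). The
quadratic term is negligible for small data because H² is an algebra
(`tsum_pow_four_mul_conv_sq_le`). A second fixed point argument, in `exists_perturbation`, produces
z bounded for all times, which is exponential decay of the perturbation.

All weights have the form (1 + |k|/10^6)^p. They grow like |k|^p, so they control H², yet they are
within 10⁻⁴ of 1 on the modes where the inequalities are tight. The constants become enormous, which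
is harmless because δ and D are free.

It remains to translate. A function is in `MemH2Odd` exactly when it is a sine series with ∑ n⁴ b_n²
finite, and its norm is then √(π ∑ n⁴ b_n²) (`memH2Odd_sineSeries`, `normH2_sineSeries`,
`MemH2Odd.summable`, `MemH2Odd.eq_sineSeries`). The modewise Duhamel formulas sum to the one in H²
by dominated convergence (`IsTrajectory.isSolution`), the smoothing of the semigroup making up for
the lost derivative. -/

theorem exists_fixedPoint_of_weighted_contraction {ι τ : Type*} {S : Set (ι → τ → ℝ)}
    {Φ : (ι → τ → ℝ) → ι → τ → ℝ} {P : ι → ℝ} {q M : ℝ} (hq0 : 0 ≤ q)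
    (hq1 : q < 1) (hΦ : ∀ u ∈ S, Φ u ∈ S)
    (hcontr : ∀ u ∈ S, ∀ v ∈ S, ∀ C, 0 ≤ C → (∀ k t, |u k t - v k t| ≤ C * P k) →
      ∀ k t, |Φ u k t - Φ v k t| ≤ q * C * P k)
    {u₀ : ι → τ → ℝ} (hu₀ : u₀ ∈ S) (hM : 0 ≤ M)
    (h₀ : ∀ k t, |Φ u₀ k t - u₀ k t| ≤ M * P k)
    (hclosed : ∀ (v : ℕ → ι → τ → ℝ) (w : ι → τ → ℝ), (∀ n, v n ∈ S) →
      (∀ k, TendstoUniformly (fun n => v n k) (w k) atTop) → w ∈ S) :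
    ∃ u ∈ S, Φ u = u := by
  set v : ℕ → ι → τ → ℝ := fun n => Φ^[n] u₀ with hv
  have hvS : ∀ n, v n ∈ S := by
    intro n
    induction n with
    | zero => simpa [hv] using hu₀
    | succ n ih =>
      simp only [hv, Function.iterate_succ_apply'] at ih ⊢
      exact hΦ _ ih
  have hsucc : ∀ n, v (n + 1) = Φ (v n) := fun n => by
    simp only [hv, Function.iterate_succ_apply']
  have hstep : ∀ n k t, |v (n + 1) k t - v n k t| ≤ (q ^ n * M) * P k := by
    intro n
    induction n with
    | zero => intro k t; simpa [hv] using h₀ k t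
    | succ n ih =>
      intro k t
      rw [hsucc (n + 1)]
      nth_rewrite 2 [hsucc n]
      have := hcontr _ (hvS (n + 1)) _ (hvS n) (q ^ n * M) (by positivity) ih k t
      calc _ ≤ _ := this
        _ = _ := by ring
  have hdist : ∀ k t n, dist (v n k t) (v (n + 1) k t) ≤ (M * P k) * q ^ n := by
    intro k t n
    rw [dist_comm, Real.dist_eq]
    calc _ ≤ _ := hstep n k t
      _ = _ := by ring
  have hcau : ∀ k t, CauchySeq fun n => v n k t := fun k t =>
    cauchySeq_of_le_geometric q _ hq1 (hdist k t)
  choose w hw using fun k t => cauchySeq_tendsto_of_complete (hcau k t)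
  -- The geometric rate is stated in the weighted distance itself. It yields convergence uniform in
  -- t for each k, which is what `hclosed` asks, and it lets `hcontr` compare w with the iterates.
  have hrate : ∀ n k t, |v n k t - w k t| ≤ (M * q ^ n / (1 - q)) * P k := by
    intro n k t
    have := dist_le_of_le_geometric_of_tendsto q _ hq1 (hdist k t) (hw k t) n
    rw [Real.dist_eq] at this
    calc _ ≤ _ := this
      _ = _ := by ring
  have hq1' : 0 < 1 - q := by linarith
  have hzero : ∀ c : ℝ, Tendsto (fun n : ℕ => c * q ^ n) atTop (𝓝 0) := fun c => by
    simpa using (tendsto_pow_atTop_nhds_zero_of_lt_one hq0 hq1).const_mul c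
  have hwS : w ∈ S := by
    refine hclosed v w hvS fun k => ?_
    rw [Metric.tendstoUniformly_iff]
    intro ε hε
    have h := (hzero (M / (1 - q) * P k)).eventually (gt_mem_nhds hε)
    filter_upwards [h] with n hn t
    rw [dist_comm, Real.dist_eq]
    refine (hrate n k t).trans_lt ?_
    calc _ = M / (1 - q) * P k * q ^ n := by ring
      _ < ε := hn
  refine ⟨w, hwS, ?_⟩
  ext k t
  have hb : ∀ n, |Φ w k t - w k t| ≤ (2 * q * M / (1 - q) * P k) * q ^ n := by
    intro n
    have h1 := hcontr w hwS (v n) (hvS n) (M * q ^ n / (1 - q)) (by positivity)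
      (fun k t => by rw [abs_sub_comm]; exact hrate n k t) k t
    have h2 := hrate (n + 1) k t
    rw [hsucc n] at h2
    have h3 := abs_sub_le (Φ w k t) (Φ (v n) k t) (w k t)
    refine h3.trans ((add_le_add h1 h2).trans (le_of_eq ?_))
    rw [pow_succ]; ring
  have h0 := ge_of_tendsto' (hzero _) hb
  exact sub_eq_zero.mp (abs_nonpos_iff.mp h0)

/-! ### Suprema in time -/

/-- The supremum of `|f|`. -/
noncomputable def supAbs (f : ℝ → ℝ) : ℝ := ⨆ t, |f t|

theorem supAbs_nonneg (f : ℝ → ℝ) : 0 ≤ supAbs f := Real.iSup_nonneg fun _ => abs_nonneg _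

theorem abs_le_supAbs {f : ℝ → ℝ} {C : ℝ} (h : ∀ t, |f t| ≤ C) (t : ℝ) : |f t| ≤ supAbs f :=
  le_ciSup (f := fun t => |f t|) ⟨C, by rintro _ ⟨s, rfl⟩; exact h s⟩ t

theorem supAbs_le {f : ℝ → ℝ} {C : ℝ} (h : ∀ t, |f t| ≤ C) : supAbs f ≤ C := ciSup_le h

theorem supAbs_neg (f : ℝ → ℝ) : supAbs (fun t => -f t) = supAbs f := by simp [supAbs]

/-- Bounded functions are stable under uniform limits, and their suprema converge. -/
theorem tendsto_supAbs {f : ℕ → ℝ → ℝ} {g : ℝ → ℝ} (hf : ∀ n, ∃ C, ∀ t, |f n t| ≤ C)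
    (h : TendstoUniformly f g atTop) :
    (∃ C, ∀ t, |g t| ≤ C) ∧ Tendsto (fun n => supAbs (f n)) atTop (𝓝 (supAbs g)) := by
  rw [Metric.tendstoUniformly_iff] at h
  have hg : ∃ C, ∀ t, |g t| ≤ C := by
    obtain ⟨n, hn⟩ := (h 1 one_pos).exists
    obtain ⟨C, hC⟩ := hf n
    refine ⟨C + 1, fun t => ?_⟩
    have h1 := hn t
    rw [Real.dist_eq] at h1
    have h2 := abs_sub_abs_le_abs_sub (g t) (f n t)
    linarith [hC t]
  refine ⟨hg, ?_⟩
  rw [Metric.tendsto_atTop']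
  intro ε hε
  obtain ⟨N, hN⟩ := eventually_atTop.mp (h (ε / 2) (by positivity))
  refine ⟨N, fun n hn => ?_⟩
  obtain ⟨C, hC⟩ := hf n
  obtain ⟨C', hC'⟩ := hg
  have hd : ∀ t, |g t - f n t| < ε / 2 := fun t => by
    have := hN n hn.le t
    rwa [Real.dist_eq] at this
  have h1 : supAbs (f n) ≤ supAbs g + ε / 2 := by
    refine supAbs_le fun t => ?_
    have h2 := abs_sub_abs_le_abs_sub (f n t) (g t)
    rw [abs_sub_comm] at h2
    linarith [abs_le_supAbs hC' t, hd t]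
  have h1' : supAbs g ≤ supAbs (f n) + ε / 2 := by
    refine supAbs_le fun t => ?_
    have h2 := abs_sub_abs_le_abs_sub (g t) (f n t)
    linarith [abs_le_supAbs hC t, hd t]
  rw [Real.dist_eq, abs_lt]
  constructor <;> linarith

/-! ### Convolution of sequences indexed by the integers -/

/-- The convolution of two sequences. -/
noncomputable def conv (a b : ℤ → ℝ) (k : ℤ) : ℝ := ∑' j, a j * b (k - j)

theorem abs_le_tsum_abs {b : ℤ → ℝ} (hb : Summable fun j => |b j|) (k : ℤ) :
    |b k| ≤ ∑' j, |b j| :=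
  hb.le_tsum k fun _ _ => abs_nonneg _

theorem le_tsum_of_nonneg {b : ℤ → ℝ} (h0 : ∀ j, 0 ≤ b j) (hb : Summable b) (k : ℤ) :
    b k ≤ ∑' j, b j :=
  hb.le_tsum k fun _ _ => h0 _

theorem summable_conv_of_bdd {a b : ℤ → ℝ} {C : ℝ} (ha : Summable fun j => |a j|)
    (hb : ∀ j, |b j| ≤ C) (k : ℤ) : Summable fun j => a j * b (k - j) := by
  refine Summable.of_norm_bounded (ha.mul_right C) fun j => ?_
  rw [Real.norm_eq_abs, abs_mul]
  exact mul_le_mul_of_nonneg_left (hb _) (abs_nonneg _)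

theorem conv_comm (a b : ℤ → ℝ) : conv a b = conv b a := by
  ext k
  rw [conv, conv, ← (Equiv.subLeft k).tsum_eq]
  refine tsum_congr fun j => ?_
  simp [mul_comm]

theorem conv_nonneg {a b : ℤ → ℝ} (ha : ∀ j, 0 ≤ a j) (hb : ∀ j, 0 ≤ b j) (k : ℤ) :
    0 ≤ conv a b k := tsum_nonneg fun _ => mul_nonneg (ha _) (hb _)

theorem abs_conv_le {f g a b : ℤ → ℝ} {C : ℝ} (hf : ∀ j, |f j| ≤ a j) (hg : ∀ j, |g j| ≤ b j)
    (ha : Summable a) (hb : ∀ j, b j ≤ C) (k : ℤ) : |conv f g k| ≤ conv a b k := by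
  have hs : Summable fun j => a j * b (k - j) := by
    refine summable_conv_of_bdd (C := C) ?_ ?_ k
    · exact ha.congr fun j => (abs_of_nonneg ((abs_nonneg _).trans (hf j))).symm
    · exact fun j => by rw [abs_of_nonneg ((abs_nonneg _).trans (hg j))]; exact hb j
  rw [conv, ← Real.norm_eq_abs]
  refine tsum_of_norm_bounded hs.hasSum fun j => ?_
  rw [Real.norm_eq_abs, abs_mul]
  exact mul_le_mul (hf _) (hg _) (abs_nonneg _) ((abs_nonneg _).trans (hf _))

theorem conv_mono {a a' b b' : ℤ → ℝ} {C : ℝ} (h0 : ∀ j, 0 ≤ a j) (h0' : ∀ j, 0 ≤ b j)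
    (ha : ∀ j, a j ≤ a' j) (hb : ∀ j, b j ≤ b' j) (hs : Summable a') (hC : ∀ j, b' j ≤ C)
    (k : ℤ) : conv a b k ≤ conv a' b' k := by
  have := abs_conv_le (f := a) (g := b) (a := a') (b := b')
    (fun j => by rw [abs_of_nonneg (h0 j)]; exact ha j)
    (fun j => by rw [abs_of_nonneg (h0' j)]; exact hb j) hs hC k
  exact (le_abs_self _).trans this

theorem conv_add_left {a a' b : ℤ → ℝ} {C : ℝ} (ha : Summable fun j => |a j|)
    (ha' : Summable fun j => |a' j|) (hb : ∀ j, |b j| ≤ C) (k : ℤ) :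
    conv (fun j => a j + a' j) b k = conv a b k + conv a' b k := by
  rw [conv, conv, conv, ← (summable_conv_of_bdd ha hb k).tsum_add (summable_conv_of_bdd ha' hb k)]
  exact tsum_congr fun j => by ring

theorem conv_sub_left {a a' b : ℤ → ℝ} {C : ℝ} (ha : Summable fun j => |a j|)
    (ha' : Summable fun j => |a' j|) (hb : ∀ j, |b j| ≤ C) (k : ℤ) :
    conv (fun j => a j - a' j) b k = conv a b k - conv a' b k := by
  rw [conv, conv, conv, ← (summable_conv_of_bdd ha hb k).tsum_sub (summable_conv_of_bdd ha' hb k)]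
  exact tsum_congr fun j => by ring

/-- The bilinear identity `f * f - g * g = (f - g) * f + (f - g) * g`. -/
theorem conv_self_sub_conv_self {f g : ℤ → ℝ} (hf : Summable fun j => |f j|)
    (hg : Summable fun j => |g j|) (k : ℤ) :
    conv f f k - conv g g k =
      conv (fun j => f j - g j) f k + conv (fun j => f j - g j) g k := by
  rw [conv_sub_left hf hg (abs_le_tsum_abs hf), conv_sub_left hf hg (abs_le_tsum_abs hg),
    conv_comm g f]
  ring

theorem summable_prod_conv {a b : ℤ → ℝ} (ha0 : ∀ j, 0 ≤ a j) (hb0 : ∀ j, 0 ≤ b j)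
    (ha : Summable a) (hb : Summable b) :
    Summable fun p : ℤ × ℤ => a p.2 * b (p.1 - p.2) := by
  have h := ha.mul_of_nonneg hb ha0 hb0
  let e : ℤ × ℤ ≃ ℤ × ℤ :=
    { toFun := fun p => (p.2, p.1 - p.2)
      invFun := fun p => (p.1 + p.2, p.1)
      left_inv := fun p => by simp
      right_inv := fun p => by simp }
  exact (e.summable_iff (f := fun p : ℤ × ℤ => a p.1 * b p.2)).mpr h

theorem summable_conv {a b : ℤ → ℝ} (ha0 : ∀ j, 0 ≤ a j) (hb0 : ∀ j, 0 ≤ b j)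
    (ha : Summable a) (hb : Summable b) : Summable (conv a b) :=
  (summable_prod_conv ha0 hb0 ha hb).prod

theorem tsum_conv {a b : ℤ → ℝ} (ha0 : ∀ j, 0 ≤ a j) (hb0 : ∀ j, 0 ≤ b j)
    (ha : Summable a) (hb : Summable b) : ∑' k, conv a b k = (∑' j, a j) * ∑' j, b j := by
  unfold conv
  rw [← Summable.tsum_comm (f := fun k j => a j * b (k - j)) (summable_prod_conv ha0 hb0 ha hb),
    ← tsum_mul_right]
  refine tsum_congr fun j => ?_
  rw [tsum_mul_left]
  exact congrArg _ ((Equiv.subRight j).tsum_eq b)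

/-- A sequence of weights. -/
structure IsWeight (ρ : ℤ → ℝ) : Prop where
  one_le : ∀ k, 1 ≤ ρ k
  le_mul : ∀ j k, ρ k ≤ ρ j * ρ (k - j)

/-- Submultiplicativity distributes the weight over the two factors of each product. Thus unweighted
convolution estimates apply verbatim to weighted sequences. -/
theorem IsWeight.mul_conv_le {ρ a b : ℤ → ℝ} (hρ : IsWeight ρ) {C : ℝ} (ha0 : ∀ j, 0 ≤ a j)
    (hb0 : ∀ j, 0 ≤ b j) (ha : Summable fun j => ρ j * a j) (hb : ∀ j, ρ j * b j ≤ C) (k : ℤ) :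
    ρ k * conv a b k ≤ conv (fun j => ρ j * a j) (fun j => ρ j * b j) k := by
  have hpos : ∀ j, 0 ≤ ρ j := fun j => zero_le_one.trans (hρ.one_le j)
  rw [conv, conv, ← tsum_mul_left]
  have hs : Summable fun j => ρ j * a j * (ρ (k - j) * b (k - j)) := by
    have h1 : Summable fun j => |ρ j * a j| :=
      ha.congr fun j => (abs_of_nonneg (mul_nonneg (hpos j) (ha0 j))).symm
    have h2 : ∀ j, |ρ j * b j| ≤ C := fun j =>
      (abs_of_nonneg (mul_nonneg (hpos j) (hb0 j))).trans_le (hb j)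
    exact summable_conv_of_bdd (a := fun j => ρ j * a j) (b := fun j => ρ j * b j) h1 h2 k
  have hle : ∀ j, ρ k * (a j * b (k - j)) ≤ ρ j * a j * (ρ (k - j) * b (k - j)) := fun j => by
    have := mul_le_mul_of_nonneg_right (hρ.le_mul j k) (mul_nonneg (ha0 j) (hb0 (k - j)))
    calc _ ≤ _ := this
      _ = _ := by ring
  refine Summable.tsum_le_tsum hle (Summable.of_nonneg_of_le (fun j => ?_) hle hs) hs
  exact mul_nonneg (hpos k) (mul_nonneg (ha0 _) (hb0 _))

/-! ### The Schur test -/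

theorem tsum_mul_sq_le {ι : Type*} {w z : ι → ℝ} (hw0 : ∀ i, 0 ≤ w i) (hz0 : ∀ i, 0 ≤ z i)
    (hw : Summable w) (hwz : Summable fun i => w i * z i ^ 2) :
    Summable (fun i => w i * z i) ∧
      (∑' i, w i * z i) ^ 2 ≤ (∑' i, w i) * ∑' i, w i * z i ^ 2 := by
  have hs : Summable fun i => w i * z i := by
    refine Summable.of_nonneg_of_le (fun i => mul_nonneg (hw0 i) (hz0 i)) (fun i => ?_)
      (hw.add hwz)
    nlinarith [hw0 i, mul_nonneg (hw0 i) (sq_nonneg (z i - 1)), mul_nonneg (hw0 i) (hz0 i)]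
  refine ⟨hs, ?_⟩
  refine le_of_tendsto (hs.hasSum.pow 2) (Eventually.of_forall fun F => ?_)
  have h := Finset.sum_sq_le_sum_mul_sum_of_sq_le_mul F (r := fun i => w i * z i) (f := w)
    (g := fun i => w i * z i ^ 2) (fun i _ => hw0 i)
    (fun i _ => mul_nonneg (hw0 i) (sq_nonneg _)) (fun i _ => le_of_eq (by ring))
  refine h.trans (mul_le_mul (hw.sum_le_tsum F fun i _ => hw0 i)
    (hwz.sum_le_tsum F fun i _ => mul_nonneg (hw0 i) (sq_nonneg _))
    (Finset.sum_nonneg fun i _ => mul_nonneg (hw0 i) (sq_nonneg _)) (tsum_nonneg hw0))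

/-- Schur's test for the operator `y ↦ (2 W)⁻¹ (A * y)` in the `ℓ²` space with weight `W`. -/
theorem schur_conv {A P W y : ℤ → ℝ} {q C : ℝ} (hA0 : ∀ j, 0 ≤ A j) (hAe : ∀ j, A (-j) = A j)
    (hA : Summable A) (hP0 : P 0 = 0) (hP1 : ∀ k, k ≠ 0 → 1 ≤ P k) (hPC : ∀ k, P k ≤ C)
    (hW0 : W 0 = 0) (hW1 : ∀ k, k ≠ 0 → 1 ≤ W k) (hy0 : ∀ k, 0 ≤ y k) (hyz : y 0 = 0) (hq : 0 ≤ q)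
    (hWy : Summable fun k => W k * y k ^ 2)
    (hrow : ∀ k, k ≠ 0 → conv A P k ≤ 2 * q * W k * P k) :
    Summable (fun k => W k * ((2 * W k)⁻¹ * conv A y k) ^ 2) ∧
      ∑' k, W k * ((2 * W k)⁻¹ * conv A y k) ^ 2 ≤ q ^ 2 * ∑' k, W k * y k ^ 2 := by
  have hPnn : ∀ k, 0 ≤ P k := fun k => by
    by_cases h : k = 0
    · simp [h, hP0]
    · exact zero_le_one.trans (hP1 k h)
  have hC0 : 0 ≤ C := (hPnn 0).trans (hPC 0)
  -- Cauchy-Schwarz with weights A (k - m) P m bounds (A * y)² by (A * P)(A * v). At m = 0 the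
  -- quotient is 0/0 = 0, consistent with y 0 = 0.
  set v : ℤ → ℝ := fun m => y m ^ 2 / P m with hv
  have hv0 : ∀ m, 0 ≤ v m := fun m => div_nonneg (sq_nonneg _) (hPnn m)
  have hvW : ∀ m, v m ≤ W m * y m ^ 2 := fun m => by
    by_cases h : m = 0
    · simp [hv, h, hyz]
    · simp only [hv]
      rw [div_le_iff₀ (by linarith [hP1 m h])]
      have h1 := mul_le_mul (hW1 m h) (hP1 m h) zero_le_one (by linarith [hW1 m h])
      nlinarith [sq_nonneg (y m)]
  have hvs : Summable v := Summable.of_nonneg_of_le hv0 hvW hWy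
  have hAabs : Summable fun j => |A j| := hA.congr fun j => (abs_of_nonneg (hA0 j)).symm
  have hAt : ∀ k, Summable fun m => A (k - m) := fun k => (Equiv.subLeft k).summable_iff.mpr hA
  have hAle : ∀ j, A j ≤ ∑' i, A i := le_tsum_of_nonneg hA0 hA
  have hsP : ∀ k, Summable fun m => A (k - m) * P m := fun k =>
    Summable.of_nonneg_of_le (fun m => mul_nonneg (hA0 _) (hPnn _))
      (fun m => mul_le_mul_of_nonneg_left (hPC m) (hA0 _)) ((hAt k).mul_right C)
  have hsv : ∀ k, Summable fun m => A (k - m) * v m := fun k =>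
    Summable.of_nonneg_of_le (fun m => mul_nonneg (hA0 _) (hv0 _))
      (fun m => mul_le_mul_of_nonneg_right (hAle _) (hv0 _)) (hvs.mul_left _)
  have hconvP : ∀ k, conv A P k = ∑' m, A (k - m) * P m := fun k => by
    rw [conv_comm]; exact tsum_congr fun m => mul_comm _ _
  have hconvv : ∀ k, conv A v k = ∑' m, A (k - m) * v m := fun k => by
    rw [conv_comm]; exact tsum_congr fun m => mul_comm _ _
  have hterm : ∀ k, W k * ((2 * W k)⁻¹ * conv A y k) ^ 2 ≤ q / 2 * (P k * conv A v k) := by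
    intro k
    by_cases hk : k = 0
    · simp [hk, hW0, hP0]
    have hWk := hW1 k hk
    have hcs := (tsum_mul_sq_le (w := fun m => A (k - m) * P m) (z := fun m => y m / P m)
      (fun m => mul_nonneg (hA0 _) (hPnn _)) (fun m => div_nonneg (hy0 _) (hPnn _)) (hsP k)
      ((hsv k).congr fun m => by
        by_cases h : m = 0
        · simp [hv, h, hyz]
        · have := hP1 m h
          simp only [hv]; field_simp)).2
    have e1 : ∑' m, A (k - m) * P m * (y m / P m) = conv A y k := by
      rw [conv_comm]
      refine tsum_congr fun m => ?_
      by_cases h : m = 0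
      · simp [h, hyz]
      · have := hP1 m h
        field_simp
    have e2 : ∑' m, A (k - m) * P m * (y m / P m) ^ 2 = conv A v k := by
      rw [hconvv]
      refine tsum_congr fun m => ?_
      by_cases h : m = 0
      · simp [hv, h, hyz]
      · have := hP1 m h
        simp only [hv]; field_simp
    rw [e1, e2, ← hconvP] at hcs
    have hcv : 0 ≤ conv A v k := conv_nonneg hA0 hv0 k
    have h2 := hcs.trans (mul_le_mul_of_nonneg_right (hrow k hk) hcv)
    have e3 : W k * ((2 * W k)⁻¹ * conv A y k) ^ 2 = conv A y k ^ 2 / (4 * W k) := by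
      field_simp; ring
    rw [e3, div_le_iff₀ (by linarith)]
    calc _ ≤ _ := h2
      _ = _ := by ring
  have hscv : Summable (conv A v) := summable_conv hA0 hv0 hA hvs
  have hsPv : Summable fun k => P k * conv A v k :=
    Summable.of_nonneg_of_le (fun k => mul_nonneg (hPnn _) (conv_nonneg hA0 hv0 k))
      (fun k => mul_le_mul_of_nonneg_right (hPC k) (conv_nonneg hA0 hv0 k)) (hscv.mul_left C)
  have hnn : ∀ k, 0 ≤ W k * ((2 * W k)⁻¹ * conv A y k) ^ 2 := fun k => by
    by_cases h : k = 0
    · simp [h, hW0]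
    · exact mul_nonneg (by linarith [hW1 k h]) (sq_nonneg _)
  have hsum := Summable.of_nonneg_of_le hnn hterm (hsPv.mul_left (q / 2))
  refine ⟨hsum, (hsum.tsum_le_tsum hterm (hsPv.mul_left (q / 2))).trans ?_⟩
  rw [tsum_mul_left]
  have hprod : Summable fun p : ℤ × ℤ => P p.1 * (A (p.1 - p.2) * v p.2) := by
    have h := summable_prod_conv hv0 hA0 hvs hA
    refine Summable.of_nonneg_of_le (fun p => mul_nonneg (hPnn _) (mul_nonneg (hA0 _) (hv0 _)))
      (fun p => ?_) (h.mul_left C)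
    have h1 := mul_le_mul_of_nonneg_right (hPC p.1) (mul_nonneg (hA0 (p.1 - p.2)) (hv0 p.2))
    have h2 : C * (A (p.1 - p.2) * v p.2) = C * (v p.2 * A (p.1 - p.2)) := by ring
    exact h1.trans_eq h2
  -- Since A is even, the column sums equal the row sums. The row hypothesis is therefore used
  -- twice, once on each side of the transposition, which gives the square of q.
  have hswap : ∑' k, P k * conv A v k = ∑' m, v m * conv A P m := by
    have e1 : ∀ k, P k * conv A v k = ∑' m, P k * (A (k - m) * v m) := fun k => by
      rw [hconvv, tsum_mul_left]
    rw [tsum_congr e1, ← Summable.tsum_comm (f := fun k m => P k * (A (k - m) * v m)) hprod]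
    refine tsum_congr fun m => ?_
    rw [hconvP, ← tsum_mul_left]
    refine tsum_congr fun k => ?_
    rw [← hAe (m - k), neg_sub]; ring
  rw [hswap]
  have hle : ∀ m, v m * conv A P m ≤ 2 * q * (W m * y m ^ 2) := fun m => by
    by_cases h : m = 0
    · simp [hv, h, hyz, hW0]
    · refine (mul_le_mul_of_nonneg_left (hrow m h) (hv0 m)).trans (le_of_eq ?_)
      have := hP1 m h
      simp only [hv]; field_simp
  have hs2 := hWy.mul_left (2 * q)
  have hs1 : Summable fun m => v m * conv A P m :=
    Summable.of_nonneg_of_le (fun m => mul_nonneg (hv0 m) (conv_nonneg hA0 hPnn m)) hle hs2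
  have := hs1.tsum_le_tsum hle hs2
  rw [tsum_mul_left] at this
  nlinarith

end FracBurgers

namespace FracBurgers

open Filter MeasureTheory intervalIntegral

/-! ### Scalar linear equations -/

theorem integral_exp_kernel {l : ℝ} (hl : l ≠ 0) (a t : ℝ) :
    ∫ s in a..t, Real.exp (-l * (t - s)) = (1 - Real.exp (-l * (t - a))) / l := by
  have h : ∀ s ∈ Set.uIcc a t, HasDerivAt (fun s => Real.exp (-l * (t - s)) / l)
      (Real.exp (-l * (t - s))) s := fun s _ => by
    have h1 : HasDerivAt (fun s => -l * (t - s)) l s := by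
      simpa using ((hasDerivAt_id s).const_sub t).const_mul (-l)
    exact (h1.exp.div_const l).congr_deriv (by field_simp)
  rw [integral_eq_sub_of_hasDerivAt h (by apply Continuous.intervalIntegrable; fun_prop)]
  simp; ring

/-- Factorization of the exponential kernel. -/
theorem integral_exp_mul_eq {l : ℝ} (f : ℝ → ℝ) (a t : ℝ) :
    ∫ s in a..t, Real.exp (-l * (t - s)) * f s
      = Real.exp (-l * t) * ∫ s in a..t, Real.exp (l * s) * f s := by
  rw [← intervalIntegral.integral_const_mul]
  refine integral_congr fun s _ => ?_
  rw [← mul_assoc, ← Real.exp_add]; ring_nf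

theorem integral_exp_mul_le {l M : ℝ} (hl : 0 < l) {f : ℝ → ℝ} (hf : Continuous f) {a t : ℝ}
    (hat : a ≤ t) (hM : ∀ s ∈ Set.Icc a t, f s ≤ M) :
    ∫ s in a..t, Real.exp (-l * (t - s)) * f s ≤ (1 - Real.exp (-l * (t - a))) * (M / l) := by
  have h : ∫ s in a..t, Real.exp (-l * (t - s)) * f s
      ≤ ∫ s in a..t, Real.exp (-l * (t - s)) * M := by
    refine integral_mono_on hat ?_ ?_ fun s hs => ?_
    · apply Continuous.intervalIntegrable; fun_prop
    · apply Continuous.intervalIntegrable; fun_prop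
    · exact mul_le_mul_of_nonneg_left (hM s hs) (Real.exp_pos _).le
  rw [intervalIntegral.integral_mul_const, integral_exp_kernel hl.ne'] at h
  calc _ ≤ _ := h
    _ = _ := by ring

theorem abs_integral_exp_mul_le {l M : ℝ} (hl : 0 < l) {f : ℝ → ℝ} (hf : Continuous f) {a t : ℝ}
    (hat : a ≤ t) (hM : ∀ s ∈ Set.Icc a t, |f s| ≤ M) :
    |∫ s in a..t, Real.exp (-l * (t - s)) * f s| ≤ (1 - Real.exp (-l * (t - a))) * (M / l) := by
  rw [abs_le]
  constructor
  · have := integral_exp_mul_le hl hf.neg hat (M := M) fun s hs => (neg_le_abs _).trans (hM s hs)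
    simp only [Pi.neg_apply, mul_neg, intervalIntegral.integral_neg] at this
    linarith
  · exact integral_exp_mul_le hl hf hat fun s hs => (le_abs_self _).trans (hM s hs)

theorem abs_integral_exp_mul_le' {l M : ℝ} (hl : 0 < l) (hM0 : 0 ≤ M) {f : ℝ → ℝ}
    (hf : Continuous f) {a t : ℝ} (hat : a ≤ t) (hM : ∀ s ∈ Set.Icc a t, |f s| ≤ M) :
    |∫ s in a..t, Real.exp (-l * (t - s)) * f s| ≤ M / l := by
  refine (abs_integral_exp_mul_le hl hf hat hM).trans ?_
  have := (Real.exp_pos (-l * (t - a))).le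
  have h2 : 0 ≤ M / l := by positivity
  nlinarith

theorem continuous_integral_exp_mul {l : ℝ} {f a b : ℝ → ℝ} (hf : Continuous f)
    (ha : Continuous a) (hb : Continuous b) :
    Continuous fun t => ∫ s in (a t)..(b t), Real.exp (l * s) * f s := by
  have hc : Continuous fun s => Real.exp (l * s) * f s := by fun_prop
  have h := continuous_primitive (fun a b => hc.intervalIntegrable a b) (μ := volume) 0
  have e : (fun t => ∫ s in (a t)..(b t), Real.exp (l * s) * f s) = fun t =>
      (∫ s in (0 : ℝ)..(b t), Real.exp (l * s) * f s) -
        ∫ s in (0 : ℝ)..(a t), Real.exp (l * s) * f s := by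
    ext t
    rw [integral_interval_sub_left (hc.intervalIntegrable _ _) (hc.intervalIntegrable _ _)]
  rw [e]
  exact (h.comp hb).sub (h.comp ha)

/-- The solution of period one of `y' = -l y + f` for `f` of period one. -/
noncomputable def periodicResponse (l : ℝ) (f : ℝ → ℝ) (t : ℝ) : ℝ :=
  (1 - Real.exp (-l))⁻¹ * ∫ s in (t - 1)..t, Real.exp (-l * (t - s)) * f s

theorem one_sub_exp_neg_pos {l : ℝ} (hl : 0 < l) : 0 < 1 - Real.exp (-l) := by
  rw [sub_pos, Real.exp_lt_one_iff]; linarith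

/-- The normalised kernel is positive with total mass 1/l. One-sided bounds are kept because the low
modes of the box carry signs. -/
theorem periodicResponse_le {l M : ℝ} (hl : 0 < l) {f : ℝ → ℝ} (hf : Continuous f)
    (hM : ∀ s, f s ≤ M) (t : ℝ) : periodicResponse l f t ≤ M / l := by
  have h := integral_exp_mul_le hl hf (show t - 1 ≤ t by linarith) fun s _ => hM s
  have h1 := one_sub_exp_neg_pos hl
  rw [periodicResponse, inv_mul_le_iff₀ h1]
  simpa using h

theorem periodicResponse_neg (l : ℝ) (f : ℝ → ℝ) (t : ℝ) :
    periodicResponse l (fun s => -f s) t = -periodicResponse l f t := by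
  simp [periodicResponse]

theorem le_periodicResponse {l M : ℝ} (hl : 0 < l) {f : ℝ → ℝ} (hf : Continuous f)
    (hM : ∀ s, M ≤ f s) (t : ℝ) : M / l ≤ periodicResponse l f t := by
  have h := periodicResponse_le hl hf.neg (M := -M) (fun s => neg_le_neg (hM s)) t
  have e := periodicResponse_neg l f t
  simp only [Pi.neg_def] at h
  rw [e, neg_div] at h
  linarith

theorem abs_periodicResponse_le {l M : ℝ} (hl : 0 < l) {f : ℝ → ℝ} (hf : Continuous f)
    (hM : ∀ s, |f s| ≤ M) (t : ℝ) : |periodicResponse l f t| ≤ M / l := by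
  rw [abs_le, ← neg_div]
  exact ⟨le_periodicResponse hl hf (fun s => (abs_le.mp (hM s)).1) t,
    periodicResponse_le hl hf (fun s => (abs_le.mp (hM s)).2) t⟩

theorem periodicResponse_sub {l : ℝ} {f g : ℝ → ℝ} (hf : Continuous f) (hg : Continuous g)
    (t : ℝ) : periodicResponse l (fun s => f s - g s) t
      = periodicResponse l f t - periodicResponse l g t := by
  simp only [periodicResponse, mul_sub]
  rw [intervalIntegral.integral_sub, mul_sub] <;>
  · apply Continuous.intervalIntegrable; fun_prop

theorem continuous_periodicResponse {l : ℝ} {f : ℝ → ℝ} (hf : Continuous f) :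
    Continuous (periodicResponse l f) := by
  have h := continuous_integral_exp_mul (l := l) hf (a := fun t => t - 1) (b := fun t => t)
    (by fun_prop) (by fun_prop)
  unfold periodicResponse
  simp_rw [integral_exp_mul_eq]
  fun_prop

theorem periodicResponse_add_one {l : ℝ} {f : ℝ → ℝ} (hp : ∀ t, f (t + 1) = f t) (t : ℝ) :
    periodicResponse l f (t + 1) = periodicResponse l f t := by
  have h := intervalIntegral.integral_comp_add_right (a := t - 1) (b := t)
    (fun s => Real.exp (-l * (t + 1 - s)) * f s) 1
  rw [show t - 1 + 1 = t + 1 - 1 by ring] at h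
  rw [periodicResponse, periodicResponse, ← h]
  congr 1
  refine integral_congr fun s _ => ?_
  rw [hp]; congr 2; ring

/-- Moving the unit window from t₀ to t adds the integral over [t₀, t] and removes the one over its
translate by -1. By periodicity the latter is exp(-l) times the former, and the normalisation
cancels the resulting 1 - exp(-l). -/
theorem periodicResponse_duhamel {l : ℝ} (hl : 0 < l) {f : ℝ → ℝ} (hf : Continuous f)
    (hp : ∀ t, f (t + 1) = f t) (t₀ t : ℝ) :
    periodicResponse l f t = Real.exp (-l * (t - t₀)) * periodicResponse l f t₀
      + ∫ s in t₀..t, Real.exp (-l * (t - s)) * f s := by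
  have h1 := one_sub_exp_neg_pos hl
  have hc : Continuous fun s => Real.exp (l * s) * f s := by fun_prop
  have hi : ∀ a b, IntervalIntegrable (fun s => Real.exp (l * s) * f s) volume a b :=
    fun a b => hc.intervalIntegrable a b
  simp only [periodicResponse, integral_exp_mul_eq]
  have hshift : ∫ s in t₀..t, Real.exp (l * s) * f s
      = Real.exp l * ∫ s in (t₀ - 1)..(t - 1), Real.exp (l * s) * f s := by
    have h := intervalIntegral.integral_comp_add_right (a := t₀ - 1) (b := t - 1)
      (fun s => Real.exp (l * s) * f s) 1
    simp only [sub_add_cancel] at h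
    rw [← h, ← intervalIntegral.integral_const_mul]
    refine integral_congr fun s _ => ?_
    rw [hp, mul_add, mul_one, Real.exp_add]; ring
  have hsplit : ∫ s in (t - 1)..t, Real.exp (l * s) * f s
      = (∫ s in (t₀ - 1)..t₀, Real.exp (l * s) * f s) + (∫ s in t₀..t, Real.exp (l * s) * f s)
        - ∫ s in (t₀ - 1)..(t - 1), Real.exp (l * s) * f s := by
    rw [integral_add_adjacent_intervals (hi _ _) (hi _ _),
      integral_interval_sub_left (hi _ _) (hi _ _)]
  rw [hsplit, hshift]
  have e1 : Real.exp (-l * (t - t₀)) * Real.exp (-l * t₀) = Real.exp (-l * t) := by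
    rw [← Real.exp_add]; ring_nf
  have e2 : Real.exp (-l) * Real.exp l = 1 := by rw [← Real.exp_add]; simp
  have e3 : (1 - Real.exp (-l)) * Real.exp l = Real.exp l - 1 := by rw [sub_mul, e2, one_mul]
  set A := ∫ s in (t₀ - 1)..t₀, Real.exp (l * s) * f s
  set B := ∫ s in (t₀ - 1)..(t - 1), Real.exp (l * s) * f s
  have e4 : Real.exp l * B - B = (1 - Real.exp (-l)) * (Real.exp l * B) := by
    rw [← mul_assoc, e3]; ring
  have e5 : A + Real.exp l * B - B = A + (1 - Real.exp (-l)) * (Real.exp l * B) := by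
    rw [← e4]; ring
  rw [e5, ← e1]
  field_simp

/-- Uniqueness of the periodic solution, by integrating exp(l s) y(s) over one period. It reduces
the harmonic response to checking a derivative. -/
theorem periodicResponse_eq_of_hasDerivAt {l : ℝ} (hl : 0 < l) {f y : ℝ → ℝ} (hf : Continuous f)
    (hy : ∀ t, y (t + 1) = y t) (hd : ∀ t, HasDerivAt y (f t - l * y t) t) (t : ℝ) :
    periodicResponse l f t = y t := by
  have h1 := one_sub_exp_neg_pos hl
  have h : ∀ s ∈ Set.uIcc (t - 1) t, HasDerivAt (fun s => Real.exp (-l * (t - s)) * y s)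
      (Real.exp (-l * (t - s)) * f s) s := fun s _ => by
    have h1 : HasDerivAt (fun s => -l * (t - s)) l s := by
      simpa using ((hasDerivAt_id s).const_sub t).const_mul (-l)
    exact (h1.exp.mul (hd s)).congr_deriv (by ring)
  have hyt : y (t - 1) = y t := by rw [← hy (t - 1), sub_add_cancel]
  rw [periodicResponse, integral_eq_sub_of_hasDerivAt h
    (by apply Continuous.intervalIntegrable; fun_prop), hyt]
  simp only [sub_self, mul_zero, Real.exp_zero, one_mul, sub_sub_cancel, mul_one]
  field_simp

/-- The response to a harmonic forcing of period one. -/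
theorem periodicResponse_harmonic {l : ℝ} (hl : 0 < l) (a b t : ℝ) :
    periodicResponse l (fun s => a * Real.sin (2 * π * s) + b * Real.cos (2 * π * s)) t
      = (l * a + 2 * π * b) / (l ^ 2 + (2 * π) ^ 2) * Real.sin (2 * π * t)
        + (l * b - 2 * π * a) / (l ^ 2 + (2 * π) ^ 2) * Real.cos (2 * π * t) := by
  refine periodicResponse_eq_of_hasDerivAt (y := fun t =>
    (l * a + 2 * π * b) / (l ^ 2 + (2 * π) ^ 2) * Real.sin (2 * π * t)
        + (l * b - 2 * π * a) / (l ^ 2 + (2 * π) ^ 2) * Real.cos (2 * π * t)) hl (by fun_prop)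
    (fun t => ?_) (fun t => ?_) t
  · simp only [mul_add, mul_one, Real.sin_add_two_pi, Real.cos_add_two_pi]
  · have h1 : HasDerivAt (fun t : ℝ => 2 * π * t) (2 * π) t := by
      simpa using (hasDerivAt_id t).const_mul (2 * π)
    have h2 := (h1.sin.const_mul ((l * a + 2 * π * b) / (l ^ 2 + (2 * π) ^ 2))).add
      (h1.cos.const_mul ((l * b - 2 * π * a) / (l ^ 2 + (2 * π) ^ 2)))
    have : l ^ 2 + (2 * π) ^ 2 ≠ 0 := by positivity
    exact h2.congr_deriv (by field_simp; ring)

theorem harmonic_sq_le (a b t : ℝ) :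
    (a * Real.sin t + b * Real.cos t) ^ 2 ≤ a ^ 2 + b ^ 2 := by
  nlinarith [Real.sin_sq_add_cos_sq t, sq_nonneg (a * Real.cos t - b * Real.sin t)]

/-- The transfer function at frequency one is 1/(l + 2πi), so squared amplitudes are divided by l² +
4π². This is the averaging gain that the bound by M / l misses. -/
theorem harmonic_response_sq (l a b : ℝ) (hl : 0 < l) :
    ((l * a + 2 * π * b) / (l ^ 2 + (2 * π) ^ 2)) ^ 2
      + ((l * b - 2 * π * a) / (l ^ 2 + (2 * π) ^ 2)) ^ 2
      = (a ^ 2 + b ^ 2) / (l ^ 2 + (2 * π) ^ 2) := by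
  have : l ^ 2 + (2 * π) ^ 2 ≠ 0 := by positivity
  field_simp
  ring

end FracBurgers

namespace FracBurgers

open Filter

/-! ### Even sequences: low modes and tails -/

theorem hasSum_tail {f : ℤ → ℝ} (h : Summable fun n : ℕ => f (n + 10)) :
    HasSum (fun j : ℤ => if 10 ≤ j then f j else 0) (∑' n : ℕ, f (n + 10)) := by
  have hinj : Function.Injective fun n : ℕ => (n : ℤ) + 10 := fun a b hab => by
    simpa using hab
  refine (hinj.hasSum_iff fun j hj => ?_).mp ?_
  · rw [if_neg]
    intro h10
    exact hj ⟨(j - 10).toNat, by simp only; omega⟩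
  · have e : ((fun j : ℤ => if 10 ≤ j then f j else 0) ∘ fun n : ℕ => (n : ℤ) + 10)
        = fun n : ℕ => f (n + 10) := by
      ext n
      simp
    rw [e]
    exact h.hasSum

/-- The split at ten matches the box: modes up to nine are bounded one by one, the later ones only
in sum. -/
theorem hasSum_even {f : ℤ → ℝ} (he : ∀ j, f (-j) = f j) (h0 : f 0 = 0)
    (h : Summable fun n : ℕ => f (n + 10)) :
    HasSum f (2 * (∑ n ∈ Finset.range 9, f (n + 1) + ∑' n : ℕ, f (n + 10))) := by
  have hs : HasSum (fun n : ℕ => f n)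
      (∑ n ∈ Finset.range 9, f (n + 1) + ∑' n : ℕ, f (n + 10)) := by
    have h1 : HasSum (fun n : ℕ => f ((n + 10 : ℕ) : ℤ)) (∑' n : ℕ, f (n + 10)) := by
      simpa using h.hasSum
    have h2 := (hasSum_nat_add_iff (f := fun n : ℕ => f n) 10).mp h1
    rw [Finset.sum_range_succ'] at h2
    simp only [Nat.cast_zero, h0, add_zero, Nat.cast_add, Nat.cast_one] at h2
    rwa [add_comm]
  have h2 := HasSum.of_nat_of_neg (f := f) hs (by simpa [he] using hs)
  rw [h0, sub_zero] at h2
  rwa [two_mul]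

theorem conv_even {f g : ℤ → ℝ} (hf : ∀ j, f (-j) = f j) (hg : ∀ j, g (-j) = g j) (k : ℤ) :
    conv f g (-k) = conv f g k := by
  rw [conv, conv, ← (Equiv.neg ℤ).tsum_eq]
  refine tsum_congr fun j => ?_
  simp only [Equiv.neg_apply, hf]
  rw [← hg]; congr 2; ring

/-- The two tails are disjoint mirror images, so each carries at most half of the total. This factor
1/2 is needed for the tail bound to close. -/
theorem tsum_tail_le_half {f : ℤ → ℝ} (he : ∀ j, f (-j) = f j) (h0 : ∀ j, 0 ≤ f j)
    (hs : Summable f) : Summable (fun n : ℕ => f (n + 10)) ∧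
      ∑' n : ℕ, f (n + 10) ≤ (∑' j, f j) / 2 := by
  have hinj : Function.Injective fun n : ℕ => (n : ℤ) + 10 := fun a b hab => by
    simpa using hab
  have h1 : Summable fun n : ℕ => f (n + 10) := hs.comp_injective hinj
  refine ⟨h1, ?_⟩
  have h2 := hasSum_tail h1
  have h3 := (Equiv.neg ℤ).hasSum_iff.mpr h2
  have h4 := hasSum_le (fun j => ?_) (h2.add h3) hs.hasSum
  · linarith
  · simp only [Function.comp, Equiv.neg_apply, he]
    have := h0 j
    split_ifs <;> linarith

/-! ### The box -/

/-- Bounds for the amplitudes of the modes `1, …, 9` in units of `10⁻⁵`. -/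
def boxBound : ℕ → ℕ
  | 1 => 105429
  | 2 => 20248
  | 3 => 7747
  | 4 => 3921
  | 5 => 2012
  | 6 => 1067
  | 7 => 589
  | 8 => 352
  | 9 => 261
  | _ => 0

/-- A bound for the sum of the amplitudes of the modes beyond the ninth. -/
noncomputable def tailBound : ℝ := 43 / 10000

/-- The sequence `a` bounds amplitudes of modes: up to the factor `β` in the low modes, it obeys
the bounds `boxBound` and `tailBound`. -/
structure IsBoxed (β : ℝ) (a : ℤ → ℝ) : Prop where
  nonneg : ∀ k, 0 ≤ a k
  even : ∀ k, a (-k) = a k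
  zero : a 0 = 0
  low : ∀ n : ℕ, 1 ≤ n → n ≤ 9 → a n ≤ β * (boxBound n / 10 ^ 5)
  summable_tail : Summable fun n : ℕ => a (n + 10)
  tail_le : ∑' n : ℕ, a (n + 10) ≤ tailBound

namespace IsBoxed

variable {β : ℝ} {a : ℤ → ℝ}

theorem summable (h : IsBoxed β a) : Summable a :=
  (hasSum_even h.even h.zero h.summable_tail).summable

theorem le_tailBound (h : IsBoxed β a) {i : ℤ} (hi : 10 ≤ i) : a i ≤ tailBound := by
  have h1 := h.summable_tail.le_tsum (i - 10).toNat fun _ _ => h.nonneg _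
  have e : (((i - 10).toNat : ℕ) : ℤ) + 10 = i := by omega
  rw [e] at h1
  exact h1.trans h.tail_le

theorem le_boxBound (h : IsBoxed β a) {j : ℤ} (hj : j.natAbs ≤ 9) :
    a j ≤ β * (boxBound j.natAbs / 10 ^ 5) := by
  have e : a j = a j.natAbs := by
    rcases Int.natAbs_eq j with h1 | h1
    · rw [← h1]
    · conv_lhs => rw [h1, h.even]
  rw [e]
  rcases Nat.eq_zero_or_pos j.natAbs with h0 | h0
  · simp [h0, h.zero, boxBound]
  · exact h.low _ h0 hj

/-- Up to a small error, the convolution only sees the low modes. -/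
theorem abs_conv_sub_le (h : IsBoxed β a) {f : ℤ → ℝ} (hf : ∀ j, |f j| ≤ a j) (k : ℤ) {M : ℝ}
    (hM : ∀ i, 10 - k ≤ i → a i ≤ M) :
    |conv f f k - ∑ j ∈ Finset.Icc (k - 9) 9, f j * f (k - j)| ≤ 2 * M * tailBound := by
  have hfs : Summable fun j => |f j| :=
    Summable.of_nonneg_of_le (fun _ => abs_nonneg _) hf h.summable
  have hs := summable_conv_of_bdd hfs (abs_le_tsum_abs hfs) k
  have hM0 : 0 ≤ M := (h.nonneg _).trans (hM (10 - k) le_rfl)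
  have h1 : HasSum (fun j => if j ∈ Finset.Icc (k - 9) 9 then 0 else f j * f (k - j))
      (conv f f k - ∑ j ∈ Finset.Icc (k - 9) 9, f j * f (k - j)) := by
    have h2 := hs.hasSum.sub
      (hasSum_sum_of_ne_finset_zero (s := Finset.Icc (k - 9) 9)
        (f := fun j => if j ∈ Finset.Icc (k - 9) 9 then f j * f (k - j) else 0)
        fun j hj => if_neg hj)
    have e : ∑ j ∈ Finset.Icc (k - 9) 9, (if j ∈ Finset.Icc (k - 9) 9 then f j * f (k - j) else 0)
        = ∑ j ∈ Finset.Icc (k - 9) 9, f j * f (k - j) :=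
      Finset.sum_congr rfl fun j hj => if_pos hj
    rw [e] at h2
    refine h2.congr_fun ?_
    intro j
    split_ifs <;> simp
  have h3 := hasSum_tail h.summable_tail
  have h4 := ((Equiv.subLeft k).hasSum_iff.mpr h3)
  have h5 := (h3.add h4).mul_left M
  rw [← h1.tsum_eq, ← Real.norm_eq_abs]
  refine (tsum_of_norm_bounded h5 fun j => ?_).trans ?_
  · rw [Real.norm_eq_abs]
    have ha := h.nonneg
    simp only [Function.comp, Equiv.subLeft_apply, Finset.mem_Icc]
    by_cases hj : k - 9 ≤ j ∧ j ≤ 9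
    · rw [if_pos hj, abs_zero]
      refine mul_nonneg hM0 (add_nonneg ?_ ?_) <;> split_ifs <;> first | exact ha _ | exact le_rfl
    · rw [if_neg hj, abs_mul]
      -- Outside the window one of the indices j, k - j is at least 10 and is summed against the
      -- tail. The other one, after reflection, is at least 10 - k, hence its term is at most M.
      by_cases h10 : 10 ≤ j
      · rw [if_pos h10]
        have e1 : |f (k - j)| ≤ M := (hf _).trans (by
          rw [← h.even]; exact hM _ (by omega))
        have e2 : (0 : ℝ) ≤ if 10 ≤ k - j then a (k - j) else 0 := by
          split_ifs <;> first | exact ha _ | exact le_rfl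
        calc |f j| * |f (k - j)| ≤ a j * M :=
              mul_le_mul (hf j) e1 (abs_nonneg _) (ha j)
          _ ≤ _ := by nlinarith
      · rw [if_neg h10, if_pos (by omega)]
        have e1 : |f j| ≤ M := (hf _).trans (by
          rw [← h.even]; exact hM _ (by omega))
        calc |f j| * |f (k - j)| ≤ M * a (k - j) :=
              mul_le_mul e1 (hf _) (abs_nonneg _) hM0
          _ = _ := by ring
  · have := h.tail_le
    nlinarith

/-- In units of 10⁻⁵ the box bounds are integers, so the finite double sums become integer
computations that the kernel can decide. -/
theorem sum_low_le (h : IsBoxed 1 a) {k : ℤ} {N : ℕ}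
    (hN : ∑ j ∈ Finset.Icc (k - 9) 9, boxBound j.natAbs * boxBound (k - j).natAbs ≤ N)
    (hk : 0 ≤ k) :
    ∑ j ∈ Finset.Icc (k - 9) 9, a j * a (k - j) ≤ N / 10 ^ 10 := by
  have h1 : ∑ j ∈ Finset.Icc (k - 9) 9, a j * a (k - j)
      ≤ ∑ j ∈ Finset.Icc (k - 9) 9,
        ((boxBound j.natAbs * boxBound (k - j).natAbs : ℕ) : ℝ) / 10 ^ 10 := by
    refine Finset.sum_le_sum fun j hj => ?_
    rw [Finset.mem_Icc] at hj
    have e1 := h.le_boxBound (j := j) (by omega)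
    have e2 := h.le_boxBound (j := k - j) (by omega)
    refine (mul_le_mul e1 e2 (h.nonneg _) ((h.nonneg _).trans e1)).trans (le_of_eq ?_)
    push_cast; ring
  refine h1.trans ?_
  rw [← Finset.sum_div, ← Nat.cast_sum]
  gcongr

end IsBoxed

end FracBurgers

/-! ### Weights, symbols, and the convolution bounds for modes five and higher -/

namespace FracBurgers

open Filter

/-- A slowly growing weight, equivalent to `k²`. -/
noncomputable def modeWeight (k : ℤ) : ℝ := (1 + |(k : ℝ)| / 10 ^ 6) ^ 2

theorem one_le_modeWeight (k : ℤ) : 1 ≤ modeWeight k := by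
  have h : 0 ≤ |(k : ℝ)| / 10 ^ 6 := by positivity
  exact one_le_pow₀ (by linarith)

theorem base_le_mul (j k : ℤ) : 1 + |(k : ℝ)| / 10 ^ 6
    ≤ (1 + |(j : ℝ)| / 10 ^ 6) * (1 + |((k - j : ℤ) : ℝ)| / 10 ^ 6) := by
  have h1 : |(k : ℝ)| ≤ |(j : ℝ)| + |((k - j : ℤ) : ℝ)| := by
    have := abs_add_le (j : ℝ) ((k - j : ℤ) : ℝ)
    push_cast at this ⊢
    simpa using this
  have h2 : 0 ≤ |(j : ℝ)| / 10 ^ 6 * (|((k - j : ℤ) : ℝ)| / 10 ^ 6) := by positivity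
  have h3 : |(k : ℝ)| / 10 ^ 6 ≤ (|(j : ℝ)| + |((k - j : ℤ) : ℝ)|) / 10 ^ 6 := by gcongr
  rw [add_div] at h3
  nlinarith

theorem isWeight_modeWeight : IsWeight modeWeight where
  one_le := one_le_modeWeight
  le_mul j k := by
    rw [modeWeight, modeWeight, modeWeight, ← mul_pow]
    exact pow_le_pow_left₀ (by positivity) (base_le_mul j k) 2

theorem modeWeight_neg (k : ℤ) : modeWeight (-k) = modeWeight k := by simp [modeWeight]

/-- A product of two modes up to 9 lands in modes up to 18, so there the weight costs only a factor
1.0001. -/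
theorem modeWeight_le {k : ℤ} (hk : k.natAbs ≤ 18) : modeWeight k ≤ 10001 / 10000 := by
  have h : |(k : ℝ)| ≤ 18 := by
    rw [← Int.cast_abs, Int.abs_eq_natAbs]
    exact_mod_cast hk
  have h2 : 1 + |(k : ℝ)| / 10 ^ 6 ≤ 1 + 18 / 10 ^ 6 := by gcongr
  refine (pow_le_pow_left₀ (by positivity) h2 2).trans (by norm_num)

/-- The symbol `|k|^s`. -/
noncomputable def symbolWeight (s : ℝ) (k : ℤ) : ℝ := |(k : ℝ)| ^ s

theorem symbolWeight_neg (s : ℝ) (k : ℤ) : symbolWeight s (-k) = symbolWeight s k := by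
  simp [symbolWeight]

theorem one_le_symbolWeight {s : ℝ} (hs : 0 ≤ s) {k : ℤ} (hk : k ≠ 0) : 1 ≤ symbolWeight s k := by
  refine Real.one_le_rpow ?_ hs
  rw [← Int.cast_abs]
  exact_mod_cast Int.one_le_abs hk

/-- Taking the 32nd power clears the exponent 11/32 and leaves a rational inequality for `norm_num`.
Monotonicity in s and in k does the rest, so a single rational x serves all admissible s. -/
theorem le_symbolWeight {s x : ℝ} (hs : 11 / 32 ≤ s) {m : ℕ} (hm : 1 ≤ m)
    (h : x ^ 32 ≤ (m : ℝ) ^ 11) {k : ℤ} (hk : (m : ℤ) ≤ k) : x ≤ symbolWeight s k := by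
  have hm1 : (1 : ℝ) ≤ m := by exact_mod_cast hm
  have hmk : (m : ℝ) ≤ |(k : ℝ)| := by
    refine le_trans ?_ (le_abs_self _)
    exact_mod_cast hk
  have h1 : x ≤ (m : ℝ) ^ (11 / 32 : ℝ) := by
    have h2 : x ^ 32 ≤ ((m : ℝ) ^ (11 / 32 : ℝ)) ^ 32 := by
      rw [← Real.rpow_natCast ((m : ℝ) ^ (11 / 32 : ℝ)) 32, ← Real.rpow_mul (by linarith)]
      refine h.trans (le_of_eq ?_)
      rw [← Real.rpow_natCast]
      norm_num
    exact le_of_pow_le_pow_left₀ (by norm_num) (by positivity) h2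
  refine h1.trans ((Real.rpow_le_rpow_of_exponent_le hm1 hs).trans ?_)
  exact Real.rpow_le_rpow (by linarith) hmk (by linarith)

theorem symbolWeight_le {s : ℝ} (hs : s ≤ 1) {m : ℕ} (hm : 1 ≤ m) : symbolWeight s m ≤ m := by
  have hm1 : (1 : ℝ) ≤ m := by exact_mod_cast hm
  have h := Real.rpow_le_rpow_of_exponent_le hm1 hs
  rw [Real.rpow_one] at h
  simpa [symbolWeight] using h

namespace IsBoxed

variable {β : ℝ} {a : ℤ → ℝ}

/-- The number 430 is `tailBound` in units of 10⁻⁵. It also bounds each single mode beyond the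
ninth. -/
theorem le_of_le (h : IsBoxed 1 a) {m c : ℕ} (hm : 1 ≤ m)
    (hc : ∀ n ∈ Finset.Icc m 9, boxBound n ≤ c) (h430 : 430 ≤ c) (i : ℤ) (hi : (m : ℤ) ≤ i) :
    a i ≤ c / 10 ^ 5 := by
  by_cases h10 : 10 ≤ i
  · refine (h.le_tailBound h10).trans ?_
    have : (430 : ℝ) ≤ c := by exact_mod_cast h430
    rw [tailBound]
    linarith
  · have h1 := h.le_boxBound (j := i) (by omega)
    have h2 : (boxBound i.natAbs : ℝ) ≤ c := by
      exact_mod_cast hc _ (by rw [Finset.mem_Icc]; omega)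
    refine h1.trans ?_
    rw [one_mul]
    gcongr

theorem conv_le (h : IsBoxed 1 a) {k : ℤ} {N m c : ℕ} (hk : 0 ≤ k) (hm : (m : ℤ) = 10 - k)
    (hN : ∑ j ∈ Finset.Icc (k - 9) 9, boxBound j.natAbs * boxBound (k - j).natAbs ≤ N)
    (hm1 : 1 ≤ m) (hc : ∀ n ∈ Finset.Icc m 9, boxBound n ≤ c) (h430 : 430 ≤ c) :
    conv a a k ≤ N / 10 ^ 10 + 2 * (c / 10 ^ 5) * tailBound := by
  have h1 := h.abs_conv_sub_le (f := a) (fun j => (abs_of_nonneg (h.nonneg j)).le) k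
    (M := c / 10 ^ 5) fun i hi => h.le_of_le hm1 hc h430 i (by omega)
  have h2 := h.sum_low_le hN hk
  have h3 := (abs_le.mp h1).2
  linarith

/-- The modes `5, …, 9` of the convolution. -/
theorem conv_le_mid (h : IsBoxed 1 a) {s : ℝ} (hs : 11 / 32 ≤ s) {n : ℕ} (h5 : 5 ≤ n)
    (h9 : n ≤ 9) : conv a a n ≤ 4 * symbolWeight s n * (boxBound n / 10 ^ 5) := by
  have key : ∀ (N m c : ℕ) (w : ℝ), (m : ℤ) = 10 - n →
      ∑ j ∈ Finset.Icc ((n : ℤ) - 9) 9, boxBound j.natAbs * boxBound ((n : ℤ) - j).natAbs ≤ N →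
      1 ≤ m → (∀ n ∈ Finset.Icc m 9, boxBound n ≤ c) → 430 ≤ c → 0 ≤ w →
      w ^ 32 ≤ (n : ℝ) ^ 11 →
      (N / 10 ^ 10 + 2 * (c / 10 ^ 5) * (43 / 10000) : ℝ) ≤ 4 * w * (boxBound n / 10 ^ 5) →
      conv a a n ≤ 4 * symbolWeight s n * (boxBound n / 10 ^ 5) := by
    intro N m c w hm hN hm1 hc h430 hw0 hw hfin
    have h1 := h.conv_le (by omega) hm hN hm1 hc h430
    rw [tailBound] at h1
    have h2 := le_symbolWeight hs (by omega) hw (le_refl (n : ℤ))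
    refine h1.trans (hfin.trans ?_)
    gcongr
  interval_cases n
  -- In each case N bounds the sum of the low products, m = 10 - n, c is the largest box bound among
  -- the modes m to 9, and w lies just below n^(11/32).
  · exact key 1396835010 5 2012 (10000 / 5751) (by norm_num) (by decide +kernel) (by norm_num)
      (by decide) (by norm_num) (by norm_num) (by norm_num) (by norm_num [boxBound])
  · exact key 785541009 4 3921 (10000 / 5402) (by norm_num) (by decide +kernel) (by norm_num)
      (by decide) (by norm_num) (by norm_num) (by norm_num) (by norm_num [boxBound])
  · exact key 452006884 3 7747 (10000 / 5123) (by norm_num) (by decide +kernel) (by norm_num)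
      (by decide) (by norm_num) (by norm_num) (by norm_num) (by norm_num [boxBound])
  · exact key 268986701 2 20248 (10000 / 4893) (by norm_num) (by decide +kernel) (by norm_num)
      (by decide) (by norm_num) (by norm_num) (by norm_num) (by norm_num [boxBound])
  · exact key 130384362 1 105429 (10000 / 4699) (by norm_num) (by decide +kernel) (by norm_num)
      (by decide) (by norm_num) (by norm_num) (by norm_num) (by norm_num [boxBound])

theorem weighted (h : IsBoxed 1 a)
    (hs : Summable fun n : ℕ => modeWeight (n + 10) * a (n + 10))
    (ht : ∑' n : ℕ, modeWeight (n + 10) * a (n + 10) ≤ tailBound) {r : ℤ → ℝ}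
    (hr1 : ∀ k, 1 ≤ r k) (hre : ∀ k, r (-k) = r k) (hr : ∀ k, r k ≤ modeWeight k) :
    IsBoxed (10001 / 10000) fun k => r k * a k where
  nonneg k := mul_nonneg (zero_le_one.trans (hr1 k)) (h.nonneg k)
  even k := by rw [hre, h.even]
  zero := by rw [h.zero, mul_zero]
  low n h1 h9 := by
    have h2 := h.low n h1 h9
    rw [one_mul] at h2
    exact mul_le_mul ((hr n).trans (modeWeight_le (by simpa using by omega))) h2 (h.nonneg _)
      (by norm_num)
  summable_tail := Summable.of_nonneg_of_le
    (fun n => mul_nonneg (zero_le_one.trans (hr1 _)) (h.nonneg _))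
    (fun n => mul_le_mul_of_nonneg_right (hr _) (h.nonneg _)) hs
  tail_le := by
    refine le_trans (Summable.tsum_le_tsum
      (fun n => mul_le_mul_of_nonneg_right (hr _) (h.nonneg _)) ?_ hs) ht
    exact Summable.of_nonneg_of_le
      (fun n => mul_nonneg (zero_le_one.trans (hr1 _)) (h.nonneg _))
      (fun n => mul_le_mul_of_nonneg_right (hr _) (h.nonneg _)) hs

theorem sum_low_le_total (h : IsBoxed β a) :
    ∑ n ∈ Finset.range 9, a (n + 1) ≤ β * (141626 / 10 ^ 5) := by
  have h1 : ∑ n ∈ Finset.range 9, a (n + 1)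
      ≤ ∑ n ∈ Finset.range 9, β * (boxBound (n + 1) / 10 ^ 5) := by
    refine Finset.sum_le_sum fun n hn => ?_
    rw [Finset.mem_range] at hn
    exact_mod_cast h.low (n + 1) (by omega) (by omega)
  refine h1.trans (le_of_eq ?_)
  simp [Finset.sum_range_succ, boxBound]
  ring

theorem tsum_eq (h : IsBoxed β a) :
    ∑' k, a k = 2 * (∑ n ∈ Finset.range 9, a (n + 1) + ∑' n : ℕ, a (n + 10)) :=
  (hasSum_even h.even h.zero h.summable_tail).tsum_eq

/-- The tail of the convolution in the weighted `ℓ¹` norm. -/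
theorem conv_tail_le (h : IsBoxed 1 a)
    (hs : Summable fun n : ℕ => modeWeight (n + 10) * a (n + 10))
    (ht : ∑' n : ℕ, modeWeight (n + 10) * a (n + 10) ≤ tailBound) :
    Summable (fun n : ℕ => modeWeight (n + 10) * conv a a (n + 10)) ∧
    ∑' n : ℕ, modeWeight (n + 10) * conv a a (n + 10) ≤ 4 * (10000 / 4532) * tailBound := by
  set A : ℤ → ℝ := fun k => modeWeight k * a k with hA
  have hbA : IsBoxed (10001 / 10000) A :=
    h.weighted hs ht one_le_modeWeight modeWeight_neg fun _ => le_rfl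
  -- Here b is the unweighted low part, while B and c are the weighted low and high parts. The
  -- product b * b is finite and evaluated explicitly. Only interactions with the tail pass through
  -- the lossier product of weighted ℓ¹ norms.
  set b : ℤ → ℝ := fun k => if k.natAbs ≤ 9 then a k else 0 with hb
  set c : ℤ → ℝ := fun k => if k.natAbs ≤ 9 then 0 else A k with hc
  set B : ℤ → ℝ := fun k => if k.natAbs ≤ 9 then A k else 0 with hB
  have hb0 : ∀ k, 0 ≤ b k := fun k => by
    simp only [hb]; split_ifs
    exacts [h.nonneg k, le_rfl]
  have hc0 : ∀ k, 0 ≤ c k := fun k => by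
    simp only [hc]; split_ifs
    exacts [le_rfl, hbA.nonneg k]
  have hB0 : ∀ k, 0 ≤ B k := fun k => by
    simp only [hB]; split_ifs
    exacts [hbA.nonneg k, le_rfl]
  have hbe : ∀ k, b (-k) = b k := fun k => by simp only [hb, Int.natAbs_neg, h.even]
  have hce : ∀ k, c (-k) = c k := fun k => by simp only [hc, Int.natAbs_neg, hbA.even]
  have hBe : ∀ k, B (-k) = B k := fun k => by simp only [hB, Int.natAbs_neg, hbA.even]
  have hBc : ∀ k, A k = B k + c k := fun k => by
    simp only [hB, hc]; split_ifs <;> simp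
  have hlarge : ∀ n : ℕ, ¬ ((n : ℤ) + 10).natAbs ≤ 9 := fun n => by omega
  have hsmall : ∀ n ∈ Finset.range 9, ((n : ℤ) + 1).natAbs ≤ 9 := fun n hn => by
    rw [Finset.mem_range] at hn; omega
  have hcsum : HasSum c (2 * ∑' n : ℕ, A (n + 10)) := by
    have h1 := hasSum_even hce (by simp [hc]) (f := c)
      (hbA.summable_tail.congr fun n => by simp only [hc]; rw [if_neg (hlarge n)])
    have e1 : ∑ n ∈ Finset.range 9, c (n + 1) = 0 :=
      Finset.sum_eq_zero fun n hn => by simp only [hc]; rw [if_pos (hsmall n hn)]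
    have e2 : ∀ n : ℕ, c (n + 10) = A (n + 10) := fun n => by
      simp only [hc]; rw [if_neg (hlarge n)]
    rwa [e1, zero_add, tsum_congr e2] at h1
  have hBsum : HasSum B (2 * ∑ n ∈ Finset.range 9, A (n + 1)) := by
    have e2 : ∀ n : ℕ, B (n + 10) = 0 := fun n => by
      simp only [hB]; rw [if_neg (hlarge n)]
    have h1 := hasSum_even hBe (by simp [hB, hbA.zero]) (f := B)
      (summable_zero.congr fun n => e2 n)
    have e1 : ∑ n ∈ Finset.range 9, B (n + 1) = ∑ n ∈ Finset.range 9, A (n + 1) :=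
      Finset.sum_congr rfl fun n hn => by simp only [hB]; rw [if_pos (hsmall n hn)]
    rwa [e1, tsum_congr e2, tsum_zero, add_zero] at h1
  have habs : ∀ {f : ℤ → ℝ}, (∀ k, 0 ≤ f k) → Summable f → Summable fun k => |f k| :=
    fun h0 hf => hf.congr fun k => (abs_of_nonneg (h0 k)).symm
  set X : ℤ → ℝ := fun k => 2 * conv B c k + conv c c k with hX
  have hXs : HasSum X (2 * ((2 * ∑ n ∈ Finset.range 9, A (n + 1)) * (2 * ∑' n : ℕ, A (n + 10)))
      + (2 * ∑' n : ℕ, A (n + 10)) * (2 * ∑' n : ℕ, A (n + 10))) := by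
    have h1 := (summable_conv hB0 hc0 hBsum.summable hcsum.summable).hasSum
    have h2 := (summable_conv hc0 hc0 hcsum.summable hcsum.summable).hasSum
    rw [tsum_conv hB0 hc0 hBsum.summable hcsum.summable, hBsum.tsum_eq, hcsum.tsum_eq] at h1
    rw [tsum_conv hc0 hc0 hcsum.summable hcsum.summable, hcsum.tsum_eq] at h2
    exact (h1.mul_left 2).add h2
  have hX0 : ∀ k, 0 ≤ X k := fun k => by
    have := conv_nonneg hB0 hc0 k
    have := conv_nonneg hc0 hc0 k
    simp only [hX]; linarith
  have hXe : ∀ k, X (-k) = X k := fun k => by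
    simp only [hX, conv_even hBe hce, conv_even hce hce]
  -- Evenness of the interaction terms halves their contribution to the modes from 10 on.
  obtain ⟨hXt, hXle⟩ := tsum_tail_le_half hXe hX0 hXs.summable
  rw [hXs.tsum_eq] at hXle
  have hpt : ∀ k, modeWeight k * conv a a k ≤ modeWeight k * conv b b k + X k := by
    intro k
    set c' : ℤ → ℝ := fun k => if k.natAbs ≤ 9 then 0 else a k with hc'
    have hc'0 : ∀ k, 0 ≤ c' k := fun k => by
      simp only [hc']; split_ifs
      exacts [le_rfl, h.nonneg k]
    have hle1 : ∀ k, b k ≤ a k := fun k => by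
      simp only [hb]; split_ifs
      exacts [le_rfl, h.nonneg k]
    have hle2 : ∀ k, c' k ≤ a k := fun k => by
      simp only [hc']; split_ifs
      exacts [h.nonneg k, le_rfl]
    have hbs := Summable.of_nonneg_of_le hb0 hle1 h.summable
    have hc's := Summable.of_nonneg_of_le hc'0 hle2 h.summable
    have e : a = fun j => b j + c' j := by
      ext j; simp only [hb, hc']; split_ifs <;> simp
    have eB : (fun j => modeWeight j * b j) = B := by
      ext j; simp only [hb, hB, hA]; split_ifs <;> simp
    have ec : (fun j => modeWeight j * c' j) = c := by
      ext j; simp only [hc, hc', hA]; split_ifs <;> simp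
    have e2 : conv a a k = conv b b k + (2 * conv b c' k + conv c' c' k) := by
      have hasum := habs h.nonneg h.summable
      have h1 : conv a a k = conv b a k + conv c' a k := by
        conv_lhs => rw [show conv a a k = conv (fun j => b j + c' j) a k by rw [← e]]
        exact conv_add_left (habs hb0 hbs) (habs hc'0 hc's) (abs_le_tsum_abs hasum) k
      have h2 : ∀ f : ℤ → ℝ, (Summable fun j => |f j|) →
          conv f a k = conv b f k + conv c' f k := fun f hf => by
        rw [conv_comm, show conv a f k = conv (fun j => b j + c' j) f k by rw [← e]]
        exact conv_add_left (habs hb0 hbs) (habs hc'0 hc's) (abs_le_tsum_abs hf) k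
      rw [h1, h2 b (habs hb0 hbs), h2 c' (habs hc'0 hc's), conv_comm c' b]
      ring
    have h3 := isWeight_modeWeight.mul_conv_le hb0 hc'0 (by rw [eB]; exact hBsum.summable)
      (fun j => by
        rw [show modeWeight j * c' j = c j from congrFun ec j]
        exact le_tsum_of_nonneg hc0 hcsum.summable j) k
    have h4 := isWeight_modeWeight.mul_conv_le hc'0 hc'0 (by rw [ec]; exact hcsum.summable)
      (fun j => by
        rw [show modeWeight j * c' j = c j from congrFun ec j]
        exact le_tsum_of_nonneg hc0 hcsum.summable j) k
    rw [eB, ec] at h3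
    rw [ec] at h4
    rw [e2, mul_add]
    simp only [hX]
    nlinarith
  have hfin : ∀ n : ℕ, conv b b (n + 10)
      = ∑ j ∈ Finset.Icc ((n : ℤ) + 1) 9, a j * a (n + 10 - j) := fun n => by
    rw [conv, tsum_eq_sum (s := Finset.Icc ((n : ℤ) + 1) 9)]
    · refine Finset.sum_congr rfl fun j hj => ?_
      rw [Finset.mem_Icc] at hj
      simp only [hb]
      rw [if_pos (by omega), if_pos (by omega)]
    · intro j hj
      rw [Finset.mem_Icc] at hj
      simp only [hb]
      by_cases h1 : j.natAbs ≤ 9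
      · rw [if_neg (show ¬ ((n : ℤ) + 10 - j).natAbs ≤ 9 by omega), mul_zero]
      · rw [if_neg h1, zero_mul]
  have hbig : ∀ n ∉ Finset.range 9, modeWeight ((n : ℕ) + 10) * conv b b (n + 10) = 0 := by
    intro n hn
    rw [Finset.mem_range, not_lt] at hn
    rw [hfin, Finset.Icc_eq_empty (by omega), Finset.sum_empty, mul_zero]
  have hbb : HasSum (fun n : ℕ => modeWeight (n + 10) * conv b b (n + 10))
      (∑ n ∈ Finset.range 9, modeWeight (n + 10) * conv b b (n + 10)) :=
    hasSum_sum_of_ne_finset_zero hbig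
  have hbble : ∑ n ∈ Finset.range 9, modeWeight ((n : ℕ) + 10) * conv b b (n + 10)
      ≤ 10001 / 10000 * (134602233 / 10 ^ 10) := by
    have h1 : ∀ n ∈ Finset.range 9, modeWeight ((n : ℕ) + 10) * conv b b (n + 10)
        ≤ 10001 / 10000 * (((∑ j ∈ Finset.Icc ((n : ℤ) + 10 - 9) 9,
          boxBound j.natAbs * boxBound ((n : ℤ) + 10 - j).natAbs : ℕ) : ℝ) / 10 ^ 10) := by
      intro n hn
      rw [Finset.mem_range] at hn
      refine mul_le_mul (modeWeight_le (by omega)) ?_ (conv_nonneg hb0 hb0 _) (by norm_num)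
      rw [hfin]
      have := h.sum_low_le (k := (n : ℤ) + 10) le_rfl (by omega)
      rwa [show (n : ℤ) + 10 - 9 = n + 1 by ring] at this ⊢
    refine (Finset.sum_le_sum h1).trans ?_
    rw [← Finset.mul_sum, ← Finset.sum_div, ← Nat.cast_sum]
    have h2 : ∑ n ∈ Finset.range 9, ∑ j ∈ Finset.Icc ((n : ℤ) + 10 - 9) 9,
        boxBound j.natAbs * boxBound ((n : ℤ) + 10 - j).natAbs = 134602233 := by decide +kernel
    rw [h2]
    norm_num
  have hsum2 : Summable fun n : ℕ => modeWeight (n + 10) * conv b b (n + 10) + X (n + 10) :=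
    hbb.summable.add hXt
  have hnn : ∀ n : ℕ, 0 ≤ modeWeight (n + 10) * conv a a (n + 10) := fun n =>
    mul_nonneg (zero_le_one.trans (one_le_modeWeight _)) (conv_nonneg h.nonneg h.nonneg _)
  have hS := Summable.of_nonneg_of_le hnn (fun n => hpt _) hsum2
  refine ⟨hS, (hS.tsum_le_tsum (fun n => hpt _) hsum2).trans ?_⟩
  rw [hbb.summable.tsum_add hXt, hbb.tsum_eq]
  have hL := hbA.sum_low_le_total
  have hT := hbA.tail_le
  have hL0 : 0 ≤ ∑ n ∈ Finset.range 9, A (n + 1) := Finset.sum_nonneg fun _ _ => hbA.nonneg _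
  have hT0 : 0 ≤ ∑' n : ℕ, A (n + 10) := tsum_nonneg fun _ => hbA.nonneg _
  rw [tailBound] at hT ⊢
  -- With L the low sum and T the tail bound, the total is at most 0.01347 + 4LT + 2T², about
  -- 0.03786. The target is about 0.03795.
  have h1 := mul_le_mul hL hT hT0 (by norm_num)
  have h2 := mul_le_mul hT hT hT0 (by norm_num)
  norm_num at h1 h2 hbble ⊢
  nlinarith

end IsBoxed

/-- The comparison sequence of the contraction estimates. -/
noncomputable def testSeq (k : ℤ) : ℝ := if k = 0 then 0 else if k.natAbs = 2 then 108 / 100 else 1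

theorem testSeq_zero : testSeq 0 = 0 := by simp [testSeq]

theorem one_le_testSeq {k : ℤ} (hk : k ≠ 0) : 1 ≤ testSeq k := by
  rw [testSeq, if_neg hk]; split_ifs <;> norm_num

theorem testSeq_nonneg (k : ℤ) : 0 ≤ testSeq k := by
  rw [testSeq]; split_ifs <;> norm_num

theorem testSeq_le (k : ℤ) : testSeq k ≤ 108 / 100 := by
  rw [testSeq]; split_ifs <;> norm_num

theorem testSeq_neg (k : ℤ) : testSeq (-k) = testSeq k := by simp [testSeq]

/-! ### The row estimate behind contraction and stability -/

namespace IsBoxed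

variable {a : ℤ → ℝ}

/-- The comparison sequence is the constant 1, minus a unit mass at 0, plus masses 0.08 at ±2.
Convolving with it is therefore explicit. -/
theorem conv_testSeq {β : ℝ} (h : IsBoxed β a) (k : ℤ) :
    conv a testSeq k = ∑' j, a j - a k + 8 / 100 * (a (k - 2) + a (k + 2)) := by
  have h1 := h.summable.hasSum
  have h2 := hasSum_ite_eq k (a k)
  have h3 := hasSum_ite_eq (k - 2) (8 / 100 * a (k - 2))
  have h4 := hasSum_ite_eq (k + 2) (8 / 100 * a (k + 2))
  have h5 := ((h1.sub h2).add (h3.add h4))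
  rw [conv, mul_add, ← h5.tsum_eq]
  refine tsum_congr fun j => ?_
  rw [testSeq]
  by_cases e1 : j = k
  · subst e1
    rw [if_pos (by ring), if_pos rfl, if_neg (by omega), if_neg (by omega)]; ring
  rw [if_neg (show ¬ k - j = 0 by omega), if_neg e1]
  by_cases e2 : j = k - 2
  · subst e2
    rw [if_pos (by omega), if_pos rfl, if_neg (by omega)]; ring
  by_cases e3 : j = k + 2
  · subst e3
    rw [if_pos (by omega), if_pos rfl, if_neg (by omega)]; ring
  rw [if_neg (by omega), if_neg e2, if_neg e3]; ring

/-- With constant weights the row k = 2 can fail: it contains both copies of the large first mode,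
and for s = 11/32 the sum allowed by the box exceeds 2 · 2^s. Raising the weight at ±2 to 1.08
repairs it. The other rows pay 0.08 times the two neighbours at distance 2, and the row k = 3 is
left with little room. -/
theorem conv_testSeq_le (h : IsBoxed (10001 / 10000) a) {s : ℝ} (hs : 11 / 32 ≤ s) {k : ℤ}
    (hk : k ≠ 0) : conv a testSeq k ≤ 2 * (98 / 100) * symbolWeight s k * testSeq k := by
  wlog hpos : 0 < k generalizing k
  · have := this (k := -k) (by omega) (by omega)
    rwa [conv_even h.even testSeq_neg, symbolWeight_neg, testSeq_neg] at this
  rw [h.conv_testSeq, h.tsum_eq]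
  have hT := h.tail_le
  have hn := h.nonneg
  have l1 := h.low 1 (by norm_num) (by norm_num)
  have l2 := h.low 2 (by norm_num) (by norm_num)
  have l3 := h.low 3 (by norm_num) (by norm_num)
  have l4 := h.low 4 (by norm_num) (by norm_num)
  have l5 := h.low 5 (by norm_num) (by norm_num)
  have l6 := h.low 6 (by norm_num) (by norm_num)
  have l7 := h.low 7 (by norm_num) (by norm_num)
  have l8 := h.low 8 (by norm_num) (by norm_num)
  have l9 := h.low 9 (by norm_num) (by norm_num)
  rw [tailBound] at hT
  by_cases h3 : k ≤ 3
  · simp only [Finset.sum_range_succ, Finset.sum_range_zero, boxBound] at l1 l2 l3 l4 l5 l6 l7 l8 l9 ⊢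
    norm_num at l1 l2 l3 l4 l5 l6 l7 l8 l9 ⊢
    have hm1 : a (-1) = a 1 := h.even 1
    have n2 := hn 2
    have n3 := hn 3
    interval_cases k
    · norm_num [testSeq, hm1]
      have hw : symbolWeight s 1 = 1 := by simp [symbolWeight]
      rw [hw]
      linarith
    · norm_num [testSeq, h.zero]
      have hw := le_symbolWeight (x := 10000 / 7880) hs (m := 2) (by norm_num)
        (by norm_num) (le_refl 2)
      linarith
    · norm_num [testSeq]
      have hw := le_symbolWeight (x := 10000 / 6855) hs (m := 3) (by norm_num)
        (by norm_num) (le_refl 3)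
      linarith
  -- From k = 4 on, 4^(11/32) ≥ 1.61 leaves enough room to bound each neighbour at distance 2 by
  -- 3/2.
  · have hL := h.sum_low_le_total
    have hw := le_symbolWeight (x := 10000 / 6210) hs (m := 4) (by norm_num)
        (by norm_num) (show ((4 : ℕ) : ℤ) ≤ k by push_cast; omega)
    have hP := one_le_testSeq hk
    have h1 : ∀ j, 0 < j → a j ≤ 15 / 10 := fun j hj => by
      by_cases h10 : 10 ≤ j
      · have := h.le_tailBound h10
        rw [tailBound] at this
        linarith
      · have h2 := h.le_boxBound (j := j) (by omega)
        have h3 : (boxBound j.natAbs : ℝ) ≤ 105429 := by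
          have : ∀ n ∈ Finset.Icc 1 9, boxBound n ≤ 105429 := by decide
          exact_mod_cast this _ (by rw [Finset.mem_Icc]; omega)
        linarith
    have h2 := h1 (k - 2) (by omega)
    have h3 := h1 (k + 2) (by omega)
    have h4 := hn k
    have h5 : (10000 / 6210 : ℝ) * 1 ≤ symbolWeight s k * testSeq k :=
      mul_le_mul hw hP zero_le_one (by linarith)
    nlinarith

end IsBoxed

end FracBurgers

namespace FracBurgers

open Filter

/-! ### Bounds for the four lowest modes -/

theorem mul_bounds {x y a b : ℝ} (hx : |x| ≤ a) (hy : |y| ≤ b) : -(a * b) ≤ x * y ∧ x * y ≤ a * b :=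
  abs_le.mp (by rw [abs_mul]; exact mul_le_mul hx hy (abs_nonneg _) ((abs_nonneg _).trans hx))

/-- The box constraints for the values of the first nine modes at a given time. -/
structure LowBox (x : ℕ → ℝ) (p : ℝ) : Prop where
  abs_p : |p| ≤ 787 / 10000
  v1 : 88333 / 10 ^ 5 ≤ x 1 - p ∧ x 1 - p ≤ 97559 / 10 ^ 5
  x2 : 6276 / 10 ^ 5 ≤ x 2 ∧ x 2 ≤ 20248 / 10 ^ 5
  x3 : 0 ≤ x 3 ∧ x 3 ≤ 7747 / 10 ^ 5
  x4 : -688 / 10 ^ 5 ≤ x 4 ∧ x 4 ≤ 3921 / 10 ^ 5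
  mid : ∀ n, 5 ≤ n → n ≤ 9 → |x n| ≤ boxBound n / 10 ^ 5

namespace LowBox

variable {x : ℕ → ℝ} {p : ℝ}

theorem x1 (h : LowBox x p) : 80463 / 10 ^ 5 ≤ x 1 ∧ x 1 ≤ 105429 / 10 ^ 5 := by
  have h1 := abs_le.mp h.abs_p
  have h2 := h.v1
  constructor <;> linarith

theorem abs_le_boxBound (h : LowBox x p) {n : ℕ} (h1 : 1 ≤ n) (h9 : n ≤ 9) :
    |x n| ≤ boxBound n / 10 ^ 5 := by
  by_cases h5 : 5 ≤ n
  · exact h.mid n h5 h9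
  · have e1 := h.x1
    have e2 := h.x2
    have e3 := h.x3
    have e4 := h.x4
    interval_cases n <;> rw [abs_le] <;> norm_num [boxBound] <;> constructor <;> linarith

theorem mul_mem (h : LowBox x p) {i j : ℕ} (hi : 1 ≤ i) (hi9 : i ≤ 9) (hj : 1 ≤ j) (hj9 : j ≤ 9) :
    -(boxBound i / 10 ^ 5 * (boxBound j / 10 ^ 5)) ≤ x i * x j ∧
      x i * x j ≤ boxBound i / 10 ^ 5 * (boxBound j / 10 ^ 5) :=
  mul_bounds (h.abs_le_boxBound hi hi9) (h.abs_le_boxBound hj hj9)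

/-- The leading interactions x 1 * x 2 and x 2 * x 3 have a known sign and only lower the mode. The
upper bound thus uses the positive lower bounds on x 1 and x 2, and the lower bound uses the upper
ends of the box. -/
theorem mode_one (h : LowBox x p) {R : ℝ} (hR : |R| ≤ 2 * (430 / 10 ^ 5) * (43 / 10000)) :
    88333 / 10 ^ 5 ≤ 1 + (-2 * (x 1 * x 2 + x 2 * x 3 + x 3 * x 4 + x 4 * x 5 + x 5 * x 6
      + x 6 * x 7 + x 7 * x 8 + x 8 * x 9) + R) / 4 ∧
    1 + (-2 * (x 1 * x 2 + x 2 * x 3 + x 3 * x 4 + x 4 * x 5 + x 5 * x 6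
      + x 6 * x 7 + x 7 * x 8 + x 8 * x 9) + R) / 4 ≤ 97559 / 10 ^ 5 := by
  have hR := abs_le.mp hR
  have e1 := h.x1
  have e2 := h.x2
  have e3 := h.x3
  have e4 := h.x4
  have m12 := mul_le_mul e1.1 e2.1 (by norm_num) (by linarith)
  have M12 := h.mul_mem (i := 1) (j := 2) (by norm_num) (by norm_num) (by norm_num) (by norm_num)
  have m23 : 0 ≤ x 2 * x 3 := mul_nonneg (by linarith) e3.1
  have M23 := h.mul_mem (i := 2) (j := 3) (by norm_num) (by norm_num) (by norm_num) (by norm_num)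
  have m34 : -(7747 / 10 ^ 5 * (688 / 10 ^ 5)) ≤ x 3 * x 4 := by nlinarith
  have M34 := h.mul_mem (i := 3) (j := 4) (by norm_num) (by norm_num) (by norm_num) (by norm_num)
  have M45 := h.mul_mem (i := 4) (j := 5) (by norm_num) (by norm_num) (by norm_num) (by norm_num)
  have M56 := h.mul_mem (i := 5) (j := 6) (by norm_num) (by norm_num) (by norm_num) (by norm_num)
  have M67 := h.mul_mem (i := 6) (j := 7) (by norm_num) (by norm_num) (by norm_num) (by norm_num)
  have M78 := h.mul_mem (i := 7) (j := 8) (by norm_num) (by norm_num) (by norm_num) (by norm_num)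
  have M89 := h.mul_mem (i := 8) (j := 9) (by norm_num) (by norm_num) (by norm_num) (by norm_num)
  norm_num [boxBound] at m12 M12 M23 m34 M34 M45 M56 M67 M78 M89 hR
  constructor <;> linarith

/-- With v = x 1 - p one has x 1² = v² + 2vp + p². Replacing v by 0.93, close to the midpoint of its
interval, isolates the oscillating term 2 · 0.93 · p whose response is `oscTwo`. What remains of it
is at most 2 · 0.0787 · 0.04667. The positive lower bound scales with w, hence the need for w ≤ 2.
-/
theorem mode_two (h : LowBox x p) {R w : ℝ} (hR : |R| ≤ 2 * (430 / 10 ^ 5) * (43 / 10000))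
    (hw1 : 10000 / 7880 ≤ w) (hw2 : w ≤ 2) :
    7366 / 10 ^ 5 * (4 * w) ≤ x 1 * x 1 - 2 * (x 1 * x 3 + x 2 * x 4 + x 3 * x 5 + x 4 * x 6
      + x 5 * x 7 + x 6 * x 8 + x 7 * x 9) + R - 2 * (93 / 100 * p) ∧
    x 1 * x 1 - 2 * (x 1 * x 3 + x 2 * x 4 + x 3 * x 5 + x 4 * x 6
      + x 5 * x 7 + x 6 * x 8 + x 7 * x 9) + R - 2 * (93 / 100 * p)
      ≤ 19158 / 10 ^ 5 * (4 * w) := by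
  have hR := abs_le.mp hR
  have hp := abs_le.mp h.abs_p
  have e1 := h.x1
  have e2 := h.x2
  have e3 := h.x3
  have e4 := h.x4
  have hv := h.v1
  set v := x 1 - p with hvdef
  have ex : x 1 * x 1 - 2 * (93 / 100 * p) = v * v + p * p + 2 * (p * (v - 93 / 100)) := by
    rw [hvdef]; ring
  have q1 : 88333 / 10 ^ 5 * (88333 / 10 ^ 5) ≤ v * v := by nlinarith
  have q2 : v * v ≤ 97559 / 10 ^ 5 * (97559 / 10 ^ 5) := by nlinarith
  have q3 : 0 ≤ p * p := mul_self_nonneg p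
  have q4 : p * p ≤ 787 / 10000 * (787 / 10000) := by nlinarith
  have q5 := mul_bounds h.abs_p (show |v - 93 / 100| ≤ 4667 / 10 ^ 5 by
    rw [abs_le]; constructor <;> linarith)
  have m13 : 0 ≤ x 1 * x 3 := mul_nonneg (by linarith) e3.1
  have M13 := h.mul_mem (i := 1) (j := 3) (by norm_num) (by norm_num) (by norm_num) (by norm_num)
  have m24 : -(20248 / 10 ^ 5 * (688 / 10 ^ 5)) ≤ x 2 * x 4 := by nlinarith
  have M24 := h.mul_mem (i := 2) (j := 4) (by norm_num) (by norm_num) (by norm_num) (by norm_num)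
  have M35 := h.mul_mem (i := 3) (j := 5) (by norm_num) (by norm_num) (by norm_num) (by norm_num)
  have M46 := h.mul_mem (i := 4) (j := 6) (by norm_num) (by norm_num) (by norm_num) (by norm_num)
  have M57 := h.mul_mem (i := 5) (j := 7) (by norm_num) (by norm_num) (by norm_num) (by norm_num)
  have M68 := h.mul_mem (i := 6) (j := 8) (by norm_num) (by norm_num) (by norm_num) (by norm_num)
  have M79 := h.mul_mem (i := 7) (j := 9) (by norm_num) (by norm_num) (by norm_num) (by norm_num)
  norm_num [boxBound] at q1 q2 q4 q5 M13 m24 M24 M35 M46 M57 M68 M79 hR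
  constructor <;> linarith

/-- The term 2 * (x 1 * x 2) dominates, and its positive lower bound keeps mode three nonnegative. A
lower end equal to 0 needs no upper bound on w. -/
theorem mode_three (h : LowBox x p) {R w : ℝ} (hR : |R| ≤ 2 * (589 / 10 ^ 5) * (43 / 10000))
    (hw1 : 10000 / 6855 ≤ w) :
    0 ≤ 2 * (x 1 * x 2) - 2 * (x 1 * x 4 + x 2 * x 5 + x 3 * x 6 + x 4 * x 7
      + x 5 * x 8 + x 6 * x 9) + R ∧
    2 * (x 1 * x 2) - 2 * (x 1 * x 4 + x 2 * x 5 + x 3 * x 6 + x 4 * x 7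
      + x 5 * x 8 + x 6 * x 9) + R ≤ 7747 / 10 ^ 5 * (4 * w) := by
  have hR := abs_le.mp hR
  have e1 := h.x1
  have e2 := h.x2
  have e3 := h.x3
  have e4 := h.x4
  have m12 := mul_le_mul e1.1 e2.1 (by norm_num) (by linarith)
  have M12 := h.mul_mem (i := 1) (j := 2) (by norm_num) (by norm_num) (by norm_num) (by norm_num)
  have m14 : -(105429 / 10 ^ 5 * (688 / 10 ^ 5)) ≤ x 1 * x 4 := by nlinarith
  have M14 := h.mul_mem (i := 1) (j := 4) (by norm_num) (by norm_num) (by norm_num) (by norm_num)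
  have M25 := h.mul_mem (i := 2) (j := 5) (by norm_num) (by norm_num) (by norm_num) (by norm_num)
  have M36 := h.mul_mem (i := 3) (j := 6) (by norm_num) (by norm_num) (by norm_num) (by norm_num)
  have M47 := h.mul_mem (i := 4) (j := 7) (by norm_num) (by norm_num) (by norm_num) (by norm_num)
  have M58 := h.mul_mem (i := 5) (j := 8) (by norm_num) (by norm_num) (by norm_num) (by norm_num)
  have M69 := h.mul_mem (i := 6) (j := 9) (by norm_num) (by norm_num) (by norm_num) (by norm_num)
  norm_num [boxBound] at m12 M12 m14 M14 M25 M36 M47 M58 M69 hR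
  constructor <;> linarith

/-- The first two terms are nonnegative, but x 1 * x 5 has no controlled sign, so the lower end is
slightly negative. A larger w only relaxes both ends. -/
theorem mode_four (h : LowBox x p) {R w : ℝ} (hR : |R| ≤ 2 * (1067 / 10 ^ 5) * (43 / 10000))
    (hw1 : 10000 / 6210 ≤ w) :
    -688 / 10 ^ 5 * (4 * w) ≤ 2 * (x 1 * x 3) + x 2 * x 2 - 2 * (x 1 * x 5 + x 2 * x 6 + x 3 * x 7
      + x 4 * x 8 + x 5 * x 9) + R ∧
    2 * (x 1 * x 3) + x 2 * x 2 - 2 * (x 1 * x 5 + x 2 * x 6 + x 3 * x 7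
      + x 4 * x 8 + x 5 * x 9) + R ≤ 3921 / 10 ^ 5 * (4 * w) := by
  have hR := abs_le.mp hR
  have e1 := h.x1
  have e2 := h.x2
  have e3 := h.x3
  have m13 : 0 ≤ x 1 * x 3 := mul_nonneg (by linarith) e3.1
  have M13 := h.mul_mem (i := 1) (j := 3) (by norm_num) (by norm_num) (by norm_num) (by norm_num)
  have m22 := mul_le_mul e2.1 e2.1 (by norm_num) (by linarith)
  have M22 := h.mul_mem (i := 2) (j := 2) (by norm_num) (by norm_num) (by norm_num) (by norm_num)
  have M15 := h.mul_mem (i := 1) (j := 5) (by norm_num) (by norm_num) (by norm_num) (by norm_num)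
  have M26 := h.mul_mem (i := 2) (j := 6) (by norm_num) (by norm_num) (by norm_num) (by norm_num)
  have M37 := h.mul_mem (i := 3) (j := 7) (by norm_num) (by norm_num) (by norm_num) (by norm_num)
  have M48 := h.mul_mem (i := 4) (j := 8) (by norm_num) (by norm_num) (by norm_num) (by norm_num)
  have M59 := h.mul_mem (i := 5) (j := 9) (by norm_num) (by norm_num) (by norm_num) (by norm_num)
  norm_num [boxBound] at m22 M13 M22 M15 M26 M37 M48 M59 hR
  constructor <;> linarith

end LowBox

/-! ### Explicit low mode sums -/

theorem sum_low_one {f : ℤ → ℝ} (hf : ∀ j, f (-j) = -f j) :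
    ∑ j ∈ Finset.Icc ((1 : ℤ) - 9) 9, f j * f (1 - j)
    = -2 * (f 1 * f 2 + f 2 * f 3 + f 3 * f 4 + f 4 * f 5 + f 5 * f 6
      + f 6 * f 7 + f 7 * f 8 + f 8 * f 9) := by
  have h0 : f 0 = 0 := by have := hf 0; simp at this; linarith
  rw [show Finset.Icc ((1 : ℤ) - 9) 9
    = {-8, -7, -6, -5, -4, -3, -2, -1, 0, 1, 2, 3, 4, 5, 6, 7, 8, 9} by decide]
  simp [Finset.sum_insert, hf, h0]
  ring

theorem sum_low_two {f : ℤ → ℝ} (hf : ∀ j, f (-j) = -f j) :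
    ∑ j ∈ Finset.Icc ((2 : ℤ) - 9) 9, f j * f (2 - j)
    = f 1 * f 1 - 2 * (f 1 * f 3 + f 2 * f 4 + f 3 * f 5 + f 4 * f 6
      + f 5 * f 7 + f 6 * f 8 + f 7 * f 9) := by
  have h0 : f 0 = 0 := by have := hf 0; simp at this; linarith
  rw [show Finset.Icc ((2 : ℤ) - 9) 9
    = {-7, -6, -5, -4, -3, -2, -1, 0, 1, 2, 3, 4, 5, 6, 7, 8, 9} by decide]
  simp [Finset.sum_insert, hf, h0]
  ring

theorem sum_low_three {f : ℤ → ℝ} (hf : ∀ j, f (-j) = -f j) :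
    ∑ j ∈ Finset.Icc ((3 : ℤ) - 9) 9, f j * f (3 - j)
    = 2 * (f 1 * f 2) - 2 * (f 1 * f 4 + f 2 * f 5 + f 3 * f 6 + f 4 * f 7
      + f 5 * f 8 + f 6 * f 9) := by
  have h0 : f 0 = 0 := by have := hf 0; simp at this; linarith
  rw [show Finset.Icc ((3 : ℤ) - 9) 9
    = {-6, -5, -4, -3, -2, -1, 0, 1, 2, 3, 4, 5, 6, 7, 8, 9} by decide]
  simp [Finset.sum_insert, hf, h0]
  ring

theorem sum_low_four {f : ℤ → ℝ} (hf : ∀ j, f (-j) = -f j) :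
    ∑ j ∈ Finset.Icc ((4 : ℤ) - 9) 9, f j * f (4 - j)
    = 2 * (f 1 * f 3) + f 2 * f 2 - 2 * (f 1 * f 5 + f 2 * f 6 + f 3 * f 7
      + f 4 * f 8 + f 5 * f 9) := by
  have h0 : f 0 = 0 := by have := hf 0; simp at this; linarith
  rw [show Finset.Icc ((4 : ℤ) - 9) 9
    = {-5, -4, -3, -2, -1, 0, 1, 2, 3, 4, 5, 6, 7, 8, 9} by decide]
  simp [Finset.sum_insert, hf, h0]
  ring

end FracBurgers

namespace FracBurgers

open Filter

/-! ### The periodic orbit in Fourier space -/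

/-- The symbol `|k|^{1+s}` of the dissipation. -/
noncomputable def rate (s : ℝ) (k : ℤ) : ℝ := |(k : ℝ)| * symbolWeight s k

theorem rate_neg (s : ℝ) (k : ℤ) : rate s (-k) = rate s k := by simp [rate, symbolWeight_neg]

theorem rate_one (s : ℝ) : rate s 1 = 1 := by simp [rate, symbolWeight]

theorem abs_cast_pos {k : ℤ} (hk : k ≠ 0) : 0 < |(k : ℝ)| := abs_pos.mpr (by exact_mod_cast hk)

theorem one_le_abs_cast {k : ℤ} (hk : k ≠ 0) : 1 ≤ |(k : ℝ)| := by
  rw [← Int.cast_abs]; exact_mod_cast Int.one_le_abs hk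

theorem symbolWeight_pos (s : ℝ) {k : ℤ} (hk : k ≠ 0) : 0 < symbolWeight s k :=
  Real.rpow_pos_of_pos (abs_cast_pos hk) s

theorem rate_pos (s : ℝ) {k : ℤ} (hk : k ≠ 0) : 0 < rate s k :=
  mul_pos (abs_cast_pos hk) (symbolWeight_pos s hk)

theorem one_le_rate {s : ℝ} (hs : 0 ≤ s) {k : ℤ} (hk : k ≠ 0) : 1 ≤ rate s k :=
  one_le_mul_of_one_le_of_one_le (one_le_abs_cast hk) (one_le_symbolWeight hs hk)

/-- The Fourier coefficients of the forcing. -/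
noncomputable def force (k : ℤ) (t : ℝ) : ℝ :=
  if k = 1 then 1 / 2 * Real.sin (2 * π * t) + 1
  else if k = -1 then -(1 / 2 * Real.sin (2 * π * t) + 1) else 0

theorem force_neg (k : ℤ) (t : ℝ) : force (-k) t = -force k t := by
  unfold force
  split_ifs <;> first | omega | simp

theorem continuous_force (k : ℤ) : Continuous (force k) := by
  unfold force
  split_ifs <;> fun_prop

theorem force_add_one (k : ℤ) (t : ℝ) : force k (t + 1) = force k t := by
  have : Real.sin (2 * π * (t + 1)) = Real.sin (2 * π * t) := by
    rw [mul_add, mul_one, Real.sin_add_two_pi]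
  simp only [force, this]

/-- The Fourier coefficients of `½ (u²)_x + g`. -/
noncomputable def source (u : ℤ → ℝ → ℝ) (k : ℤ) (t : ℝ) : ℝ :=
  (k / 4 : ℝ) * conv (fun j => u j t) (fun j => u j t) k + force k t

/-- The periodic response to the source generated by `u`. -/
noncomputable def orbitMap (s : ℝ) (u : ℤ → ℝ → ℝ) (k : ℤ) (t : ℝ) : ℝ :=
  periodicResponse (rate s k) (source u k) t

theorem continuous_conv {u v : ℤ → ℝ → ℝ} {a b : ℤ → ℝ} {C : ℝ} (hu : ∀ k, Continuous (u k))
    (hv : ∀ k, Continuous (v k)) (ha : Summable a) (hua : ∀ k t, |u k t| ≤ a k)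
    (hvb : ∀ k t, |v k t| ≤ b k) (hb : ∀ k, b k ≤ C) (k : ℤ) :
    Continuous fun t => conv (fun j => u j t) (fun j => v j t) k := by
  refine continuous_tsum (u := fun j => a j * C) (fun j => ?_) (ha.mul_right C) fun j t => ?_
  · exact (hu j).mul (hv _)
  · rw [Real.norm_eq_abs, abs_mul]
    exact mul_le_mul (hua j t) ((hvb _ t).trans (hb _)) (abs_nonneg _)
      ((abs_nonneg _).trans (hua j t))

theorem conv_odd {f g : ℤ → ℝ} (hf : ∀ j, f (-j) = -f j) (hg : ∀ j, g (-j) = -g j) (k : ℤ) :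
    conv f g (-k) = conv f g k := by
  rw [conv, conv, ← (Equiv.neg ℤ).tsum_eq]
  refine tsum_congr fun j => ?_
  have e : g (-k - -j) = -g (k - j) := by rw [← hg]; congr 1; ring
  simp only [Equiv.neg_apply, hf, e]
  ring

/-- The oscillation of the first mode caused by the forcing. -/
noncomputable def oscOne (t : ℝ) : ℝ :=
  periodicResponse 1 (fun s => 1 / 2 * Real.sin (2 * π * s)) t

/-- The main part of the oscillation of the second mode. -/
noncomputable def oscTwo (s : ℝ) (t : ℝ) : ℝ :=
  periodicResponse (rate s 2) (fun t => 93 / 100 * oscOne t) t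

theorem four_mul_pi_sq_gt : 394384 / 10000 < (2 * π) ^ 2 := by
  have := Real.pi_gt_d2
  nlinarith

theorem oscOne_eq (t : ℝ) : oscOne t = (1 * (1 / 2) + 2 * π * 0) / (1 ^ 2 + (2 * π) ^ 2)
    * Real.sin (2 * π * t)
    + (1 * 0 - 2 * π * (1 / 2)) / (1 ^ 2 + (2 * π) ^ 2) * Real.cos (2 * π * t) := by
  rw [← periodicResponse_harmonic one_pos, oscOne]
  simp

/-- The amplitude is (1/2)/√(1 + 4π²), about 0.0786. Only π > 3.14 is used. -/
theorem oscOne_amplitude :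
    ((1 * (1 / 2) + 2 * π * 0) / (1 ^ 2 + (2 * π) ^ 2)) ^ 2
      + ((1 * 0 - 2 * π * (1 / 2)) / (1 ^ 2 + (2 * π) ^ 2)) ^ 2 ≤ (787 / 10000) ^ 2 := by
  have h := four_mul_pi_sq_gt
  rw [harmonic_response_sq 1 (1 / 2) 0 one_pos, div_le_iff₀ (by positivity)]
  nlinarith

theorem abs_oscOne_le (t : ℝ) : |oscOne t| ≤ 787 / 10000 := by
  refine abs_le_of_sq_le_sq ?_ (by norm_num)
  rw [oscOne_eq]
  exact (harmonic_sq_le _ _ _).trans oscOne_amplitude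

theorem abs_oscTwo_le {s : ℝ} (hr : 20000 / 7880 ≤ rate s 2) (t : ℝ) :
    |oscTwo s t| ≤ 109 / 10000 := by
  have h := four_mul_pi_sq_gt
  have hpos : 0 < rate s 2 := by linarith
  refine abs_le_of_sq_le_sq ?_ (by norm_num)
  have hA := oscOne_amplitude
  have hE := oscOne_eq
  set A := (1 * (1 / 2) + 2 * π * 0) / (1 ^ 2 + (2 * π) ^ 2)
  set B := (1 * 0 - 2 * π * (1 / 2)) / (1 ^ 2 + (2 * π) ^ 2)
  have e : oscTwo s t = periodicResponse (rate s 2) (fun t => 93 / 100 * A * Real.sin (2 * π * t)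
      + 93 / 100 * B * Real.cos (2 * π * t)) t := by
    rw [oscTwo]
    congr 1
    ext t
    rw [hE]; ring
  rw [e, periodicResponse_harmonic hpos]
  refine (harmonic_sq_le _ _ _).trans ?_
  rw [harmonic_response_sq _ _ _ hpos, div_le_iff₀ (by positivity)]
  have : (20000 / 7880) ^ 2 ≤ rate s 2 ^ 2 := pow_le_pow_left₀ (by norm_num) hr 2
  nlinarith

theorem continuous_oscOne : Continuous oscOne :=
  continuous_periodicResponse (by fun_prop)

theorem continuous_oscTwo (s : ℝ) : Continuous (oscTwo s) :=
  continuous_periodicResponse (continuous_const.mul continuous_oscOne)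

theorem oscOne_add_one (t : ℝ) : oscOne (t + 1) = oscOne t :=
  periodicResponse_add_one (fun t => by rw [mul_add, mul_one, Real.sin_add_two_pi]) t

theorem oscTwo_add_one (s t : ℝ) : oscTwo s (t + 1) = oscTwo s t :=
  periodicResponse_add_one (fun t => by rw [oscOne_add_one]) t

/-- The set of coefficient functions in which the periodic orbit is sought. -/
structure OrbitBox (s : ℝ) (u : ℤ → ℝ → ℝ) : Prop where
  cont : ∀ k, Continuous (u k)
  periodic : ∀ k t, u k (t + 1) = u k t
  odd : ∀ k t, u (-k) t = -u k t
  bdd : ∀ k, ∃ C, ∀ t, |u k t| ≤ C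
  one : ∀ t, 88333 / 10 ^ 5 ≤ u 1 t - oscOne t ∧ u 1 t - oscOne t ≤ 97559 / 10 ^ 5
  two : ∀ t, 7366 / 10 ^ 5 ≤ u 2 t - oscTwo s t ∧ u 2 t - oscTwo s t ≤ 19158 / 10 ^ 5
  three : ∀ t, 0 ≤ u 3 t ∧ u 3 t ≤ 7747 / 10 ^ 5
  four : ∀ t, -688 / 10 ^ 5 ≤ u 4 t ∧ u 4 t ≤ 3921 / 10 ^ 5
  mid : ∀ n : ℕ, 5 ≤ n → n ≤ 9 → ∀ t, |u n t| ≤ boxBound n / 10 ^ 5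
  summable_tail : Summable fun n : ℕ => modeWeight (n + 10) * supAbs (u (n + 10))
  tail_le : ∑' n : ℕ, modeWeight (n + 10) * supAbs (u (n + 10)) ≤ tailBound

theorem symbolWeight_two_ge {s : ℝ} (hs : 11 / 32 ≤ s) : 10000 / 7880 ≤ symbolWeight s 2 :=
  le_symbolWeight hs (m := 2) (by norm_num) (by norm_num) (by norm_num)

theorem rate_two_ge {s : ℝ} (hs : 11 / 32 ≤ s) : 20000 / 7880 ≤ rate s 2 := by
  have := symbolWeight_two_ge hs
  rw [rate]
  norm_num at this ⊢
  linarith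

/-! ### The response map preserves the box and contracts on it -/

namespace OrbitBox

variable {s : ℝ} {u v : ℤ → ℝ → ℝ}

theorem zero (h : OrbitBox s u) (t : ℝ) : u 0 t = 0 := by
  have := h.odd 0 t
  simp at this
  linarith

theorem abs_le (h : OrbitBox s u) (k : ℤ) (t : ℝ) : |u k t| ≤ supAbs (u k) := by
  obtain ⟨C, hC⟩ := h.bdd k
  exact abs_le_supAbs hC t

theorem lowBox (h : OrbitBox s u) (hs : 11 / 32 ≤ s) (t : ℝ) :
    LowBox (fun n => u n t) (oscOne t) where
  abs_p := abs_oscOne_le t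
  v1 := h.one t
  x2 := by
    have h1 := _root_.abs_le.mp (abs_oscTwo_le (rate_two_ge hs) t)
    have h2 := h.two t
    simp only [Nat.cast_ofNat]
    constructor <;> linarith
  x3 := h.three t
  x4 := h.four t
  mid n h5 h9 := h.mid n h5 h9 t

theorem isBoxed (h : OrbitBox s u) (hs : 11 / 32 ≤ s) : IsBoxed 1 fun k => supAbs (u k) where
  nonneg k := supAbs_nonneg _
  even k := by
    rw [show u (-k) = fun t => -u k t from funext (h.odd k), supAbs_neg]
  zero := by
    rw [show u 0 = fun _ => 0 from funext h.zero]
    simp [supAbs]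
  low n h1 h9 := by
    rw [one_mul]
    exact supAbs_le fun t => (h.lowBox hs t).abs_le_boxBound h1 h9
  summable_tail := h.summable_tail.of_nonneg_of_le (fun _ => supAbs_nonneg _) fun n =>
    le_mul_of_one_le_left (supAbs_nonneg _) (one_le_modeWeight _)
  tail_le := by
    refine le_trans ?_ h.tail_le
    refine Summable.tsum_le_tsum (fun n =>
      le_mul_of_one_le_left (supAbs_nonneg _) (one_le_modeWeight _)) ?_ h.summable_tail
    exact h.summable_tail.of_nonneg_of_le (fun _ => supAbs_nonneg _) fun n =>
      le_mul_of_one_le_left (supAbs_nonneg _) (one_le_modeWeight _)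

theorem summable_abs (h : OrbitBox s u) (hs : 11 / 32 ≤ s) (t : ℝ) :
    Summable fun k => |u k t| :=
  (h.isBoxed hs).summable.of_nonneg_of_le (fun _ => abs_nonneg _) fun k => h.abs_le k t

theorem supAbs_le_tsum (h : OrbitBox s u) (hs : 11 / 32 ≤ s) (k : ℤ) :
    supAbs (u k) ≤ ∑' j, supAbs (u j) :=
  le_tsum_of_nonneg (fun _ => supAbs_nonneg _) (h.isBoxed hs).summable k

theorem continuous_conv_self (h : OrbitBox s u) (hs : 11 / 32 ≤ s) (k : ℤ) :
    Continuous fun t => conv (fun j => u j t) (fun j => u j t) k :=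
  continuous_conv h.cont h.cont (h.isBoxed hs).summable h.abs_le h.abs_le (h.supAbs_le_tsum hs) k

theorem abs_conv_self_le (h : OrbitBox s u) (hs : 11 / 32 ≤ s) (k : ℤ) (t : ℝ) :
    |conv (fun j => u j t) (fun j => u j t) k|
      ≤ conv (fun j => supAbs (u j)) (fun j => supAbs (u j)) k :=
  abs_conv_le (fun j => h.abs_le j t) (fun j => h.abs_le j t) (h.isBoxed hs).summable
    (h.supAbs_le_tsum hs) k

theorem continuous_source (h : OrbitBox s u) (hs : 11 / 32 ≤ s) (k : ℤ) :
    Continuous (source u k) := by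
  unfold source
  exact (continuous_const.mul (h.continuous_conv_self hs k)).add (continuous_force k)

theorem source_add_one (h : OrbitBox s u) (k : ℤ) (t : ℝ) : source u k (t + 1) = source u k t := by
  simp only [source, h.periodic, force_add_one]

theorem source_neg (h : OrbitBox s u) (k : ℤ) (t : ℝ) : source u (-k) t = -source u k t := by
  simp only [source, force_neg,
    conv_odd (f := fun j => u j t) (g := fun j => u j t) (fun j => h.odd j t) (fun j => h.odd j t)]
  push_cast; ring

theorem source_zero (u : ℤ → ℝ → ℝ) (t : ℝ) : source u 0 t = 0 := by
  simp [source, force]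

/-- The part of the self-interaction that does not involve products of two low modes. -/
theorem abs_remainder_le (h : OrbitBox s u) (hs : 11 / 32 ≤ s) {k : ℤ} {m c : ℕ}
    (hm : (m : ℤ) = 10 - k) (hm1 : 1 ≤ m) (hc : ∀ n ∈ Finset.Icc m 9, boxBound n ≤ c)
    (h430 : 430 ≤ c) (t : ℝ) :
    |conv (fun j => u j t) (fun j => u j t) k - ∑ j ∈ Finset.Icc (k - 9) 9, u j t * u (k - j) t|
      ≤ 2 * (c / 10 ^ 5) * (43 / 10000) :=
  (h.isBoxed hs).abs_conv_sub_le (fun j => h.abs_le j t) k fun i hi =>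
    (h.isBoxed hs).le_of_le hm1 hc h430 i (by omega)

/-- By linearity the sinusoidal forcing is removed exactly through `oscOne`. The remaining source 1
+ (u * u)₁/4 is trapped in the interval of the box, and the rate of this mode is 1. -/
theorem orbitMap_one (h : OrbitBox s u) (hs : 11 / 32 ≤ s) (t : ℝ) :
    88333 / 10 ^ 5 ≤ orbitMap s u 1 t - oscOne t ∧
      orbitMap s u 1 t - oscOne t ≤ 97559 / 10 ^ 5 := by
  have hc : Continuous fun t => 1 / 2 * Real.sin (2 * π * t) := by fun_prop
  have hd := h.continuous_source hs 1
  rw [orbitMap, rate_one, oscOne, ← periodicResponse_sub hd hc]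
  have key : ∀ t, 88333 / 10 ^ 5 ≤ source u 1 t - 1 / 2 * Real.sin (2 * π * t) ∧
      source u 1 t - 1 / 2 * Real.sin (2 * π * t) ≤ 97559 / 10 ^ 5 := fun t => by
    have hR := h.abs_remainder_le hs (k := 1) (m := 9) (c := 430) (by norm_num) (by norm_num)
      (by decide) le_rfl t
    have h1 := (h.lowBox hs t).mode_one (R := conv (fun j => u j t) (fun j => u j t) 1
      - ∑ j ∈ Finset.Icc ((1 : ℤ) - 9) 9, u j t * u (1 - j) t) (by simpa only [Nat.cast_ofNat] using hR)
    rw [sum_low_one (f := fun j => u j t) fun j => h.odd j t] at h1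
    simp only [source, force, if_true, Int.cast_one]
    simp only [Nat.cast_ofNat, Nat.cast_one] at h1
    constructor <;> linarith [h1.1, h1.2]
  have l := le_periodicResponse one_pos (hd.sub hc) (fun t => (key t).1) t
  have r := periodicResponse_le one_pos (hd.sub hc) (fun t => (key t).2) t
  rw [div_one] at l r
  exact ⟨l, r⟩

theorem orbitMap_two (h : OrbitBox s u) (hs : 11 / 32 ≤ s) (hs1 : s ≤ 1) (t : ℝ) :
    7366 / 10 ^ 5 ≤ orbitMap s u 2 t - oscTwo s t ∧
      orbitMap s u 2 t - oscTwo s t ≤ 19158 / 10 ^ 5 := by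
  have hc : Continuous fun t => 93 / 100 * oscOne t := continuous_const.mul continuous_oscOne
  have hd := h.continuous_source hs 2
  have hr := rate_pos s (k := 2) (by norm_num)
  have er : rate s 2 = 2 * symbolWeight s 2 := by simp [rate]
  rw [orbitMap, oscTwo, ← periodicResponse_sub hd hc]
  have key : ∀ t, 7366 / 10 ^ 5 * rate s 2 ≤ source u 2 t - 93 / 100 * oscOne t ∧
      source u 2 t - 93 / 100 * oscOne t ≤ 19158 / 10 ^ 5 * rate s 2 := fun t => by
    have hR := h.abs_remainder_le hs (k := 2) (m := 8) (c := 430) (by norm_num) (by norm_num)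
      (by decide) le_rfl t
    have h1 := (h.lowBox hs t).mode_two (w := symbolWeight s 2) (R := conv (fun j => u j t) (fun j => u j t) 2
      - ∑ j ∈ Finset.Icc ((2 : ℤ) - 9) 9, u j t * u (2 - j) t) (by simpa only [Nat.cast_ofNat] using hR)
      (symbolWeight_two_ge hs) (by exact_mod_cast symbolWeight_le hs1 (m := 2) (by norm_num))
    rw [sum_low_two (f := fun j => u j t) fun j => h.odd j t] at h1
    simp only [source, force]
    norm_num at h1 ⊢
    rw [er]
    constructor <;> linarith [h1.1, h1.2]
  have l := le_periodicResponse hr (hd.sub hc) (fun t => (key t).1) t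
  have r := periodicResponse_le hr (hd.sub hc) (fun t => (key t).2) t
  rw [mul_div_cancel_right₀ _ hr.ne'] at l r
  exact ⟨l, r⟩

theorem orbitMap_three (h : OrbitBox s u) (hs : 11 / 32 ≤ s) (t : ℝ) :
    0 ≤ orbitMap s u 3 t ∧ orbitMap s u 3 t ≤ 7747 / 10 ^ 5 := by
  have hd := h.continuous_source hs 3
  have hr := rate_pos s (k := 3) (by norm_num)
  have er : rate s 3 = 3 * symbolWeight s 3 := by simp [rate]
  have key : ∀ t, 0 * rate s 3 ≤ source u 3 t ∧
      source u 3 t ≤ 7747 / 10 ^ 5 * rate s 3 := fun t => by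
    have hR := h.abs_remainder_le hs (k := 3) (m := 7) (c := 589) (by norm_num) (by norm_num)
      (by decide) (by norm_num) t
    have h1 := (h.lowBox hs t).mode_three (w := symbolWeight s 3) (R := conv (fun j => u j t) (fun j => u j t) 3
      - ∑ j ∈ Finset.Icc ((3 : ℤ) - 9) 9, u j t * u (3 - j) t) (by simpa only [Nat.cast_ofNat] using hR)
      (le_symbolWeight hs (m := 3) (by norm_num) (by norm_num) (by norm_num))
    rw [sum_low_three (f := fun j => u j t) fun j => h.odd j t] at h1
    simp only [source, force]
    norm_num at h1 ⊢
    rw [er]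
    constructor <;> linarith [h1.1, h1.2]
  have l := le_periodicResponse hr hd (fun t => (key t).1) t
  have r := periodicResponse_le hr hd (fun t => (key t).2) t
  rw [mul_div_cancel_right₀ _ hr.ne'] at l r
  exact ⟨l, r⟩

theorem orbitMap_four (h : OrbitBox s u) (hs : 11 / 32 ≤ s) (t : ℝ) :
    -688 / 10 ^ 5 ≤ orbitMap s u 4 t ∧ orbitMap s u 4 t ≤ 3921 / 10 ^ 5 := by
  have hd := h.continuous_source hs 4
  have hr := rate_pos s (k := 4) (by norm_num)
  have er : rate s 4 = 4 * symbolWeight s 4 := by simp [rate]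
  have key : ∀ t, -688 / 10 ^ 5 * rate s 4 ≤ source u 4 t ∧
      source u 4 t ≤ 3921 / 10 ^ 5 * rate s 4 := fun t => by
    have hR := h.abs_remainder_le hs (k := 4) (m := 6) (c := 1067) (by norm_num) (by norm_num)
      (by decide) (by norm_num) t
    have h1 := (h.lowBox hs t).mode_four (w := symbolWeight s 4) (R := conv (fun j => u j t) (fun j => u j t) 4
      - ∑ j ∈ Finset.Icc ((4 : ℤ) - 9) 9, u j t * u (4 - j) t) (by simpa only [Nat.cast_ofNat] using hR)
      (le_symbolWeight hs (m := 4) (by norm_num) (by norm_num) (by norm_num))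
    rw [sum_low_four (f := fun j => u j t) fun j => h.odd j t] at h1
    simp only [source, force]
    norm_num at h1 ⊢
    rw [er]
    constructor <;> linarith [h1.1, h1.2]
  have l := le_periodicResponse hr hd (fun t => (key t).1) t
  have r := periodicResponse_le hr hd (fun t => (key t).2) t
  rw [mul_div_cancel_right₀ _ hr.ne'] at l r
  exact ⟨l, r⟩

/-- The forcing acts only on k = ±1. Dividing k/4 by the rate |k|^(1+s) cancels the derivative and
leaves the gain |k|^(-s). -/
theorem abs_orbitMap_le (h : OrbitBox s u) (hs : 11 / 32 ≤ s) {k : ℤ} (hk : 2 ≤ k) (t : ℝ) :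
    |orbitMap s u k t|
      ≤ (4 * symbolWeight s k)⁻¹ * conv (fun j => supAbs (u j)) (fun j => supAbs (u j)) k := by
  have hk0 : k ≠ 0 := by omega
  have hp := abs_cast_pos hk0
  have hw := symbolWeight_pos s hk0
  refine (abs_periodicResponse_le (rate_pos s hk0) (h.continuous_source hs k) (M :=
    |(k : ℝ)| / 4 * conv (fun j => supAbs (u j)) (fun j => supAbs (u j)) k) (fun t => ?_) t).trans
    (le_of_eq ?_)
  · rw [source, force, if_neg (by omega), if_neg (by omega), add_zero, abs_mul, abs_div,
      abs_of_pos (show (0 : ℝ) < 4 by norm_num)]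
    exact mul_le_mul_of_nonneg_left (h.abs_conv_self_le hs k t) (by positivity)
  · rw [rate]; field_simp

theorem orbitMap_mem (h : OrbitBox s u) (hs : 11 / 32 ≤ s) (hs1 : s ≤ 1) :
    OrbitBox s (orbitMap s u) := by
  have hB := h.isBoxed hs
  have hodd : ∀ k t, orbitMap s u (-k) t = -orbitMap s u k t := fun k t => by
    rw [orbitMap, orbitMap, rate_neg, show source u (-k) = fun t => -source u k t from
      funext (h.source_neg k), periodicResponse_neg]
  have hper : ∀ k t, orbitMap s u k (t + 1) = orbitMap s u k t := fun k t =>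
    periodicResponse_add_one (h.source_add_one k) t
  have hcont : ∀ k, Continuous (orbitMap s u k) := fun k =>
    continuous_periodicResponse (h.continuous_source hs k)
  have hbdd : ∀ k, ∃ C, ∀ t, |orbitMap s u k t| ≤ C := fun k => by
    have hP : Function.Periodic (orbitMap s u k) 1 := hper k
    obtain ⟨C, hC⟩ := (isCompact_Icc (a := (0 : ℝ)) (b := 1)).exists_bound_of_continuousOn
      (hcont k).continuousOn
    refine ⟨C, fun t => ?_⟩
    obtain ⟨t', ht', e⟩ := hP.exists_mem_Ico₀ one_pos t
    rw [e]
    exact hC t' ⟨ht'.1, ht'.2.le⟩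
  obtain ⟨hs', ht'⟩ := hB.conv_tail_le h.summable_tail h.tail_le
  set c := conv (fun j => supAbs (u j)) (fun j => supAbs (u j)) with hc
  -- On the tail the gain is uniformly at most that of k = 10, where 10^(11/32) ≥ 10000/4532. This
  -- is the constant in `IsBoxed.conv_tail_le`.
  have hle : ∀ n : ℕ, modeWeight (n + 10) * supAbs (orbitMap s u (n + 10))
      ≤ (4 * (10000 / 4532))⁻¹ * (modeWeight (n + 10) * c (n + 10)) := fun n => by
    have hc0 : 0 ≤ c (n + 10) := conv_nonneg (fun _ => supAbs_nonneg _)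
      (fun _ => supAbs_nonneg _) _
    have h1 : supAbs (orbitMap s u (n + 10)) ≤ (4 * (10000 / 4532))⁻¹ * c (n + 10) := by
      refine supAbs_le fun t => (h.abs_orbitMap_le hs (by omega) t).trans ?_
      refine mul_le_mul_of_nonneg_right ?_ hc0
      have : (10000 / 4532 : ℝ) ≤ symbolWeight s (n + 10) :=
        le_symbolWeight hs (m := 10) (by norm_num) (by norm_num) (by push_cast; omega)
      gcongr
    calc _ ≤ modeWeight (n + 10) * ((4 * (10000 / 4532))⁻¹ * c (n + 10)) :=
          mul_le_mul_of_nonneg_left h1 (zero_le_one.trans (one_le_modeWeight _))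
      _ = _ := by ring
  have hsum : Summable fun n : ℕ => modeWeight (n + 10) * supAbs (orbitMap s u (n + 10)) :=
    (hs'.mul_left _).of_nonneg_of_le
      (fun n => mul_nonneg (zero_le_one.trans (one_le_modeWeight _)) (supAbs_nonneg _)) hle
  refine ⟨hcont, hper, hodd, hbdd, h.orbitMap_one hs, h.orbitMap_two hs hs1,
    h.orbitMap_three hs, h.orbitMap_four hs, fun n h5 h9 t => ?_, hsum, ?_⟩
  · have hw := symbolWeight_pos s (k := n) (by omega)
    refine (h.abs_orbitMap_le hs (by omega) t).trans ?_
    rw [inv_mul_le_iff₀ (by positivity)]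
    exact hB.conv_le_mid hs h5 h9
  · refine (hsum.tsum_le_tsum hle (hs'.mul_left _)).trans ?_
    rw [tsum_mul_left, inv_mul_le_iff₀ (by norm_num)]
    exact ht'

/-- The difference of the squares splits into two convolutions with u - v. Each is bounded by the
row estimate with 2 · 0.98 · |k|^s, and the prefactor |k|/4 divided by the rate turns their sum into
exactly 0.98. -/
theorem abs_orbitMap_sub_le (hu : OrbitBox s u) (hv : OrbitBox s v) (hs : 11 / 32 ≤ s) {C : ℝ}
    (hC : 0 ≤ C) (h : ∀ k t, |u k t - v k t| ≤ C * testSeq k) (k : ℤ) (t : ℝ) :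
    |orbitMap s u k t - orbitMap s v k t| ≤ 98 / 100 * C * testSeq k := by
  by_cases hk : k = 0
  · subst hk
    simp [orbitMap, testSeq_zero, funext (source_zero u),
      funext (source_zero v)]
  have hp := abs_cast_pos hk
  have hw := symbolWeight_pos s hk
  have hPC : ∀ j, C * testSeq j ≤ C * (108 / 100) := fun j =>
    mul_le_mul_of_nonneg_left (testSeq_le j) hC
  have row : ∀ {w : ℤ → ℝ → ℝ}, OrbitBox s w → ∀ t,
      |conv (fun j => u j t - v j t) (fun j => w j t) k|
        ≤ C * (2 * (98 / 100) * symbolWeight s k * testSeq k) := fun {w} hw t => by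
    have hB := hw.isBoxed hs
    have hB' : IsBoxed (10001 / 10000) fun k => supAbs (w k) := by
      have := hB.weighted hw.summable_tail hw.tail_le (r := fun _ => 1) (fun _ => le_rfl)
        (fun _ => rfl) one_le_modeWeight
      simpa using this
    rw [conv_comm]
    refine (abs_conv_le (fun j => hw.abs_le j t) (fun j => h j t) hB.summable hPC k).trans ?_
    have e : conv (fun j => supAbs (w j)) (fun j => C * testSeq j) k
        = C * conv (fun j => supAbs (w j)) testSeq k := by
      rw [conv, conv, ← tsum_mul_left]
      exact tsum_congr fun j => by ring
    rw [e]
    exact mul_le_mul_of_nonneg_left (hB'.conv_testSeq_le hs hk) hC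
  rw [orbitMap, orbitMap, ← periodicResponse_sub (hu.continuous_source hs k)
    (hv.continuous_source hs k)]
  refine (abs_periodicResponse_le (rate_pos s hk) (M := |(k : ℝ)| * (symbolWeight s k
    * (98 / 100 * C * testSeq k))) ((hu.continuous_source hs k).sub
    (hv.continuous_source hs k)) (fun t => ?_) t).trans (le_of_eq ?_)
  · have e : source u k t - source v k t = (k / 4 : ℝ) *
        (conv (fun j => u j t - v j t) (fun j => u j t) k
          + conv (fun j => u j t - v j t) (fun j => v j t) k) := by
      rw [← conv_self_sub_conv_self (hu.summable_abs hs t) (hv.summable_abs hs t), source, source]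
      ring
    rw [Pi.sub_apply, e, abs_mul, abs_div, abs_of_pos (show (0 : ℝ) < 4 by norm_num),
      div_mul_eq_mul_div,
      mul_div_assoc]
    refine mul_le_mul_of_nonneg_left ?_ hp.le
    have h1 := (abs_add_le _ _).trans (add_le_add (row hu t) (row hv t))
    linarith
  · rw [rate]; field_simp

/-- Uniform convergence of each mode passes suprema in time to the limit. The tail condition
survives because each of its finite partial sums does. -/
theorem of_tendstoUniformly {x : ℕ → ℤ → ℝ → ℝ} {w : ℤ → ℝ → ℝ} (hx : ∀ n, OrbitBox s (x n))
    (h : ∀ k, TendstoUniformly (fun n => x n k) (w k) atTop) : OrbitBox s w := by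
  have hp : ∀ k t, Tendsto (fun n => x n k t) atTop (𝓝 (w k t)) := fun k t =>
    (h k).tendsto_at t
  have hb := fun k => tendsto_supAbs (fun n => (hx n).bdd k) (h k)
  have hfin : ∀ F : Finset ℕ, ∑ n ∈ F, modeWeight (n + 10) * supAbs (w (n + 10)) ≤ tailBound :=
    fun F => by
    refine le_of_tendsto (tendsto_finsetSum F fun n _ => (hb (n + 10)).2.const_mul _)
      (Eventually.of_forall fun m => ?_)
    exact ((hx m).summable_tail.sum_le_tsum F fun n _ => mul_nonneg
      (zero_le_one.trans (one_le_modeWeight _)) (supAbs_nonneg _)).trans (hx m).tail_le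
  have hsum : Summable fun n : ℕ => modeWeight (n + 10) * supAbs (w (n + 10)) :=
    summable_of_sum_le (fun n => mul_nonneg
      (zero_le_one.trans (one_le_modeWeight _)) (supAbs_nonneg _)) hfin
  exact {
    cont := fun k => (h k).continuous (Eventually.of_forall fun n => (hx n).cont k).frequently
    periodic := fun k t => tendsto_nhds_unique (hp k (t + 1))
      ((hp k t).congr fun n => ((hx n).periodic k t).symm)
    odd := fun k t => tendsto_nhds_unique (hp (-k) t)
      ((hp k t).neg.congr fun n => ((hx n).odd k t).symm)
    bdd := fun k => (hb k).1
    one := fun t => ⟨ge_of_tendsto' ((hp 1 t).sub_const _) fun n => ((hx n).one t).1,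
      le_of_tendsto' ((hp 1 t).sub_const _) fun n => ((hx n).one t).2⟩
    two := fun t => ⟨ge_of_tendsto' ((hp 2 t).sub_const _) fun n => ((hx n).two t).1,
      le_of_tendsto' ((hp 2 t).sub_const _) fun n => ((hx n).two t).2⟩
    three := fun t => ⟨ge_of_tendsto' (hp 3 t) fun n => ((hx n).three t).1,
      le_of_tendsto' (hp 3 t) fun n => ((hx n).three t).2⟩
    four := fun t => ⟨ge_of_tendsto' (hp 4 t) fun n => ((hx n).four t).1,
      le_of_tendsto' (hp 4 t) fun n => ((hx n).four t).2⟩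
    mid := fun m h5 h9 t => le_of_tendsto' (hp m t).abs fun n => (hx n).mid m h5 h9 t
    summable_tail := hsum
    tail_le := hsum.tsum_le_of_sum_le hfin }

end OrbitBox

/-- A simple element of the box. -/
noncomputable def boxCenter (s : ℝ) (k : ℤ) (t : ℝ) : ℝ :=
  if k = 1 then oscOne t + 9 / 10 else if k = -1 then -(oscOne t + 9 / 10)
  else if k = 2 then oscTwo s t + 1 / 10 else if k = -2 then -(oscTwo s t + 1 / 10) else 0

theorem boxCenter_eq_zero (s : ℝ) {k : ℤ} (hk : 3 ≤ k) : boxCenter s k = fun _ => 0 := by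
  ext t
  rw [boxCenter, if_neg, if_neg, if_neg, if_neg] <;> omega

theorem orbitBox_boxCenter {s : ℝ} (hs : 11 / 32 ≤ s) : OrbitBox s (boxCenter s) := by
  have h0 : ∀ n : ℕ, supAbs (boxCenter s (n + 10)) = 0 := fun n => by
    rw [boxCenter_eq_zero s (by omega)]; simp [supAbs]
  have c1 := continuous_oscOne
  have c2 := continuous_oscTwo s
  refine ⟨fun k => ?_, fun k t => ?_, fun k t => ?_, fun k => ⟨1, fun t => ?_⟩, fun t => ?_,
    fun t => ?_, fun t => ?_, fun t => ?_, fun n h5 h9 t => ?_, ?_, ?_⟩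
  · unfold boxCenter
    split_ifs <;> fun_prop
  · simp only [boxCenter, oscOne_add_one, oscTwo_add_one]
  · unfold boxCenter
    split_ifs <;> first | omega | simp
  · have h1 := abs_le.mp (abs_oscOne_le t)
    have h2 := abs_le.mp (abs_oscTwo_le (rate_two_ge hs) t)
    unfold boxCenter
    split_ifs <;> rw [abs_le] <;> constructor <;> linarith
  · simp only [boxCenter, if_true]; norm_num
  · simp [boxCenter]; norm_num
  · rw [boxCenter_eq_zero s (by norm_num)]; norm_num
  · rw [boxCenter_eq_zero s (by norm_num)]; norm_num
  · rw [boxCenter_eq_zero s (by omega)]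
    simp only [abs_zero]; positivity
  · simp only [h0, mul_zero]; exact summable_zero
  · simp only [h0, mul_zero, tsum_zero, tailBound]; norm_num

/-- The Fourier coefficients of the periodic orbit. -/
theorem exists_orbit {s : ℝ} (hs : 11 / 32 ≤ s) (hs1 : s ≤ 1) :
    ∃ u, OrbitBox s u ∧ ∀ k t₀ t, u k t = Real.exp (-rate s k * (t - t₀)) * u k t₀
      + ∫ r in t₀..t, Real.exp (-rate s k * (t - r)) * source u k r := by
  have h₀ := orbitBox_boxCenter hs
  have h₁ := h₀.orbitMap_mem hs hs1
  have h₂ : ∀ k t, |orbitMap s (boxCenter s) k t - boxCenter s k t|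
      ≤ (∑' k, supAbs (orbitMap s (boxCenter s) k) + ∑' k, supAbs (boxCenter s k)) * testSeq k :=
    fun k t => by
    by_cases hk : k = 0
    · subst hk
      simp [h₁.zero, h₀.zero, testSeq_zero]
    · have hM : |orbitMap s (boxCenter s) k t - boxCenter s k t|
          ≤ ∑' k, supAbs (orbitMap s (boxCenter s) k) + ∑' k, supAbs (boxCenter s k) :=
        (abs_sub _ _).trans (add_le_add ((h₁.abs_le k t).trans (h₁.supAbs_le_tsum hs k))
          ((h₀.abs_le k t).trans (h₀.supAbs_le_tsum hs k)))
      exact hM.trans (le_mul_of_one_le_right ((abs_nonneg _).trans hM) (one_le_testSeq hk))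
  obtain ⟨u, hu, e⟩ := exists_fixedPoint_of_weighted_contraction (S := {u | OrbitBox s u})
    (Φ := orbitMap s) (by norm_num) (by norm_num) (fun u hu => hu.orbitMap_mem hs hs1)
    (fun u hu v hv C hC h k t => hu.abs_orbitMap_sub_le hv hs hC h k t) h₀
    (add_nonneg (tsum_nonneg fun _ => supAbs_nonneg _) (tsum_nonneg fun _ => supAbs_nonneg _))
    h₂ (fun x w hx h => OrbitBox.of_tendstoUniformly hx h)
  refine ⟨u, hu, fun k t₀ t => ?_⟩
  by_cases hk : k = 0
  · subst hk
    simp [hu.zero, OrbitBox.source_zero]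
  · have := periodicResponse_duhamel (rate_pos s hk) (hu.continuous_source hs k)
      (hu.source_add_one k) t₀ t
    rwa [← orbitMap, ← orbitMap, e] at this

end FracBurgers

namespace FracBurgers

open Filter

/-! ### Weights for the stability estimate -/

/-- A submultiplicative weight whose square, multiplied by `|k|^s`, is comparable to `k⁴`. -/
noncomputable def sobolevWeight (s : ℝ) (k : ℤ) : ℝ := (1 + |(k : ℝ)| / 10 ^ 6) ^ (2 - s / 2)

/-- The weight of the energy `∑ ω_k sup |z_k|²`. -/
noncomputable def energyWeight (s : ℝ) (k : ℤ) : ℝ := symbolWeight s k * sobolevWeight s k ^ 2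

theorem one_le_base (k : ℤ) : 1 ≤ 1 + |(k : ℝ)| / 10 ^ 6 := by
  have : 0 ≤ |(k : ℝ)| / 10 ^ 6 := by positivity
  linarith

theorem isWeight_sobolevWeight {s : ℝ} (hs1 : s ≤ 1) : IsWeight (sobolevWeight s) where
  one_le k := Real.one_le_rpow (one_le_base k) (by linarith)
  le_mul j k := by
    rw [sobolevWeight, sobolevWeight, sobolevWeight, ← Real.mul_rpow (by positivity)
      (by positivity)]
    exact Real.rpow_le_rpow (by positivity) (base_le_mul j k) (by linarith)

theorem sobolevWeight_pos (s : ℝ) (k : ℤ) : 0 < sobolevWeight s k :=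
  Real.rpow_pos_of_pos (by positivity) _

theorem sobolevWeight_neg (s : ℝ) (k : ℤ) : sobolevWeight s (-k) = sobolevWeight s k := by
  simp [sobolevWeight]

theorem sobolevWeight_le {s : ℝ} (hs : 0 ≤ s) (k : ℤ) : sobolevWeight s k ≤ modeWeight k := by
  rw [modeWeight, ← Real.rpow_natCast]
  exact Real.rpow_le_rpow_of_exponent_le (one_le_base k) (by push_cast; linarith)

theorem symbolWeight_zero {s : ℝ} (hs : s ≠ 0) : symbolWeight s 0 = 0 := by
  simp [symbolWeight, Real.zero_rpow hs]

theorem symbolWeight_nonneg (s : ℝ) (k : ℤ) : 0 ≤ symbolWeight s k := by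
  rw [symbolWeight]; positivity

theorem energyWeight_nonneg (s : ℝ) (k : ℤ) : 0 ≤ energyWeight s k :=
  mul_nonneg (symbolWeight_nonneg s k) (sq_nonneg _)

theorem energyWeight_eq (s : ℝ) (k : ℤ) :
    energyWeight s k = |(k : ℝ)| ^ s * (1 + |(k : ℝ)| / 10 ^ 6) ^ (4 - s) := by
  rw [energyWeight, symbolWeight, sobolevWeight, ← Real.rpow_natCast, ← Real.rpow_mul
    (by positivity)]
  congr 2
  push_cast
  ring

/-- The factor 10^24 = (10^6)^4 is the price of a weight that is nearly flat on the low modes. It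
affects only the constants δ and D. -/
theorem pow_four_le_energyWeight {s : ℝ} (hs : 0 ≤ s) (hs1 : s ≤ 1) (k : ℤ) :
    (k : ℝ) ^ 4 ≤ 10 ^ 24 * energyWeight s k := by
  by_cases hk : k = 0
  · subst hk
    have := energyWeight_nonneg s 0
    norm_num
    positivity
  have hp := abs_cast_pos hk
  have h1 : (|(k : ℝ)| / 10 ^ 6) ^ (4 - s) ≤ (1 + |(k : ℝ)| / 10 ^ 6) ^ (4 - s) :=
    Real.rpow_le_rpow (by positivity) (by linarith) (by linarith)
  have h2 : (10 ^ 6 : ℝ) ^ (4 - s) ≤ 10 ^ 24 := by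
    refine (Real.rpow_le_rpow_of_exponent_le (by norm_num) (show 4 - s ≤ (4 : ℕ) by
      push_cast; linarith)).trans (le_of_eq ?_)
    rw [Real.rpow_natCast]; norm_num
  rw [Real.div_rpow hp.le (by positivity), div_le_iff₀ (by positivity)] at h1
  have h3 : |(k : ℝ)| ^ s * |(k : ℝ)| ^ (4 - s) = (k : ℝ) ^ 4 := by
    rw [← Real.rpow_add hp, add_sub_cancel, show (4 : ℝ) = (4 : ℕ) by norm_num, Real.rpow_natCast,
      Even.pow_abs (by decide)]
  rw [energyWeight_eq, ← h3]
  have h4 : 0 ≤ |(k : ℝ)| ^ s := by positivity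
  have h5 : 0 ≤ (1 + |(k : ℝ)| / 10 ^ 6) ^ (4 - s) := by positivity
  calc _ ≤ |(k : ℝ)| ^ s * ((1 + |(k : ℝ)| / 10 ^ 6) ^ (4 - s) * 10 ^ 24) := by
        refine mul_le_mul_of_nonneg_left (h1.trans ?_) h4
        exact mul_le_mul_of_nonneg_left h2 h5
    _ = _ := by ring

theorem energyWeight_le {s : ℝ} (hs : 0 < s) (hs1 : s ≤ 1) (k : ℤ) :
    energyWeight s k ≤ 16 * (k : ℝ) ^ 4 := by
  by_cases hk : k = 0
  · subst hk
    simp [energyWeight, symbolWeight_zero hs.ne']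
  have hp := abs_cast_pos hk
  have h1 := one_le_abs_cast hk
  have h2 : (1 + |(k : ℝ)| / 10 ^ 6) ^ (4 - s) ≤ (2 * |(k : ℝ)|) ^ (4 - s) := by
    refine Real.rpow_le_rpow (by positivity) ?_ (by linarith)
    have : |(k : ℝ)| / 10 ^ 6 ≤ |(k : ℝ)| := div_le_self hp.le (by norm_num)
    linarith
  rw [Real.mul_rpow (by norm_num) hp.le] at h2
  have h3 : |(k : ℝ)| ^ s * |(k : ℝ)| ^ (4 - s) = (k : ℝ) ^ 4 := by
    rw [← Real.rpow_add hp, add_sub_cancel, show (4 : ℝ) = (4 : ℕ) by norm_num, Real.rpow_natCast,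
      Even.pow_abs (by decide)]
  have h4 : (2 : ℝ) ^ (4 - s) ≤ 16 := by
    refine (Real.rpow_le_rpow_of_exponent_le (by norm_num) (show 4 - s ≤ (4 : ℕ) by
      push_cast; linarith)).trans (le_of_eq ?_)
    rw [Real.rpow_natCast]; norm_num
  have h5 : 0 ≤ |(k : ℝ)| ^ (4 - s) := by positivity
  rw [energyWeight_eq, ← h3]
  calc _ ≤ |(k : ℝ)| ^ s * (16 * |(k : ℝ)| ^ (4 - s)) := by
        refine mul_le_mul_of_nonneg_left (h2.trans ?_) (by positivity)
        exact mul_le_mul_of_nonneg_right h4 h5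
    _ = _ := by ring

/-- The constant in the embedding of the Sobolev space into `ℓ¹`. -/
noncomputable def invSqSum : ℝ := ∑' k : ℤ, 1 / (k : ℝ) ^ 2

theorem invSqSum_pos : 0 < invSqSum :=
  (Real.summable_one_div_int_pow.mpr one_lt_two).tsum_pos (fun _ => by positivity) 1 (by norm_num)

/-- Cauchy-Schwarz for b k = k⁻² · (k² b k): the embedding of H² into absolutely convergent Fourier
series. -/
theorem sq_tsum_le {b : ℤ → ℝ} (h0 : ∀ k, 0 ≤ b k) (hz : b 0 = 0)
    (h : Summable fun k : ℤ => (k : ℝ) ^ 4 * b k ^ 2) :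
    Summable b ∧ (∑' k, b k) ^ 2 ≤ invSqSum * ∑' k : ℤ, (k : ℝ) ^ 4 * b k ^ 2 := by
  have e : ∀ k : ℤ, 1 / (k : ℝ) ^ 2 * ((k : ℝ) ^ 2 * b k) = b k := fun k => by
    by_cases hk : k = 0
    · simp [hk, hz]
    · have : (k : ℝ) ≠ 0 := by exact_mod_cast hk
      field_simp
  have hle : ∀ k : ℤ, 1 / (k : ℝ) ^ 2 * ((k : ℝ) ^ 2 * b k) ^ 2 ≤ (k : ℝ) ^ 4 * b k ^ 2 := by
    intro k
    by_cases hk : k = 0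
    · simp [hk]
    · have h1 : 1 ≤ (k : ℝ) ^ 2 := by
        rw [← sq_abs]; exact one_le_pow₀ (one_le_abs_cast hk)
      have h2 : 1 / (k : ℝ) ^ 2 ≤ 1 := by rw [div_le_one (by linarith)]; exact h1
      calc _ ≤ 1 * ((k : ℝ) ^ 2 * b k) ^ 2 := mul_le_mul_of_nonneg_right h2 (sq_nonneg _)
        _ = _ := by ring
  have hs : Summable fun k : ℤ => 1 / (k : ℝ) ^ 2 * ((k : ℝ) ^ 2 * b k) ^ 2 :=
    h.of_nonneg_of_le (fun _ => by positivity) hle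
  have h1 := tsum_mul_sq_le (w := fun k : ℤ => 1 / (k : ℝ) ^ 2) (z := fun k => (k : ℝ) ^ 2 * b k)
    (fun _ => by positivity) (fun k => mul_nonneg (sq_nonneg _) (h0 k))
    (Real.summable_one_div_int_pow.mpr one_lt_two) hs
  simp only [e] at h1
  refine ⟨h1.1, h1.2.trans ?_⟩
  exact mul_le_mul_of_nonneg_left (hs.tsum_le_tsum hle h) invSqSum_pos.le

/-- The algebra property of H². From k² ≤ 2 (j² + (k - j)²) one gets k² (b * b) ≤ 4 (b * c) with c =
k² b. Young's inequality ℓ¹ * ℓ² ⊂ ℓ² then finishes; it is the case of Schur's test in which weight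
and comparison sequence are 1 off zero. -/
theorem tsum_pow_four_mul_conv_sq_le {b : ℤ → ℝ} (h0 : ∀ k, 0 ≤ b k) (he : ∀ k, b (-k) = b k)
    (hz : b 0 = 0) (h : Summable fun k : ℤ => (k : ℝ) ^ 4 * b k ^ 2) :
    Summable (fun k : ℤ => (k : ℝ) ^ 4 * conv b b k ^ 2) ∧
      ∑' k : ℤ, (k : ℝ) ^ 4 * conv b b k ^ 2
        ≤ 16 * (∑' k, b k) ^ 2 * ∑' k : ℤ, (k : ℝ) ^ 4 * b k ^ 2 := by
  obtain ⟨hb, -⟩ := sq_tsum_le h0 hz h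
  set c : ℤ → ℝ := fun k => (k : ℝ) ^ 2 * b k with hc
  have hc0 : ∀ k, 0 ≤ c k := fun k => mul_nonneg (sq_nonneg _) (h0 k)
  have ec : ∀ k : ℤ, c k ^ 2 = (k : ℝ) ^ 4 * b k ^ 2 := fun k => by simp only [hc]; ring
  have hcs : Summable fun k => c k ^ 2 := h.congr fun k => (ec k).symm
  have hcC : ∀ k, |c k| ≤ Real.sqrt (∑' j, c j ^ 2) := fun k => by
    rw [← Real.sqrt_sq_eq_abs]
    exact Real.sqrt_le_sqrt (hcs.le_tsum k fun _ _ => sq_nonneg _)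
  have hba : Summable fun k => |b k| := hb.congr fun k => (abs_of_nonneg (h0 k)).symm
  have hpt : ∀ k : ℤ, (k : ℝ) ^ 2 * conv b b k ≤ 4 * conv b c k := fun k => by
    have s1 := summable_conv_of_bdd hba hcC k
    have s2 : Summable fun j => c j * b (k - j) := by
      have := (Equiv.subLeft k).summable_iff.mpr s1
      refine this.congr fun j => ?_
      simp [mul_comm]
    have s3 := summable_conv_of_bdd hba (abs_le_tsum_abs hba) k
    have e : 4 * conv b c k = 2 * conv c b k + 2 * conv b c k := by rw [conv_comm c b]; ring
    rw [e, conv, conv, conv, ← tsum_mul_left, ← tsum_mul_left, ← tsum_mul_left,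
      ← (s2.mul_left 2).tsum_add (s1.mul_left 2)]
    refine (s3.mul_left _).tsum_le_tsum (fun j => ?_) ((s2.mul_left 2).add (s1.mul_left 2))
    have h1 : (k : ℝ) ^ 2 ≤ 2 * ((j : ℝ) ^ 2 + ((k - j : ℤ) : ℝ) ^ 2) := by
      push_cast
      nlinarith [sq_nonneg ((k : ℝ) - 2 * j)]
    have h2 := mul_le_mul_of_nonneg_right h1 (mul_nonneg (h0 j) (h0 (k - j)))
    simp only [hc]
    linarith
  set P : ℤ → ℝ := fun k => if k = 0 then 0 else 1 with hP
  have hPW : ∀ k, k ≠ 0 → 1 ≤ P k := fun k hk => by simp [hP, hk]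
  have hP1 : ∀ k, P k ≤ 1 := fun k => by simp only [hP]; split_ifs <;> norm_num
  have hP0 : ∀ k, 0 ≤ P k := fun k => by simp only [hP]; split_ifs <;> norm_num
  have hS0 : 0 ≤ ∑' k, b k := tsum_nonneg h0
  obtain ⟨t1, t2⟩ := schur_conv (A := b) (P := P) (W := P) (y := c) (q := (∑' k, b k) / 2) h0 he hb
    (by simp [hP]) hPW hP1 (by simp [hP]) hPW hc0 (by simp [hc]) (by positivity)
    (hcs.of_nonneg_of_le (fun k => mul_nonneg (hP0 k) (sq_nonneg _))
      fun k => mul_le_of_le_one_left (sq_nonneg _) (hP1 k)) fun k hk => by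
      have e : 2 * ((∑' k, b k) / 2) * P k * P k = ∑' k, b k := by simp [hP, hk]; ring
      rw [e]
      have := conv_mono (a' := b) (b' := fun _ => 1) h0 hP0 (fun _ => le_rfl) hP1 hb
        (fun _ => le_rfl) k
      simpa [conv] using this
  have hle : ∀ k : ℤ, (k : ℝ) ^ 4 * conv b b k ^ 2
      ≤ 64 * (P k * ((2 * P k)⁻¹ * conv b c k) ^ 2) := fun k => by
    by_cases hk : k = 0
    · simp [hk, hP]
    · have h1 := hpt k
      have h2 : 0 ≤ (k : ℝ) ^ 2 * conv b b k := mul_nonneg (sq_nonneg _) (conv_nonneg h0 h0 k)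
      have h3 := pow_le_pow_left₀ h2 h1 2
      simp only [hP, if_neg hk]
      linarith
  have hsum := (t1.mul_left 64).of_nonneg_of_le (fun k => by positivity) hle
  refine ⟨hsum, (hsum.tsum_le_tsum hle (t1.mul_left 64)).trans ?_⟩
  rw [tsum_mul_left]
  have t3 : ∑' k, P k * c k ^ 2 ≤ ∑' k : ℤ, (k : ℝ) ^ 4 * b k ^ 2 := by
    refine Summable.tsum_le_tsum (fun k => ?_) (hcs.of_nonneg_of_le
      (fun k => mul_nonneg (hP0 k) (sq_nonneg _))
      fun k => mul_le_of_le_one_left (sq_nonneg _) (hP1 k)) h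
    rw [← ec]
    exact mul_le_of_le_one_left (sq_nonneg _) (hP1 k)
  have t4 := t2.trans (mul_le_mul_of_nonneg_left t3 (sq_nonneg _))
  linarith

/-! ### Perturbations of the orbit -/

/-- `a` is a majorant of the coefficient functions `u`, and it is small enough for the linearised
equation to be stable. -/
structure IsProfile (s : ℝ) (u : ℤ → ℝ → ℝ) (a : ℤ → ℝ) : Prop where
  cont : ∀ k, Continuous (u k)
  odd : ∀ k t, u (-k) t = -u k t
  le : ∀ k t, |u k t| ≤ a k
  boxed : IsBoxed (10001 / 10000) fun k => sobolevWeight s k * a k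

/-- Time is shifted so that perturbations start at 0. The Sobolev weight is below `modeWeight`, so
the weighted tail bound of the box already pays for it. -/
theorem OrbitBox.isProfile {s : ℝ} {u : ℤ → ℝ → ℝ} (h : OrbitBox s u) (hs : 11 / 32 ≤ s)
    (hs1 : s ≤ 1) (t₀ : ℝ) : IsProfile s (fun k t => u k (t₀ + t)) fun k => supAbs (u k) where
  cont k := (h.cont k).comp (by fun_prop)
  odd k t := h.odd k _
  le k t := h.abs_le k _
  boxed := (h.isBoxed hs).weighted h.summable_tail h.tail_le (isWeight_sobolevWeight hs1).one_le
    (sobolevWeight_neg s) (sobolevWeight_le (by linarith))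

namespace IsProfile

variable {s : ℝ} {u : ℤ → ℝ → ℝ} {a : ℤ → ℝ}

theorem nonneg (h : IsProfile s u a) (k : ℤ) : 0 ≤ a k := (abs_nonneg _).trans (h.le k 0)

theorem le_weighted (h : IsProfile s u a) (hs1 : s ≤ 1) (k : ℤ) : a k ≤ sobolevWeight s k * a k :=
  le_mul_of_one_le_left (h.nonneg k) ((isWeight_sobolevWeight hs1).one_le k)

theorem summable (h : IsProfile s u a) (hs1 : s ≤ 1) : Summable a :=
  h.boxed.summable.of_nonneg_of_le h.nonneg (h.le_weighted hs1)

theorem summable_abs (h : IsProfile s u a) (hs1 : s ≤ 1) (t : ℝ) : Summable fun k => |u k t| :=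
  (h.summable hs1).of_nonneg_of_le (fun _ => abs_nonneg _) fun k => h.le k t

theorem conv_testSeq_le (h : IsProfile s u a) (hs : 11 / 32 ≤ s) (hs1 : s ≤ 1) {k : ℤ}
    (hk : k ≠ 0) : conv a testSeq k ≤ 2 * (98 / 100) * symbolWeight s k * testSeq k :=
  (conv_mono h.nonneg testSeq_nonneg (h.le_weighted hs1) (fun _ => le_rfl) h.boxed.summable
    testSeq_le k).trans (h.boxed.conv_testSeq_le hs hk)

end IsProfile

/-- The ball in which exponentially rescaled perturbations are sought. -/
structure DecayBall (s R : ℝ) (z : ℤ → ℝ → ℝ) : Prop where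
  cont : ∀ k, Continuous (z k)
  odd : ∀ k t, z (-k) t = -z k t
  bdd : ∀ k, ∃ C, ∀ t, |z k t| ≤ C
  energy : ∀ F : Finset ℤ, ∑ k ∈ F, energyWeight s k * supAbs (z k) ^ 2 ≤ R

namespace DecayBall

variable {s R : ℝ} {z z' : ℤ → ℝ → ℝ}

theorem abs_le (h : DecayBall s R z) (k : ℤ) (t : ℝ) : |z k t| ≤ supAbs (z k) := by
  obtain ⟨C, hC⟩ := h.bdd k
  exact abs_le_supAbs hC t

theorem supAbs_even (h : DecayBall s R z) (k : ℤ) : supAbs (z (-k)) = supAbs (z k) := by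
  rw [show z (-k) = fun t => -z k t from funext (h.odd k), supAbs_neg]

theorem zero (h : DecayBall s R z) (t : ℝ) : z 0 t = 0 := by
  have := h.odd 0 t
  simp at this
  linarith

theorem supAbs_zero (h : DecayBall s R z) : supAbs (z 0) = 0 := by
  rw [show z 0 = fun _ => 0 from funext h.zero]
  simp [supAbs]

theorem summable_energy (h : DecayBall s R z) :
    Summable fun k => energyWeight s k * supAbs (z k) ^ 2 :=
  summable_of_sum_le (fun k => mul_nonneg (energyWeight_nonneg s k) (sq_nonneg _)) h.energy

theorem tsum_energy_le (h : DecayBall s R z) : ∑' k, energyWeight s k * supAbs (z k) ^ 2 ≤ R :=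
  h.summable_energy.tsum_le_of_sum_le h.energy

theorem summable_pow_four (h : DecayBall s R z) (hs : 0 ≤ s) (hs1 : s ≤ 1) :
    Summable (fun k : ℤ => (k : ℝ) ^ 4 * supAbs (z k) ^ 2) ∧
      ∑' k : ℤ, (k : ℝ) ^ 4 * supAbs (z k) ^ 2 ≤ 10 ^ 24 * R := by
  have hle : ∀ k : ℤ, (k : ℝ) ^ 4 * supAbs (z k) ^ 2
      ≤ 10 ^ 24 * (energyWeight s k * supAbs (z k) ^ 2) := fun k => by
    rw [← mul_assoc]
    exact mul_le_mul_of_nonneg_right (pow_four_le_energyWeight hs hs1 k) (sq_nonneg _)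
  have hsum := (h.summable_energy.mul_left (10 ^ 24)).of_nonneg_of_le
    (fun k => by positivity) hle
  refine ⟨hsum, (hsum.tsum_le_tsum hle (h.summable_energy.mul_left _)).trans ?_⟩
  rw [tsum_mul_left]
  exact mul_le_mul_of_nonneg_left h.tsum_energy_le (by positivity)

theorem summable (h : DecayBall s R z) (hs : 0 ≤ s) (hs1 : s ≤ 1) :
    Summable fun k => supAbs (z k) :=
  (sq_tsum_le (fun k => supAbs_nonneg (z k)) h.supAbs_zero (h.summable_pow_four hs hs1).1).1

theorem sq_tsum_le (h : DecayBall s R z) (hs : 0 ≤ s) (hs1 : s ≤ 1) :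
    (∑' k, supAbs (z k)) ^ 2 ≤ invSqSum * (10 ^ 24 * R) :=
  (FracBurgers.sq_tsum_le (fun k => supAbs_nonneg (z k)) h.supAbs_zero
    (h.summable_pow_four hs hs1).1).2.trans
    (mul_le_mul_of_nonneg_left (h.summable_pow_four hs hs1).2 invSqSum_pos.le)

theorem le_tsum (h : DecayBall s R z) (hs : 0 ≤ s) (hs1 : s ≤ 1) (k : ℤ) :
    supAbs (z k) ≤ ∑' j, supAbs (z j) :=
  le_tsum_of_nonneg (fun _ => supAbs_nonneg _) (h.summable hs hs1) k

theorem summable_abs (h : DecayBall s R z) (hs : 0 ≤ s) (hs1 : s ≤ 1) (t : ℝ) :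
    Summable fun k => |z k t| :=
  (h.summable hs hs1).of_nonneg_of_le (fun _ => abs_nonneg _) fun k => h.abs_le k t

theorem of_tendstoUniformly {x : ℕ → ℤ → ℝ → ℝ} {w : ℤ → ℝ → ℝ} (hx : ∀ n, DecayBall s R (x n))
    (h : ∀ k, TendstoUniformly (fun n => x n k) (w k) atTop) : DecayBall s R w := by
  have hp : ∀ k t, Tendsto (fun n => x n k t) atTop (𝓝 (w k t)) := fun k t =>
    (h k).tendsto_at t
  have hb := fun k => tendsto_supAbs (fun n => (hx n).bdd k) (h k)
  exact {
    cont := fun k => (h k).continuous (Eventually.of_forall fun n => (hx n).cont k).frequently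
    odd := fun k t => tendsto_nhds_unique (hp (-k) t)
      ((hp k t).neg.congr fun n => ((hx n).odd k t).symm)
    bdd := fun k => (hb k).1
    energy := fun F => le_of_tendsto' (tendsto_finsetSum F fun k _ =>
      ((hb k).2.pow 2).const_mul _) fun n => (hx n).energy F }

end DecayBall

/-- The decay rate of perturbations. -/
noncomputable def decayRate : ℝ := 1 / 1000

/-- The interaction terms in the equation for an exponentially rescaled perturbation. -/
noncomputable def perturbationSource (u z : ℤ → ℝ → ℝ) (k : ℤ) (t : ℝ) : ℝ :=
  (k / 2 : ℝ) * conv (fun j => u j t) (fun j => z j t) k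
    + (k / 4 : ℝ) * (Real.exp (-decayRate * t) * conv (fun j => z j t) (fun j => z j t) k)

/-- The Duhamel map for an exponentially rescaled perturbation. -/
noncomputable def perturbationMap (s : ℝ) (u : ℤ → ℝ → ℝ) (w₀ : ℤ → ℝ) (z : ℤ → ℝ → ℝ) (k : ℤ)
    (t : ℝ) : ℝ :=
  Real.exp (-(rate s k - decayRate) * max t 0) * w₀ k
    + ∫ r in (0 : ℝ)..max t 0, Real.exp (-(rate s k - decayRate) * (max t 0 - r))
      * perturbationSource u z k r

/-- All rates are at least 1, so demanding decay 1/1000 costs only a factor 1000/999, which fits in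
the gap between 0.98 and 1. -/
theorem rate_sub_decayRate {s : ℝ} (hs : 0 ≤ s) {k : ℤ} (hk : k ≠ 0) :
    999 / 1000 * rate s k ≤ rate s k - decayRate ∧ 0 < rate s k - decayRate := by
  have := one_le_rate hs hk
  rw [decayRate]
  constructor <;> linarith

theorem perturbationSource_zero (u z : ℤ → ℝ → ℝ) (t : ℝ) : perturbationSource u z 0 t = 0 := by
  simp [perturbationSource]

/-! ### Fixed point argument for rescaled perturbations -/

section Perturbation

variable {s R : ℝ} {u z z' : ℤ → ℝ → ℝ} {a w₀ : ℤ → ℝ}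

theorem continuous_perturbationSource (hu : IsProfile s u a) (hz : DecayBall s R z) (hs : 0 ≤ s)
    (hs1 : s ≤ 1) (k : ℤ) : Continuous (perturbationSource u z k) := by
  have h1 := continuous_conv hu.cont hz.cont (hu.summable hs1) hu.le hz.abs_le
    (hz.le_tsum hs hs1) k
  have h2 := continuous_conv hz.cont hz.cont (hz.summable hs hs1) hz.abs_le hz.abs_le
    (hz.le_tsum hs hs1) k
  unfold perturbationSource
  fun_prop

theorem perturbationSource_neg (hu : IsProfile s u a) (hz : DecayBall s R z) (k : ℤ) (t : ℝ) :
    perturbationSource u z (-k) t = -perturbationSource u z k t := by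
  simp only [perturbationSource,
    conv_odd (f := fun j => u j t) (g := fun j => z j t) (fun j => hu.odd j t)
      (fun j => hz.odd j t),
    conv_odd (f := fun j => z j t) (g := fun j => z j t) (fun j => hz.odd j t)
      (fun j => hz.odd j t)]
  push_cast; ring

theorem continuous_perturbationMap (hu : IsProfile s u a) (hz : DecayBall s R z) (hs : 0 ≤ s)
    (hs1 : s ≤ 1) (w₀ : ℤ → ℝ) (k : ℤ) : Continuous (perturbationMap s u w₀ z k) := by
  have h := continuous_integral_exp_mul (l := rate s k - decayRate)
    (continuous_perturbationSource hu hz hs hs1 k) (a := fun _ => 0) (b := fun t => max t 0)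
    (by fun_prop) (by fun_prop)
  unfold perturbationMap
  simp_rw [integral_exp_mul_eq]
  fun_prop

theorem perturbationMap_neg (hu : IsProfile s u a) (hz : DecayBall s R z)
    (hw : ∀ k, w₀ (-k) = -w₀ k) (k : ℤ) (t : ℝ) :
    perturbationMap s u w₀ z (-k) t = -perturbationMap s u w₀ z k t := by
  simp only [perturbationMap, rate_neg, hw, perturbationSource_neg hu hz, mul_neg,
    intervalIntegral.integral_neg]
  ring

theorem perturbationMap_zero (hw : w₀ 0 = 0) (t : ℝ) : perturbationMap s u w₀ z 0 t = 0 := by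
  simp [perturbationMap, perturbationSource_zero, hw]

theorem exp_decay_le_one {t : ℝ} (ht : 0 ≤ t) : |Real.exp (-decayRate * t)| ≤ 1 := by
  rw [abs_of_pos (Real.exp_pos _), Real.exp_le_one_iff, decayRate]
  linarith

/-- The kernel of mode k has mass at most (1000/999)/|k|^(1+s). Time enters the map through max t 0,
so the bound holds on the whole line and passes to `supAbs`. -/
theorem abs_perturbationMap_le (hu : IsProfile s u a) (hz : DecayBall s R z) (hs : 0 ≤ s)
    (hs1 : s ≤ 1) {k : ℤ} (hk : k ≠ 0) (t : ℝ) :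
    |perturbationMap s u w₀ z k t| ≤ |w₀ k| + (1000 / 999) * ((2 * symbolWeight s k)⁻¹
        * conv a (fun j => supAbs (z j)) k
      + (4 * symbolWeight s k)⁻¹ * conv (fun j => supAbs (z j)) (fun j => supAbs (z j)) k) := by
  obtain ⟨h1, h2⟩ := rate_sub_decayRate hs hk
  have hp := abs_cast_pos hk
  have hw := symbolWeight_pos s hk
  set c₁ := conv a (fun j => supAbs (z j)) k with hc₁
  set c₂ := conv (fun j => supAbs (z j)) (fun j => supAbs (z j)) k with hc₂
  have p₁ : 0 ≤ c₁ := conv_nonneg hu.nonneg (fun _ => supAbs_nonneg _) k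
  have p₂ : 0 ≤ c₂ := conv_nonneg (fun _ => supAbs_nonneg _) (fun _ => supAbs_nonneg _) k
  have hm : 0 ≤ max t 0 := le_max_right t 0
  have hI := abs_integral_exp_mul_le' h2 (M := |(k : ℝ)| / 2 * c₁ + |(k : ℝ)| / 4 * c₂)
    (by positivity) (continuous_perturbationSource hu hz hs hs1 k) hm fun r hr => by
      refine (abs_add_le _ _).trans (add_le_add ?_ ?_)
      · rw [abs_mul, abs_div, abs_of_pos (show (0 : ℝ) < 2 by norm_num)]
        exact mul_le_mul_of_nonneg_left (abs_conv_le (fun j => hu.le j r) (fun j => hz.abs_le j r)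
          (hu.summable hs1) (hz.le_tsum hs hs1) k) (by positivity)
      · rw [abs_mul, abs_div, abs_of_pos (show (0 : ℝ) < 4 by norm_num), abs_mul]
        refine mul_le_mul_of_nonneg_left ?_ (by positivity)
        exact (mul_le_of_le_one_left (abs_nonneg _) (exp_decay_le_one hr.1)).trans
          (abs_conv_le (fun j => hz.abs_le j r) (fun j => hz.abs_le j r)
          (hz.summable hs hs1) (hz.le_tsum hs hs1) k)
  refine (abs_add_le _ _).trans (add_le_add ?_ (hI.trans ?_))
  · rw [abs_mul, abs_of_pos (Real.exp_pos _)]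
    refine mul_le_of_le_one_left (abs_nonneg _) (Real.exp_le_one_iff.mpr ?_)
    rw [neg_mul]
    exact neg_nonpos.mpr (mul_nonneg h2.le hm)
  · calc _ ≤ (|(k : ℝ)| / 2 * c₁ + |(k : ℝ)| / 4 * c₂) / (999 / 1000 * rate s k) := by
          gcongr
          have := rate_pos s hk
          positivity
      _ = _ := by rw [rate]; field_simp

/-- Young's inequality, weighted so that the linear term y loses only one percent. The other two
terms can afford large constants. -/
theorem add_sq_le_weighted (x y z : ℝ) :
    (x + y + z) ^ 2 ≤ 101 / 100 * y ^ 2 + 202 * x ^ 2 + 202 * z ^ 2 := by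
  nlinarith [sq_nonneg (y - 100 * (x + z)), sq_nonneg (x - z)]

/-- The weighted square of a sum of a datum, a linear and a quadratic term. -/
theorem weighted_sq_le {W r p w c₁ c₁' c₂ K : ℝ} (hW : 1 ≤ W) (hr : 0 ≤ r) (hp : 0 ≤ p)
    (hK : W * r ^ 2 ≤ 16 * K) (hc : r * c₁ ≤ c₁')
    (h : p ≤ w + 1000 / 999 * ((2 * W)⁻¹ * c₁ + (4 * W)⁻¹ * c₂)) :
    W * r ^ 2 * p ^ 2 ≤ 102 / 100 * (W * ((2 * W)⁻¹ * c₁') ^ 2) + 3232 * (K * w ^ 2)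
      + 203 * (K * c₂ ^ 2) := by
  have hW0 : 0 < W := by linarith
  have hi : 0 ≤ (2 * W)⁻¹ := by positivity
  have h1 : r * p ≤ r * w + 1000 / 999 * ((2 * W)⁻¹ * c₁')
      + 1000 / 999 * ((4 * W)⁻¹ * (r * c₂)) := by
    have h2 := mul_le_mul_of_nonneg_left h hr
    have h3 := mul_le_mul_of_nonneg_left hc hi
    linarith
  have h2 := mul_le_mul_of_nonneg_left ((pow_le_pow_left₀ (mul_nonneg hr hp) h1 2).trans
    (add_sq_le_weighted _ _ _)) hW0.le
  have h3 : W * r ^ 2 * w ^ 2 ≤ 16 * (K * w ^ 2) := by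
    rw [← mul_assoc]; exact mul_le_mul_of_nonneg_right hK (sq_nonneg _)
  have h4 : W * ((4 * W)⁻¹ * (r * c₂)) ^ 2 ≤ K * c₂ ^ 2 := by
    have e : W * ((4 * W)⁻¹ * (r * c₂)) ^ 2 = W * r ^ 2 * c₂ ^ 2 / (16 * W ^ 2) := by
      field_simp; ring
    have h5 := mul_le_mul_of_nonneg_right hK (sq_nonneg c₂)
    have h6 : 0 ≤ W * r ^ 2 * c₂ ^ 2 := by positivity
    have h7 : 1 ≤ W ^ 2 := one_le_pow₀ hW
    rw [e, div_le_iff₀ (by positivity)]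
    nlinarith
  have h5 : 0 ≤ W * ((2 * W)⁻¹ * c₁') ^ 2 := by positivity
  have h6 : 0 ≤ W * ((4 * W)⁻¹ * (r * c₂)) ^ 2 := by positivity
  linarith

/-- The budget is 1.02 · 0.98² R for the linear term, 3232 N = 3232 R/250000 for the datum, and 203
· 16 · 10⁻³⁰ · 10²⁴ R for the quadratic term. Together this is about 0.996 R. The supremum in time
is taken before summing over modes, so the ball controls all times at once. -/
theorem energy_perturbationMap_le (hu : IsProfile s u a) (hz : DecayBall s R z)
    (hs : 11 / 32 ≤ s) (hs1 : s ≤ 1) {N : ℝ} (hw0 : w₀ 0 = 0)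
    (hw : Summable fun k : ℤ => (k : ℝ) ^ 4 * w₀ k ^ 2)
    (hN : ∑' k : ℤ, (k : ℝ) ^ 4 * w₀ k ^ 2 ≤ N) (hR : R = 250000 * N)
    (hsmall : invSqSum * (10 ^ 24 * R) ≤ 1 / 10 ^ 30) (F : Finset ℤ) :
    ∑ k ∈ F, energyWeight s k * supAbs (perturbationMap s u w₀ z k) ^ 2 ≤ R := by
  have hs0 : 0 < s := by linarith
  have hρ := isWeight_sobolevWeight hs1
  set b : ℤ → ℝ := fun k => supAbs (z k) with hb
  have hb0 : ∀ k, 0 ≤ b k := fun k => supAbs_nonneg _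
  set A : ℤ → ℝ := fun k => sobolevWeight s k * a k with hA
  set y : ℤ → ℝ := fun k => sobolevWeight s k * b k with hy
  have eWy : ∀ k, symbolWeight s k * y k ^ 2 = energyWeight s k * b k ^ 2 := fun k => by
    simp only [hy, energyWeight]; ring
  have hWy : Summable fun k => symbolWeight s k * y k ^ 2 :=
    hz.summable_energy.congr fun k => (eWy k).symm
  have hy0 : ∀ k, 0 ≤ y k := fun k => mul_nonneg (sobolevWeight_pos s k).le (hb0 k)
  have hyz : y 0 = 0 := by simp only [hy, hb, hz.supAbs_zero, mul_zero]
  obtain ⟨sY, tY⟩ := schur_conv (A := A) (P := testSeq) (W := symbolWeight s) (y := y)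
    (q := 98 / 100) hu.boxed.nonneg hu.boxed.even hu.boxed.summable testSeq_zero
    (fun k => one_le_testSeq) testSeq_le (symbolWeight_zero hs0.ne')
    (fun k => one_le_symbolWeight hs0.le) hy0 hyz (by norm_num) hWy
    fun k hk => hu.boxed.conv_testSeq_le hs hk
  have tY' : ∑' k, symbolWeight s k * y k ^ 2 ≤ R := by
    rw [tsum_congr eWy]; exact hz.tsum_energy_le
  obtain ⟨s4, t4⟩ := hz.summable_pow_four hs0.le hs1
  obtain ⟨sZ, tZ⟩ := tsum_pow_four_mul_conv_sq_le hb0 hz.supAbs_even hz.supAbs_zero s4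
  have hyC : ∃ C, ∀ k, y k ≤ C := by
    refine ⟨1 + R, fun k => ?_⟩
    by_cases hk : k = 0
    · have h0R : 0 ≤ R := (tsum_nonneg fun k => mul_nonneg (energyWeight_nonneg s k)
        (sq_nonneg _)).trans hz.tsum_energy_le
      rw [hk, hyz]; linarith
    · have h1 := hWy.le_tsum k fun j _ => mul_nonneg (symbolWeight_nonneg s j) (sq_nonneg _)
      have h2 := one_le_symbolWeight hs0.le hk
      nlinarith [sq_nonneg (y k - 1), sq_nonneg (y k)]
  obtain ⟨C, hyC⟩ := hyC
  have hterm : ∀ k, energyWeight s k * supAbs (perturbationMap s u w₀ z k) ^ 2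
      ≤ 102 / 100 * (symbolWeight s k * ((2 * symbolWeight s k)⁻¹ * conv A y k) ^ 2)
        + 3232 * ((k : ℝ) ^ 4 * w₀ k ^ 2) + 203 * ((k : ℝ) ^ 4 * conv b b k ^ 2) := fun k => by
    by_cases hk : k = 0
    · subst hk
      rw [show perturbationMap s u w₀ z 0 = fun _ => 0 from funext (perturbationMap_zero hw0)]
      simp [supAbs, symbolWeight_zero hs0.ne']
    exact (weighted_sq_le (one_le_symbolWeight hs0.le hk) (sobolevWeight_pos s k).le
      (supAbs_nonneg _) (energyWeight_le hs0 hs1 k)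
      (hρ.mul_conv_le hu.nonneg hb0 hu.boxed.summable hyC k)
      (supAbs_le fun t => abs_perturbationMap_le hu hz hs0.le hs1 hk t)).trans_eq (by rw [sq_abs])
  have hsum := ((sY.mul_left (102 / 100)).add (hw.mul_left 3232)).add (sZ.mul_left 203)
  refine (Finset.sum_le_sum fun k _ => hterm k).trans ((hsum.sum_le_tsum F fun k _ => ?_).trans ?_)
  · have := symbolWeight_nonneg s k
    positivity
  rw [Summable.tsum_add ((sY.mul_left _).add (hw.mul_left _)) (sZ.mul_left _),
    Summable.tsum_add (sY.mul_left _) (hw.mul_left _), tsum_mul_left, tsum_mul_left, tsum_mul_left]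
  have q1 := (hz.sq_tsum_le hs0.le hs1).trans hsmall
  have q2 : 0 ≤ ∑' k : ℤ, (k : ℝ) ^ 4 * b k ^ 2 := tsum_nonneg fun k => by positivity
  have q3 : (∑' k, b k) ^ 2 * ∑' k : ℤ, (k : ℝ) ^ 4 * b k ^ 2 ≤ 1 / 10 ^ 30 * (10 ^ 24 * R) :=
    mul_le_mul q1 t4 q2 (by positivity)
  have q4 : 0 ≤ ∑' k, symbolWeight s k * y k ^ 2 :=
    tsum_nonneg fun k => mul_nonneg (symbolWeight_nonneg s k) (sq_nonneg _)
  nlinarith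

/-- The linear term contributes 0.98 by the row estimate. The quadratic one contributes at most
0.0005, since the ball forces ∑ sup |z_k| ≤ 10⁻¹⁵. After the factor 1000/999 the sum stays below
0.99. Contracting in this weaker distance suffices because the ball is closed under modewise uniform
limits. -/
theorem abs_perturbationMap_sub_le (hu : IsProfile s u a) (hz : DecayBall s R z)
    (hz' : DecayBall s R z') (hs : 11 / 32 ≤ s) (hs1 : s ≤ 1)
    (hsmall : invSqSum * (10 ^ 24 * R) ≤ 1 / 10 ^ 30) {C : ℝ} (hC : 0 ≤ C)
    (h : ∀ k t, |z k t - z' k t| ≤ C * testSeq k) (k : ℤ) (t : ℝ) :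
    |perturbationMap s u w₀ z k t - perturbationMap s u w₀ z' k t| ≤ 99 / 100 * C * testSeq k := by
  have hs0 : 0 ≤ s := by linarith
  by_cases hk : k = 0
  · subst hk
    simp [perturbationMap, perturbationSource_zero, testSeq_zero]
  obtain ⟨h1, h2⟩ := rate_sub_decayRate hs0 hk
  have hp := abs_cast_pos hk
  have hW := symbolWeight_pos s hk
  have hW1 := one_le_symbolWeight hs0 hk
  have hP1 := one_le_testSeq hk
  have hPC : ∀ j, C * testSeq j ≤ C * (108 / 100) := fun j =>
    mul_le_mul_of_nonneg_left (testSeq_le j) hC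
  have hm : 0 ≤ max t 0 := le_max_right t 0
  have hc := continuous_perturbationSource hu hz hs0 hs1 k
  have hc' := continuous_perturbationSource hu hz' hs0 hs1 k
  have scale : ∀ f : ℤ → ℝ, conv f (fun j => C * testSeq j) k = C * conv f testSeq k := fun f => by
    rw [conv, conv, ← tsum_mul_left]
    exact tsum_congr fun j => by ring
  have row : ∀ r, |conv (fun j => z j r - z' j r) (fun j => u j r) k|
      ≤ C * (2 * (98 / 100) * symbolWeight s k * testSeq k) := fun r => by
    rw [conv_comm]
    refine (abs_conv_le (fun j => hu.le j r) (fun j => h j r) (hu.summable hs1) hPC k).trans ?_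
    rw [scale]
    exact mul_le_mul_of_nonneg_left (hu.conv_testSeq_le hs hs1 hk) hC
  have row' : ∀ {v}, DecayBall s R v → ∀ r, |conv (fun j => z j r - z' j r) (fun j => v j r) k|
      ≤ C * (1 / 1000 * symbolWeight s k * testSeq k) := fun {v} hv r => by
    rw [conv_comm]
    refine (abs_conv_le (fun j => hv.abs_le j r) (fun j => h j r) (hv.summable hs0 hs1) hPC
      k).trans ?_
    rw [scale]
    refine mul_le_mul_of_nonneg_left ?_ hC
    have b1 := conv_mono (fun j => supAbs_nonneg (v j)) testSeq_nonneg (fun j => le_rfl)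
      testSeq_le (hv.summable hs0 hs1) (fun _ => le_rfl) k
    have b2 : conv (fun j => supAbs (v j)) (fun _ => 108 / 100) k
        = (∑' j, supAbs (v j)) * (108 / 100) := by rw [conv, tsum_mul_right]
    have b3 := (hv.sq_tsum_le hs0 hs1).trans hsmall
    have b4 : ∑' j, supAbs (v j) ≤ 1 / 10 ^ 15 :=
      le_of_sq_le_sq (b3.trans (by norm_num)) (by norm_num)
    have b5 : 1 ≤ symbolWeight s k * testSeq k := one_le_mul_of_one_le_of_one_le hW1 hP1
    rw [b2] at b1
    nlinarith
  have e : perturbationMap s u w₀ z k t - perturbationMap s u w₀ z' k t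
      = ∫ r in (0 : ℝ)..max t 0, Real.exp (-(rate s k - decayRate) * (max t 0 - r))
      * (perturbationSource u z k r - perturbationSource u z' k r) := by
    simp only [perturbationMap, mul_sub]
    rw [intervalIntegral.integral_sub]
    · ring
    all_goals
      apply Continuous.intervalIntegrable
      fun_prop
  rw [e]
  refine (abs_integral_exp_mul_le' h2 (M := |(k : ℝ)| * symbolWeight s k
    * (9805 / 10000 * (C * testSeq k))) (by positivity) (hc.sub hc') hm fun r hr => ?_).trans ?_
  · have hdu := conv_sub_left (hz.summable_abs hs0 hs1 r) (hz'.summable_abs hs0 hs1 r)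
      (abs_le_tsum_abs (hu.summable_abs hs1 r)) k
    have hdz := conv_self_sub_conv_self (hz.summable_abs hs0 hs1 r) (hz'.summable_abs hs0 hs1 r) k
    have e2 : perturbationSource u z k r - perturbationSource u z' k r
        = (k / 2 : ℝ) * conv (fun j => z j r - z' j r) (fun j => u j r) k
          + (k / 4 : ℝ) * (Real.exp (-decayRate * r) *
            (conv (fun j => z j r - z' j r) (fun j => z j r) k
              + conv (fun j => z j r - z' j r) (fun j => z' j r) k)) := by
      rw [hdu, ← hdz, conv_comm (fun j => z j r) fun j => u j r,
        conv_comm (fun j => z' j r) fun j => u j r, perturbationSource, perturbationSource]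
      ring
    rw [Pi.sub_apply, e2]
    have b1 := mul_le_mul_of_nonneg_left (row r) (show 0 ≤ |(k : ℝ)| / 2 by positivity)
    have b2 := (mul_le_of_le_one_left (abs_nonneg _) (exp_decay_le_one hr.1)).trans
      ((abs_add_le _ _).trans (add_le_add (row' hz r) (row' hz' r)))
    have b3 := mul_le_mul_of_nonneg_left b2 (show 0 ≤ |(k : ℝ)| / 4 by positivity)
    refine (abs_add_le _ _).trans ?_
    rw [abs_mul, abs_mul, abs_mul, abs_div, abs_div, abs_of_pos (show (0 : ℝ) < 2 by norm_num),
      abs_of_pos (show (0 : ℝ) < 4 by norm_num)]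
    refine (add_le_add b1 b3).trans (le_of_eq ?_)
    ring
  · rw [div_le_iff₀ h2]
    refine le_trans ?_ (mul_le_mul_of_nonneg_left h1
      (show 0 ≤ 99 / 100 * C * testSeq k by positivity))
    have : 0 ≤ |(k : ℝ)| * symbolWeight s k * (C * testSeq k) := by positivity
    rw [rate]
    nlinarith

theorem perturbationMap_mem (hu : IsProfile s u a) (hz : DecayBall s R z)
    (hs : 11 / 32 ≤ s) (hs1 : s ≤ 1) {N : ℝ} (hodd : ∀ k, w₀ (-k) = -w₀ k)
    (hw : Summable fun k : ℤ => (k : ℝ) ^ 4 * w₀ k ^ 2)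
    (hN : ∑' k : ℤ, (k : ℝ) ^ 4 * w₀ k ^ 2 ≤ N) (hR : R = 250000 * N)
    (hsmall : invSqSum * (10 ^ 24 * R) ≤ 1 / 10 ^ 30) :
    DecayBall s R (perturbationMap s u w₀ z) := by
  have hw0 : w₀ 0 = 0 := by have := hodd 0; simp at this; linarith
  exact {
    cont := continuous_perturbationMap hu hz (by linarith) hs1 w₀
    odd := perturbationMap_neg hu hz hodd
    bdd := fun k => by
      by_cases hk : k = 0
      · exact ⟨0, fun t => by rw [hk, perturbationMap_zero hw0, abs_zero]⟩
      · exact ⟨_, fun t => abs_perturbationMap_le hu hz (by linarith) hs1 hk t⟩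
    energy := energy_perturbationMap_le hu hz hs hs1 hw0 hw hN hR hsmall }

/-- Small perturbations of the orbit decay exponentially. -/
theorem exists_perturbation (hu : IsProfile s u a) (hs : 11 / 32 ≤ s) (hs1 : s ≤ 1) {N : ℝ}
    (hodd : ∀ k, w₀ (-k) = -w₀ k) (hw : Summable fun k : ℤ => (k : ℝ) ^ 4 * w₀ k ^ 2)
    (hN : ∑' k : ℤ, (k : ℝ) ^ 4 * w₀ k ^ 2 ≤ N)
    (hsmall : invSqSum * (10 ^ 24 * (250000 * N)) ≤ 1 / 10 ^ 30) :
    ∃ z, DecayBall s (250000 * N) z ∧ ∀ k t, 0 ≤ t → z k t =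
      Real.exp (-(rate s k - decayRate) * t) * w₀ k
        + ∫ r in (0 : ℝ)..t, Real.exp (-(rate s k - decayRate) * (t - r))
          * perturbationSource u z k r := by
  have hN0 : 0 ≤ N := (tsum_nonneg fun k => by positivity).trans hN
  have hs0 : 0 ≤ s := by linarith
  have h₀ : DecayBall s (250000 * N) fun _ _ => 0 :=
    { cont := fun k => continuous_const
      odd := fun k t => by simp
      bdd := fun k => ⟨0, by simp⟩
      energy := fun F => by simp [supAbs]; positivity }
  have hmem : ∀ z, DecayBall s (250000 * N) z →
      DecayBall s (250000 * N) (perturbationMap s u w₀ z) := fun z hz =>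
    perturbationMap_mem hu hz hs hs1 hodd hw hN rfl hsmall
  have h₁ := hmem _ h₀
  have h₂ : ∀ k t, |perturbationMap s u w₀ (fun _ _ => 0) k t - 0|
      ≤ (∑' j, supAbs (perturbationMap s u w₀ (fun _ _ => 0) j)) * testSeq k := fun k t => by
    by_cases hk : k = 0
    · subst hk
      simp [h₁.zero, testSeq_zero]
    · rw [sub_zero]
      exact ((h₁.abs_le k t).trans (h₁.le_tsum hs0 hs1 k)).trans
        (le_mul_of_one_le_right (tsum_nonneg fun _ => supAbs_nonneg _) (one_le_testSeq hk))
  obtain ⟨z, hz, e⟩ := exists_fixedPoint_of_weighted_contraction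
    (S := {z | DecayBall s (250000 * N) z}) (Φ := perturbationMap s u w₀) (by norm_num)
    (by norm_num) hmem
    (fun z hz z' hz' C hC h k t => abs_perturbationMap_sub_le hu hz hz' hs hs1 hsmall hC h k t) h₀
    (tsum_nonneg fun _ => supAbs_nonneg _)
    h₂ (fun x w hx h => DecayBall.of_tendstoUniformly hx h)
  refine ⟨z, hz, fun k t ht => ?_⟩
  have h3 := congrFun (congrFun e k) t
  rw [perturbationMap, max_eq_left ht] at h3
  exact h3.symm

end Perturbation

end FracBurgers

namespace FracBurgers

open Filter

/-! ### Trajectories of coefficients -/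

/-- The family of coefficients `v` has a majorant in `H²` and satisfies the Duhamel formula mode by
mode after the time `t₀`. -/
structure IsTrajectory (s t₀ : ℝ) (v : ℤ → ℝ → ℝ) : Prop where
  cont : ∀ k, Continuous (v k)
  odd : ∀ k t, v (-k) t = -v k t
  majorant : ∃ b : ℤ → ℝ, (∀ k t, |v k t| ≤ b k) ∧ Summable fun k : ℤ => (k : ℝ) ^ 4 * b k ^ 2
  duhamel : ∀ k t, t₀ ≤ t → v k t = Real.exp (-rate s k * (t - t₀)) * v k t₀
    + ∫ r in t₀..t, Real.exp (-rate s k * (t - r)) * source v k r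

/-- The tail condition makes k² sup |u_k| summable, since k² ≤ 10^12 `modeWeight`. A nonnegative
summable sequence is square summable. -/
theorem OrbitBox.summable_pow_four {s : ℝ} {u : ℤ → ℝ → ℝ} (h : OrbitBox s u)
    (hs : 11 / 32 ≤ s) : Summable fun k : ℤ => (k : ℝ) ^ 4 * supAbs (u k) ^ 2 := by
  have hB := h.isBoxed hs
  have hA := hasSum_even (f := fun k : ℤ => modeWeight k * supAbs (u k))
    (fun k => by rw [modeWeight_neg, hB.even]) (by rw [hB.zero, mul_zero])
    (by exact_mod_cast h.summable_tail)
  have h1 : Summable fun k : ℤ => (k : ℝ) ^ 2 * supAbs (u k) := by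
    refine (hA.summable.mul_left (10 ^ 12)).of_nonneg_of_le
      (fun k => mul_nonneg (sq_nonneg _) (supAbs_nonneg _)) fun k => ?_
    rw [← mul_assoc]
    refine mul_le_mul_of_nonneg_right ?_ (supAbs_nonneg _)
    rw [modeWeight, ← sq_abs, show (10 : ℝ) ^ 12 = (10 ^ 6) ^ 2 by norm_num, ← mul_pow]
    refine pow_le_pow_left₀ (abs_nonneg _) ?_ 2
    rw [mul_add, mul_div_cancel₀ _ (by positivity)]
    linarith
  have h2 : ∀ k : ℤ, (k : ℝ) ^ 4 * supAbs (u k) ^ 2 = ((k : ℝ) ^ 2 * supAbs (u k)) ^ 2 :=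
    fun k => by ring
  have h0 : ∀ k : ℤ, 0 ≤ (k : ℝ) ^ 2 * supAbs (u k) := fun k =>
    mul_nonneg (sq_nonneg _) (supAbs_nonneg _)
  refine (h1.mul_left (∑' k : ℤ, (k : ℝ) ^ 2 * supAbs (u k))).of_nonneg_of_le
    (fun k => by positivity) fun k => ?_
  rw [h2, sq]
  exact mul_le_mul_of_nonneg_right (h1.le_tsum k fun j _ => h0 j) (h0 k)

/-- Initial data close to the periodic orbit start trajectories that converge to it. -/
theorem exists_trajectory {s : ℝ} {u : ℤ → ℝ → ℝ} (h : OrbitBox s u) (hs : 11 / 32 ≤ s)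
    (hs1 : s ≤ 1) (hd : ∀ k t₀ t, u k t = Real.exp (-rate s k * (t - t₀)) * u k t₀
      + ∫ r in t₀..t, Real.exp (-rate s k * (t - r)) * source u k r) (t₀ : ℝ) {w₀ : ℤ → ℝ} {N : ℝ}
    (hodd : ∀ k, w₀ (-k) = -w₀ k) (hw : Summable fun k : ℤ => (k : ℝ) ^ 4 * w₀ k ^ 2)
    (hN : ∑' k : ℤ, (k : ℝ) ^ 4 * w₀ k ^ 2 ≤ N)
    (hsmall : invSqSum * (10 ^ 24 * (250000 * N)) ≤ 1 / 10 ^ 30) :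
    ∃ v, IsTrajectory s t₀ v ∧ (∀ k, v k t₀ = u k t₀ + w₀ k) ∧
      ∃ c : ℤ → ℝ, (∀ k t, t₀ ≤ t → |v k t - u k t| ≤ Real.exp (-decayRate * (t - t₀)) * c k) ∧
        Summable (fun k : ℤ => (k : ℝ) ^ 4 * c k ^ 2) ∧
        ∑' k : ℤ, (k : ℝ) ^ 4 * c k ^ 2 ≤ 10 ^ 24 * (250000 * N) := by
  have hs0 : 0 ≤ s := by linarith
  have hu := h.isProfile hs hs1 t₀
  obtain ⟨z, hz, hz'⟩ := exists_perturbation hu hs hs1 hodd hw hN hsmall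
  obtain ⟨sz, tz⟩ := hz.summable_pow_four hs0 hs1
  -- The exponential is frozen at 1 before t₀, so that w is bounded by the same majorant on the
  -- whole line.
  set w : ℤ → ℝ → ℝ := fun k t => Real.exp (-decayRate * max (t - t₀) 0) * z k (t - t₀) with hwdef
  have hw1 : ∀ k t, |w k t| ≤ supAbs (z k) := fun k t => by
    simp only [hwdef]
    rw [abs_mul]
    exact (mul_le_of_le_one_left (abs_nonneg _) (exp_decay_le_one (le_max_right _ _))).trans
      (hz.abs_le k _)
  have hwc : ∀ k, Continuous (w k) := fun k => by
    have := hz.cont k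
    simp only [hwdef]
    fun_prop
  have hwo : ∀ k t, w (-k) t = -w k t := fun k t => by simp only [hwdef, hz.odd]; ring
  have sa := h.summable_pow_four hs
  have hw0 : ∀ k, w k t₀ = w₀ k := fun k => by
    simp [hwdef, hz' k 0 le_rfl]
  have hza := hz.summable hs0 hs1
  have hua := (h.isBoxed hs).summable
  have usum := h.summable_abs hs
  have wsum : ∀ t, Summable fun k => |w k t| := fun t =>
    hza.of_nonneg_of_le (fun _ => abs_nonneg _) fun k => hw1 k t
  have hzle := hz.le_tsum hs0 hs1
  have huw : ∀ k, Continuous fun t => conv (fun j => u j t) (fun j => w j t) k :=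
    continuous_conv h.cont hwc hua h.abs_le hw1 hzle
  have hww : ∀ k, Continuous fun t => conv (fun j => w j t) (fun j => w j t) k :=
    continuous_conv hwc hwc hza hw1 hw1 hzle
  set P : ℤ → ℝ → ℝ := fun k t => (k / 2 : ℝ) * conv (fun j => u j t) (fun j => w j t) k
    + (k / 4 : ℝ) * conv (fun j => w j t) (fun j => w j t) k with hP
  have hPc : ∀ k, Continuous (P k) := fun k => by
    have h1 := huw k
    have h2 := hww k
    simp only [hP]
    fun_prop
  have hsrc : ∀ k t, source (fun k t => u k t + w k t) k t = source u k t + P k t := fun k t => by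
    have h1 := conv_self_sub_conv_self ((usum t).add (wsum t) |>.of_nonneg_of_le
      (fun _ => abs_nonneg _) fun k => abs_add_le (u k t) (w k t)) (usum t) k
    simp only [add_sub_cancel_left] at h1
    have h2 : conv (fun j => w j t) (fun j => u j t + w j t) k
        = conv (fun j => u j t) (fun j => w j t) k + conv (fun j => w j t) (fun j => w j t) k := by
      rw [conv_comm, conv_add_left (usum t) (wsum t) (abs_le_tsum_abs (wsum t))]
    rw [h2, conv_comm (fun j => w j t) fun j => u j t] at h1
    simp only [source, hP]
    linear_combination (k / 4 : ℝ) * h1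
  -- Undoing the rescaling: the linear term carries one factor of the exponential and the quadratic
  -- term two, the second of which is built into `perturbationSource`.
  have hPz : ∀ k t, t₀ ≤ t → P k t = Real.exp (-decayRate * (t - t₀))
      * perturbationSource (fun k t => u k (t₀ + t)) z k (t - t₀) := fun k t ht => by
    have e : ∀ f : ℤ → ℝ, conv f (fun j => w j t) k
        = Real.exp (-decayRate * (t - t₀)) * conv f (fun j => z j (t - t₀)) k := fun f => by
      rw [conv, conv, ← tsum_mul_left]
      refine tsum_congr fun j => ?_
      simp only [hwdef]
      rw [max_eq_left (by linarith)]
      ring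
    simp only [hP, perturbationSource]
    rw [e, e, conv_comm (fun j => w j t), e, conv_comm (fun j => z j (t - t₀))]
    simp only [add_sub_cancel]
    ring
  have hwd : ∀ k t, t₀ ≤ t → w k t = Real.exp (-rate s k * (t - t₀)) * w₀ k
      + ∫ r in t₀..t, Real.exp (-rate s k * (t - r)) * P k r := fun k t ht => by
    have e1 : w k t = Real.exp (-decayRate * (t - t₀)) * z k (t - t₀) := by
      simp only [hwdef]; rw [max_eq_left (by linarith)]
    have e2 := intervalIntegral.integral_comp_sub_right (a := t₀) (b := t)
      (fun r => Real.exp (-(rate s k - decayRate) * (t - t₀ - r))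
          * perturbationSource (fun k t => u k (t₀ + t)) z k r) t₀
    rw [sub_self] at e2
    rw [e1, hz' k _ (by linarith), ← e2, mul_add, ← mul_assoc, ← Real.exp_add,
      ← intervalIntegral.integral_const_mul]
    refine congrArg₂ (· + ·) ?_ ?_
    · ring_nf
    · refine intervalIntegral.integral_congr fun r hr => ?_
      rw [Set.uIcc_of_le ht] at hr
      rw [hPz k r hr.1, ← mul_assoc, ← mul_assoc, ← Real.exp_add, ← Real.exp_add]
      ring_nf
  refine ⟨fun k t => u k t + w k t, ⟨fun k => (h.cont k).add (hwc k), fun k t => ?_,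
    ⟨fun k => supAbs (u k) + supAbs (z k), fun k t => ?_, ?_⟩, fun k t ht => ?_⟩, fun k => ?_,
    fun k => supAbs (z k), fun k t ht => ?_, sz, tz⟩
  · rw [h.odd, hwo]; ring
  · exact (abs_add_le _ _).trans (add_le_add (h.abs_le k t) (hw1 k t))
  · refine ((sa.mul_left 2).add (sz.mul_left 2)).of_nonneg_of_le (fun k => by positivity)
      fun k => ?_
    have : 0 ≤ (k : ℝ) ^ 4 * (supAbs (u k) - supAbs (z k)) ^ 2 := by positivity
    linarith
  · have e1 := hd k t₀ t
    have e2 := hwd k t ht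
    have e3 : ∫ r in t₀..t, Real.exp (-rate s k * (t - r)) * source (fun k t => u k t + w k t) k r
        = (∫ r in t₀..t, Real.exp (-rate s k * (t - r)) * source u k r)
          + ∫ r in t₀..t, Real.exp (-rate s k * (t - r)) * P k r := by
      have c1 := h.continuous_source hs k
      have c2 := hPc k
      rw [← intervalIntegral.integral_add]
      · refine intervalIntegral.integral_congr fun r _ => ?_
        simp only [hsrc]
        ring
      all_goals
        apply Continuous.intervalIntegrable
        fun_prop
    rw [e3]
    simp only [hw0]
    linarith
  · simp only [hw0]
  · rw [add_sub_cancel_left]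
    simp only [hwdef]
    rw [max_eq_left (by linarith), abs_mul, abs_of_pos (Real.exp_pos _)]
    exact mul_le_mul_of_nonneg_left (hz.abs_le k _) (Real.exp_pos _).le

theorem OrbitBox.isTrajectory {s : ℝ} {u : ℤ → ℝ → ℝ} (h : OrbitBox s u) (hs : 11 / 32 ≤ s)
    (hd : ∀ k t₀ t, u k t = Real.exp (-rate s k * (t - t₀)) * u k t₀
      + ∫ r in t₀..t, Real.exp (-rate s k * (t - r)) * source u k r) (t₀ : ℝ) :
    IsTrajectory s t₀ u :=
  ⟨h.cont, h.odd, ⟨_, h.abs_le, h.summable_pow_four hs⟩, fun k t _ => hd k t₀ t⟩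

end FracBurgers

namespace FracBurgers

open Filter MeasureTheory

/-! ### Weak derivatives on the line -/

theorem intervalIntegrable_of_locallyIntegrable {v : ℝ → ℝ} (hv : LocallyIntegrable v) (a b : ℝ) :
    IntervalIntegrable v volume a b :=
  (hv.integrableOn_isCompact isCompact_uIcc).intervalIntegrable

/-- Integration by parts against the primitive of a locally integrable function. -/
theorem integral_primitive_mul_deriv {v g : ℝ → ℝ} (hv : LocallyIntegrable v)
    (hg : ContDiff ℝ 1 g) (C a b : ℝ) :
    ∫ x in a..b, (C + ∫ y in (0 : ℝ)..x, v y) * deriv g x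
      = (C + ∫ y in (0 : ℝ)..b, v y) * g b - (C + ∫ y in (0 : ℝ)..a, v y) * g a
        - ∫ x in a..b, v x * g x := by
  have hi := intervalIntegrable_of_locallyIntegrable hv
  set c := C + ∫ y in (0 : ℝ)..a, v y with hc
  have e : ∀ x, C + ∫ y in (0 : ℝ)..x, v y = c + ∫ y in a..x, v y := fun x => by
    rw [hc, add_assoc, intervalIntegral.integral_add_adjacent_intervals (hi _ _) (hi _ _)]
  have hF : AbsolutelyContinuousOnInterval (fun x => ∫ y in a..x, v y) a b :=
    (hi a b).absolutelyContinuousOnInterval_intervalIntegral Set.left_mem_uIcc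
  have hG : AbsolutelyContinuousOnInterval g a b := hg.contDiffOn.absolutelyContinuousOnInterval
  have h1 := hF.integral_mul_deriv_eq_deriv_mul hG
  have hd := hg.continuous_deriv le_rfl
  have h2 : ∫ x in a..b, deriv g x = g b - g a :=
    intervalIntegral.integral_deriv_eq_sub (fun x _ => hg.differentiable one_ne_zero x)
      (hd.intervalIntegrable _ _)
  have h3 : ∫ x in a..b, deriv (fun x => ∫ y in a..x, v y) x * g x = ∫ x in a..b, v x * g x := by
    refine intervalIntegral.integral_congr_ae ?_
    filter_upwards [_root_.LocallyIntegrable.ae_hasDerivAt_integral hv] with x hx _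
    rw [(hx a).deriv]
  simp only [e, add_mul]
  have i1 : IntervalIntegrable (fun x => c * deriv g x) volume a b :=
    (continuous_const.mul hd).intervalIntegrable _ _
  have i2 : IntervalIntegrable (fun x => (∫ y in a..x, v y) * deriv g x) volume a b :=
    (hd.intervalIntegrable a b).continuousOn_mul hF.continuousOn
  rw [intervalIntegral.integral_add i1 i2, intervalIntegral.integral_const_mul, h1, h2, h3,
    intervalIntegral.integral_same]
  ring

theorem exists_support_subset_Ioc {φ : ℝ → ℝ} (h : HasCompactSupport φ) :
    ∃ R, 0 < R ∧ (∀ x, x ≤ -R → φ x = 0) ∧ ∀ x, R ≤ x → φ x = 0 := by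
  obtain ⟨R, hR⟩ := h.isCompact.isBounded.subset_closedBall 0
  have h0 : ∀ x, |R| < |x| → φ x = 0 := fun x hx => by
    by_contra h1
    have h2 := hR (subset_tsupport φ h1)
    rw [mem_closedBall_zero_iff, Real.norm_eq_abs] at h2
    linarith [le_abs_self R]
  refine ⟨|R| + 1, by positivity, fun x hx => h0 x ?_, fun x hx => h0 x ?_⟩
  · rw [abs_of_nonpos (a := x) (by linarith [abs_nonneg R])]; linarith
  · rw [abs_of_nonneg (a := x) (by linarith [abs_nonneg R])]; linarith

theorem integral_eq_intervalIntegral {f : ℝ → ℝ} {R : ℝ}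
    (h1 : ∀ x, x ≤ -R → f x = 0) (h2 : ∀ x, R ≤ x → f x = 0) :
    ∫ x, f x = ∫ x in (-R)..R, f x := by
  refine (intervalIntegral.integral_eq_integral_of_support_subset fun x hx => ?_).symm
  by_contra h
  rw [Set.mem_Ioc, not_and_or, not_lt, not_le] at h
  rcases h with h | h
  · exact hx (h1 x h)
  · exact hx (h2 x h.le)

theorem deriv_eq_zero_of_locally {φ : ℝ → ℝ} {R : ℝ} (hφ : ContDiff ℝ ∞ φ)
    (h1 : ∀ x, x ≤ -R → φ x = 0) (h2 : ∀ x, R ≤ x → φ x = 0) :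
    (∀ x, x ≤ -R → deriv φ x = 0) ∧ ∀ x, R ≤ x → deriv φ x = 0 := by
  have hd : ∀ x, HasDerivAt φ (deriv φ x) x := fun x =>
    (hφ.differentiable (by simp) x).hasDerivAt
  constructor <;> intro x hx
  · exact (uniqueDiffWithinAt_Iic x).eq_deriv _ (hd x).hasDerivWithinAt
      ((hasDerivWithinAt_const x (Set.Iic x) 0).congr (fun y hy => h1 y (le_trans hy hx)) (h1 x hx))
  · exact (uniqueDiffWithinAt_Ici x).eq_deriv _ (hd x).hasDerivWithinAt
      ((hasDerivWithinAt_const x (Set.Ici x) 0).congr (fun y hy => h2 y (le_trans hx hy)) (h2 x hx))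

theorem continuous_primitive_of_locallyIntegrable {v : ℝ → ℝ} (hv : LocallyIntegrable v) (C : ℝ) :
    Continuous fun x => C + ∫ y in (0 : ℝ)..x, v y :=
  continuous_const.add (intervalIntegral.continuous_primitive
    (intervalIntegrable_of_locallyIntegrable hv) 0)

theorem isWeakDeriv_primitive {v : ℝ → ℝ} (hv : LocallyIntegrable v) (C : ℝ) :
    IsWeakDeriv (fun x => C + ∫ y in (0 : ℝ)..x, v y) v := by
  refine ⟨(continuous_primitive_of_locallyIntegrable hv C).locallyIntegrable, hv,
    fun φ hφ hc => ?_⟩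
  obtain ⟨R, -, h1, h2⟩ := exists_support_subset_Ioc hc
  obtain ⟨h3, h4⟩ := deriv_eq_zero_of_locally hφ h1 h2
  rw [integral_eq_intervalIntegral (R := R) (fun x hx => by rw [h3 x hx, mul_zero])
      (fun x hx => by rw [h4 x hx, mul_zero]),
    integral_eq_intervalIntegral (R := R) (fun x hx => by rw [h1 x hx, mul_zero])
      (fun x hx => by rw [h2 x hx, mul_zero]),
    integral_primitive_mul_deriv hv (hφ.of_le (by simp)), h1 _ le_rfl, h2 _ le_rfl]
  ring

namespace IsWeakDeriv

variable {u u' v v' : ℝ → ℝ}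

theorem ae_eq (h : IsWeakDeriv u v) (h' : IsWeakDeriv u v') : v =ᵐ[volume] v' := by
  refine ae_eq_of_integral_contDiff_smul_eq h.2.1 h'.2.1 fun g hg hc => ?_
  have e := (h.2.2 g hg hc).symm.trans (h'.2.2 g hg hc)
  simp only [smul_eq_mul, mul_comm (g _)]
  linarith

theorem congr_left (h : IsWeakDeriv u v) (hu : u =ᵐ[volume] u') : IsWeakDeriv u' v := by
  refine ⟨h.1.congr hu, h.2.1, fun φ hφ hc => ?_⟩
  rw [← h.2.2 φ hφ hc]
  refine integral_congr_ae ?_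
  filter_upwards [hu] with x hx
  rw [hx]

theorem weakDeriv_ae_eq (h : IsWeakDeriv u v) : weakDeriv u =ᵐ[volume] v :=
  (Classical.epsilon_spec (p := IsWeakDeriv u) ⟨v, h⟩).ae_eq h

end IsWeakDeriv

/-- A locally integrable function whose weak derivative vanishes is constant. -/
theorem ae_eq_const_of_weakDeriv_eq_zero {h : ℝ → ℝ} (hi : LocallyIntegrable h)
    (h0 : ∀ φ : ℝ → ℝ, ContDiff ℝ ∞ φ → HasCompactSupport φ → ∫ x, h x * deriv φ x = 0) :
    ∃ C, h =ᵐ[volume] fun _ => C := by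
  let b : ContDiffBump (0 : ℝ) := ⟨1, 2, one_pos, one_lt_two⟩
  set χ : ℝ → ℝ := b.normed volume with hχ
  have χs : ContDiff ℝ ∞ χ := b.contDiff_normed
  have χc : HasCompactSupport χ := b.hasCompactSupport_normed
  have χi : ∫ x, χ x = 1 := b.integral_normed
  have hint : ∀ g : ℝ → ℝ, ContDiff ℝ ∞ g → HasCompactSupport g →
      Integrable fun x => g x * h x := fun g hg hc =>
    hi.integrable_smul_left_of_hasCompactSupport hg.continuous hc
  refine ⟨∫ x, χ x * h x, ?_⟩
  refine ae_eq_of_integral_contDiff_smul_eq hi (locallyIntegrable_const _) fun g hg hc => ?_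
  set c := ∫ x, g x with hcdef
  -- Subtracting a multiple of the bump gives f mean zero. Its primitive then has compact support
  -- and is an admissible test function with derivative f.
  set f : ℝ → ℝ := fun x => g x - c * χ x with hf
  have fs : ContDiff ℝ ∞ f := hg.sub (contDiff_const.mul χs)
  have fc : HasCompactSupport f := hc.sub (χc.mul_left (f := fun _ => c))
  have fi : ∫ x, f x = 0 := by
    rw [hf, integral_sub (hg.continuous.integrable_of_hasCompactSupport hc)
      ((χs.continuous.integrable_of_hasCompactSupport χc).const_mul c), integral_const_mul, χi]
    simp [hcdef]
  obtain ⟨R, hR, h1, h2⟩ := exists_support_subset_Ioc fc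
  have fii : ∀ a b, IntervalIntegrable f volume a b := fun a b =>
    fs.continuous.intervalIntegrable a b
  set φ : ℝ → ℝ := fun x => ∫ y in (-R)..x, f y with hφ
  have φd : ∀ x, HasDerivAt φ (f x) x := fun x =>
    intervalIntegral.integral_hasDerivAt_right (fii _ _)
      fs.continuous.stronglyMeasurable.stronglyMeasurableAtFilter fs.continuous.continuousAt
  have φe : deriv φ = f := funext fun x => (φd x).deriv
  have φs : ContDiff ℝ ∞ φ := by
    rw [contDiff_infty_iff_deriv, φe]
    exact ⟨fun x => (φd x).differentiableAt, fs⟩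
  have φc : HasCompactSupport φ := by
    refine HasCompactSupport.intro (isCompact_Icc (a := -R) (b := R)) fun x hx => ?_
    rw [Set.mem_Icc, not_and_or, not_le, not_le] at hx
    simp only [hφ]
    rcases hx with hx | hx
    · rw [intervalIntegral.integral_congr (g := fun _ => 0), intervalIntegral.integral_zero]
      intro y hy
      rw [Set.uIcc_of_ge hx.le] at hy
      exact h1 y hy.2
    · rw [← intervalIntegral.integral_add_adjacent_intervals (fii (-R) R) (fii R x),
        ← integral_eq_intervalIntegral h1 h2, fi, zero_add,
        intervalIntegral.integral_congr (g := fun _ => 0), intervalIntegral.integral_zero]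
      intro y hy
      rw [Set.uIcc_of_le hx.le] at hy
      exact h2 y hy.1
  have key := h0 φ φs φc
  rw [φe] at key
  have e : (fun x => h x * f x) = fun x => g x * h x - c * (χ x * h x) := by
    ext x; simp only [hf]; ring
  rw [e, integral_sub (hint g hg hc) ((hint χ χs χc).const_mul c), integral_const_mul] at key
  simp only [smul_eq_mul]
  rw [integral_mul_const]
  linarith

/-- A function with a weak derivative is a primitive of it. -/
theorem IsWeakDeriv.exists_ae_eq {u v : ℝ → ℝ} (h : IsWeakDeriv u v) :
    ∃ C, u =ᵐ[volume] fun x => C + ∫ y in (0 : ℝ)..x, v y := by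
  have hp := isWeakDeriv_primitive h.2.1 0
  obtain ⟨C, hC⟩ := ae_eq_const_of_weakDeriv_eq_zero (h.1.sub hp.1) fun φ hφ hc => by
    have hdc : Continuous (deriv φ) := hφ.continuous_deriv (by simp)
    have i1 : Integrable fun x => deriv φ x * u x :=
      h.1.integrable_smul_left_of_hasCompactSupport hdc hc.deriv
    have i2 : Integrable fun x => deriv φ x * (0 + ∫ y in (0 : ℝ)..x, v y) :=
      hp.1.integrable_smul_left_of_hasCompactSupport hdc hc.deriv
    have e1 := h.2.2 φ hφ hc
    have e2 := hp.2.2 φ hφ hc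
    simp only [mul_comm _ (deriv φ _)] at e1 e2 ⊢
    simp only [Pi.sub_apply, mul_sub]
    rw [integral_sub i1 i2, e1, e2, sub_self]
  refine ⟨C, ?_⟩
  filter_upwards [hC] with x hx
  simp only [Pi.sub_apply, zero_add] at hx
  linarith

end FracBurgers

namespace FracBurgers

open Filter MeasureTheory

/-! ### Sine series -/

theorem integral_cos_int_mul (k : ℤ) :
    ∫ x in (-π)..π, Real.cos (k * x) = if k = 0 then 2 * π else 0 := by
  split_ifs with h
  · simp [h]; ring
  · have hk : (k : ℝ) ≠ 0 := by exact_mod_cast h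
    rw [intervalIntegral.integral_comp_mul_left (fun x => Real.cos x) hk, integral_cos]
    simp [Real.sin_int_mul_pi]

theorem integral_sin_mul_sin (m : ℕ) {n : ℕ} (hn : n ≠ 0) :
    ∫ x in (-π)..π, Real.sin (m * x) * Real.sin (n * x) = if m = n then π else 0 := by
  have e : ∀ x : ℝ, Real.sin (m * x) * Real.sin (n * x)
      = 1 / 2 * Real.cos (((m - n : ℤ) : ℝ) * x) - 1 / 2 * Real.cos (((m + n : ℤ) : ℝ) * x) := by
    intro x
    push_cast
    rw [sub_mul, add_mul, Real.cos_sub, Real.cos_add]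
    ring
  simp only [e]
  rw [intervalIntegral.integral_sub, intervalIntegral.integral_const_mul,
    intervalIntegral.integral_const_mul, integral_cos_int_mul, integral_cos_int_mul,
    if_neg (show (m + n : ℤ) ≠ 0 by omega)]
  · by_cases h : m = n
    · rw [if_pos h, if_pos (by omega)]; ring
    · rw [if_neg h, if_neg (by omega)]; ring
  all_goals
    apply Continuous.intervalIntegrable
    fun_prop

/-- The sine series with coefficients `b`. -/
noncomputable def sineSeries (b : ℕ → ℝ) (x : ℝ) : ℝ := ∑' n : ℕ, b n * Real.sin (n * x)

theorem summable_sine {b : ℕ → ℝ} (hb : Summable fun n => |b n|) (x : ℝ) :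
    Summable fun n : ℕ => b n * Real.sin (n * x) := by
  refine Summable.of_norm_bounded hb fun n => ?_
  rw [Real.norm_eq_abs, abs_mul]
  exact mul_le_of_le_one_right (abs_nonneg _) (Real.abs_sin_le_one _)

theorem continuous_sineSeries {b : ℕ → ℝ} (hb : Summable fun n => |b n|) :
    Continuous (sineSeries b) := by
  refine continuous_tsum (fun n => by fun_prop) hb fun n x => ?_
  rw [Real.norm_eq_abs, abs_mul]
  exact mul_le_of_le_one_right (abs_nonneg _) (Real.abs_sin_le_one _)

theorem sineSeries_odd (b : ℕ → ℝ) : Function.Odd (sineSeries b) := fun x => by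
  simp [sineSeries, tsum_neg]

theorem sineSeries_periodic (b : ℕ → ℝ) : Function.Periodic (sineSeries b) (2 * π) := fun x => by
  refine tsum_congr fun n => ?_
  rw [mul_add, Real.sin_add_nat_mul_two_pi]

theorem sineCoeff_zero (u : ℝ → ℝ) : sineCoeff u 0 = 0 := by simp [sineCoeff]

theorem sineCoeff_sineSeries {b : ℕ → ℝ} (hb : Summable fun n => |b n|) {n : ℕ} (hn : n ≠ 0) :
    sineCoeff (sineSeries b) n = b n := by
  have h := intervalIntegral.hasSum_integral_of_dominated_convergence (μ := volume) (a := -π)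
    (b := π) (F := fun (m : ℕ) x => b m * Real.sin (m * x) * Real.sin (n * x))
    (f := fun x => sineSeries b x * Real.sin (n * x)) (fun m _ => |b m|)
    (fun m => by apply Continuous.aestronglyMeasurable; fun_prop)
    (fun m => Eventually.of_forall fun x _ => by
      rw [Real.norm_eq_abs, abs_mul, abs_mul]
      exact (mul_le_of_le_one_right (by positivity) (Real.abs_sin_le_one _)).trans
        (mul_le_of_le_one_right (abs_nonneg _) (Real.abs_sin_le_one _)))
    (Eventually.of_forall fun x _ => hb) intervalIntegrable_const
    (Eventually.of_forall fun x _ => (summable_sine hb x).hasSum.mul_right _)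
  have e : ∀ m : ℕ, ∫ x in (-π)..π, b m * Real.sin (m * x) * Real.sin (n * x)
      = if m = n then b n * π else 0 := fun m => by
    simp only [mul_assoc]
    rw [intervalIntegral.integral_const_mul, integral_sin_mul_sin m hn]
    split_ifs with h
    · rw [h]
    · rw [mul_zero]
  simp only [e] at h
  rw [sineCoeff, h.unique (hasSum_ite_eq n _)]
  field_simp

section SobolevSeries

variable {b : ℕ → ℝ}

theorem summable_mul_abs (hb : Summable fun n : ℕ => (n : ℝ) ^ 4 * b n ^ 2) :
    Summable fun n : ℕ => (n : ℝ) * |b n| := by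
  refine ((Real.summable_one_div_nat_pow.mpr one_lt_two).add hb).of_nonneg_of_le
    (fun n => by positivity) fun n => ?_
  rcases Nat.eq_zero_or_pos n with h | h
  · subst h; simp
  · have hn : (0 : ℝ) < n := by exact_mod_cast h
    have h1 : (n : ℝ) * |b n| = 1 / n * (n ^ 2 * |b n|) := by field_simp
    have h2 : (n : ℝ) ^ 4 * b n ^ 2 = (n ^ 2 * |b n|) ^ 2 := by rw [mul_pow, sq_abs]; ring
    have h3 : 1 / (n : ℝ) ^ 2 = (1 / n) ^ 2 := by field_simp
    rw [h1, h2, h3]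
    nlinarith [sq_nonneg (1 / (n : ℝ) - n ^ 2 * |b n|), sq_nonneg (1 / (n : ℝ)),
      sq_nonneg ((n : ℝ) ^ 2 * |b n|)]

theorem summable_abs_of_mul (hb : Summable fun n : ℕ => (n : ℝ) * |b n|) :
    Summable fun n => |b n| := by
  rw [← summable_nat_add_iff 1] at hb ⊢
  refine hb.of_nonneg_of_le (fun n => abs_nonneg _) fun n => ?_
  refine le_mul_of_one_le_left (abs_nonneg _) ?_
  push_cast
  linarith [(Nat.cast_nonneg n : (0 : ℝ) ≤ n)]

/-- The derivative of the sine series. -/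
noncomputable def cosSeries (b : ℕ → ℝ) (x : ℝ) : ℝ := ∑' n : ℕ, n * b n * Real.cos (n * x)

theorem summable_cos (hb : Summable fun n : ℕ => (n : ℝ) * |b n|) (x : ℝ) :
    Summable fun n : ℕ => n * b n * Real.cos (n * x) := by
  refine Summable.of_norm_bounded hb fun n => ?_
  rw [Real.norm_eq_abs, abs_mul, abs_mul, Nat.abs_cast]
  exact mul_le_of_le_one_right (by positivity) (Real.abs_cos_le_one _)

theorem continuous_cosSeries (hb : Summable fun n : ℕ => (n : ℝ) * |b n|) :
    Continuous (cosSeries b) := by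
  refine continuous_tsum (fun n => by fun_prop) hb fun n x => ?_
  rw [Real.norm_eq_abs, abs_mul, abs_mul, Nat.abs_cast]
  exact mul_le_of_le_one_right (by positivity) (Real.abs_cos_le_one _)

theorem hasDerivAt_sineSeries (hb : Summable fun n : ℕ => (n : ℝ) * |b n|) (x : ℝ) :
    HasDerivAt (sineSeries b) (cosSeries b x) x := by
  refine hasDerivAt_tsum (g := fun (n : ℕ) y => b n * Real.sin (n * y))
    (g' := fun (n : ℕ) y => n * b n * Real.cos (n * y)) hb (fun n y => ?_) (fun n y => ?_)
    (summable_sine (summable_abs_of_mul hb) 0) x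
  · have h1 : HasDerivAt (fun y : ℝ => (n : ℝ) * y) n y := by
      simpa using (hasDerivAt_id y).const_mul (n : ℝ)
    exact (h1.sin.const_mul (b n)).congr_deriv (by ring)
  · rw [Real.norm_eq_abs, abs_mul, abs_mul, Nat.abs_cast]
    exact mul_le_of_le_one_right (by positivity) (Real.abs_cos_le_one _)

theorem memLp_sine (n : ℕ) : MemLp (fun x : ℝ => (√π)⁻¹ * Real.sin ((n + 1 : ℕ) * x)) 2
    (volume.restrict (Set.Ioc (-π) π)) := by
  have hc : Continuous fun x : ℝ => (√π)⁻¹ * Real.sin ((n + 1 : ℕ) * x) := by fun_prop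
  refine MemLp.of_bound hc.aestronglyMeasurable (√π)⁻¹ (Eventually.of_forall fun x => ?_)
  have h0 : 0 ≤ (√π)⁻¹ := by positivity
  rw [Real.norm_eq_abs, abs_mul, abs_of_nonneg h0]
  exact mul_le_of_le_one_right h0 (Real.abs_sin_le_one _)

/-- The normalised sine functions in `L²(-π, π)`. -/
noncomputable def sineLp (n : ℕ) : Lp ℝ 2 (volume.restrict (Set.Ioc (-π) π)) :=
  (memLp_sine n).toLp _

theorem coeFn_sineLp (n : ℕ) : sineLp n =ᵐ[volume.restrict (Set.Ioc (-π) π)]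
    fun x => (√π)⁻¹ * Real.sin ((n + 1 : ℕ) * x) := MemLp.coeFn_toLp _

theorem orthonormal_sineLp : Orthonormal ℝ sineLp := by
  rw [orthonormal_iff_ite]
  intro m n
  have h : ∫ x in Set.Ioc (-π) π, inner ℝ (sineLp m x) (sineLp n x)
      = ∫ x in Set.Ioc (-π) π, π⁻¹ * (Real.sin ((m + 1 : ℕ) * x) * Real.sin ((n + 1 : ℕ) * x)) := by
    refine integral_congr_ae ?_
    filter_upwards [coeFn_sineLp m, coeFn_sineLp n] with x h1 h2
    have h3 : (√π)⁻¹ * (√π)⁻¹ = π⁻¹ := by rw [← mul_inv, Real.mul_self_sqrt Real.pi_pos.le]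
    rw [h1, h2, ← h3]
    simp only [RCLike.inner_apply, conj_trivial]
    ring
  rw [L2.inner_def, h, ← intervalIntegral.integral_of_le (by linarith [Real.pi_pos]),
    intervalIntegral.integral_const_mul, integral_sin_mul_sin _ (by omega)]
  by_cases hmn : m = n
  · rw [if_pos (by omega), if_pos hmn, inv_mul_cancel₀ Real.pi_ne_zero]
  · rw [if_neg (by omega), if_neg hmn, mul_zero]

/-- The formal second derivative -∑ n² b_n sin(nx) need not converge pointwise. It is therefore
built as an orthonormal series in L², with its norm given by Parseval's identity. -/
theorem exists_hasSum_sineLp {c : ℕ → ℝ} (hc : Summable fun n => c n ^ 2) :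
    ∃ f : Lp ℝ 2 (volume.restrict (Set.Ioc (-π) π)), HasSum (fun n => c n • sineLp n) f ∧
      ‖f‖ ^ 2 = ∑' n, c n ^ 2 := by
  have h1 := orthonormal_sineLp.orthogonalFamily.summable_iff_norm_sq_summable (f := c)
  simp only [Real.norm_eq_abs, sq_abs, LinearIsometry.toSpanSingleton_apply] at h1
  refine ⟨_, (h1.mpr hc).hasSum, ?_⟩
  have h2 := ((h1.mpr hc).hasSum.norm).pow 2
  refine tendsto_nhds_unique h2 (hc.hasSum.congr fun F => ?_)
  have h3 := orthonormal_sineLp.orthogonalFamily.norm_sum c F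
  simp only [Real.norm_eq_abs, sq_abs, LinearIsometry.toSpanSingleton_apply] at h3
  exact h3.symm

end SobolevSeries

end FracBurgers

namespace FracBurgers

open Filter MeasureTheory

/-! ### Sine series in `H²` -/

theorem summable_pow_four_succ {b : ℕ → ℝ} (hb : Summable fun n : ℕ => (n : ℝ) ^ 4 * b n ^ 2) :
    HasSum (fun n : ℕ => (-(((n + 1 : ℕ) : ℝ) ^ 2 * b (n + 1) * √π)) ^ 2)
      (π * ∑' n : ℕ, (n : ℝ) ^ 4 * b n ^ 2) := by
  have h1 := (hasSum_nat_add_iff' 1).mpr hb.hasSum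
  simp only [Finset.sum_range_one, Nat.cast_zero] at h1
  have h2 := h1.mul_left π
  have e : ∀ n : ℕ, (-(((n + 1 : ℕ) : ℝ) ^ 2 * b (n + 1) * √π)) ^ 2
      = π * (((n + 1 : ℕ) : ℝ) ^ 4 * b (n + 1) ^ 2) := fun n => by
    rw [neg_sq, mul_pow, Real.sq_sqrt Real.pi_pos.le]; ring
  simp only [e]
  simpa using h2

theorem integrableOn_of_intervalIntegrable {w : ℝ → ℝ} (h : ∀ a b, IntervalIntegrable w volume a b)
    {K : Set ℝ} (hK : IsCompact K) : IntegrableOn w K := by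
  obtain ⟨R, hR⟩ := hK.isBounded.subset_closedBall 0
  have h0 : -|R| ≤ |R| := by linarith [abs_nonneg R]
  have h1 : K ⊆ Set.Icc (-|R|) |R| := fun x hx => by
    have h2 := hR hx
    rw [mem_closedBall_zero_iff, Real.norm_eq_abs] at h2
    exact abs_le.mp (h2.trans (le_abs_self R))
  exact ((intervalIntegrable_iff_integrableOn_Icc_of_le h0).mp (h _ _)).mono_set h1

theorem memL2Loc_of_intervalIntegrable {w : ℝ → ℝ} (h : ∀ a b, IntervalIntegrable w volume a b)
    (h2 : ∀ a b, IntervalIntegrable (fun x => w x ^ 2) volume a b) : MemL2Loc w := fun _ hK =>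
  (memLp_two_iff_integrable_sq (integrableOn_of_intervalIntegrable h hK).aestronglyMeasurable).mpr
    (integrableOn_of_intervalIntegrable h2 hK)

theorem Continuous.memL2Loc {u : ℝ → ℝ} (h : Continuous u) : MemL2Loc u :=
  memL2Loc_of_intervalIntegrable (fun _ _ => h.intervalIntegrable _ _)
    fun _ _ => (h.pow 2).intervalIntegrable _ _

section SobolevSeries

variable {b : ℕ → ℝ}

theorem cosSeries_periodic (b : ℕ → ℝ) : Function.Periodic (cosSeries b) (2 * π) := fun x => by
  refine tsum_congr fun n => ?_
  rw [mul_add, Real.cos_add_nat_mul_two_pi]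

/-- The second derivative of the sine series on a period. -/
theorem exists_second_deriv (hb : Summable fun n : ℕ => (n : ℝ) ^ 4 * b n ^ 2) :
    ∃ f : ℝ → ℝ, MemLp f 2 (volume.restrict (Set.Ioc (-π) π)) ∧
      ∫ x in (-π)..π, f x ^ 2 = π * ∑' n : ℕ, (n : ℝ) ^ 4 * b n ^ 2 ∧
      ∀ x y, -π ≤ x → x ≤ y → y ≤ π → ∫ t in x..y, f t = cosSeries b y - cosSeries b x := by
  have hπ := Real.pi_pos
  have hc := summable_pow_four_succ hb
  obtain ⟨f, hf, hn⟩ := exists_hasSum_sineLp hc.summable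
  refine ⟨f, Lp.memLp f, ?_, fun x y hx hxy hy => ?_⟩
  · rw [← hc.tsum_eq, ← hn, ← real_inner_self_eq_norm_sq, L2.inner_def,
      intervalIntegral.integral_of_le (by linarith)]
    refine integral_congr_ae (Eventually.of_forall fun x => ?_)
    simp only [RCLike.inner_apply, conj_trivial]
    ring
  · have hs : MeasurableSet (Set.Ioc x y) := measurableSet_Ioc
    have hμ : volume.restrict (Set.Ioc (-π) π) (Set.Ioc x y) ≠ ⊤ := measure_ne_top _ _
    have hr : (volume.restrict (Set.Ioc (-π) π)).restrict (Set.Ioc x y)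
        = volume.restrict (Set.Ioc x y) := by
      rw [Measure.restrict_restrict hs, Set.inter_eq_left.mpr (Set.Ioc_subset_Ioc hx hy)]
    -- Pairing with an indicator is a continuous functional on L². It turns L² convergence of the
    -- series into termwise integration over subintervals.
    have key : ∀ g : Lp ℝ 2 (volume.restrict (Set.Ioc (-π) π)),
        inner ℝ (indicatorConstLp 2 hs hμ (1 : ℝ)) g = ∫ t in x..y, g t := fun g => by
      rw [L2.inner_indicatorConstLp_one hs hμ, hr, intervalIntegral.integral_of_le hxy]
    have h1 : HasSum (fun n : ℕ => -(((n + 1 : ℕ) : ℝ) ^ 2 * b (n + 1) * √π)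
        * ∫ t in x..y, sineLp n t) (∫ t in x..y, f t) := by
      have h := (innerSL ℝ (indicatorConstLp 2 hs hμ (1 : ℝ))).hasSum hf
      simp only [innerSL_apply_apply, inner_smul_right] at h
      simpa only [key] using h
    have h2 : ∀ n : ℕ, -(((n + 1 : ℕ) : ℝ) ^ 2 * b (n + 1) * √π) * ∫ t in x..y, sineLp n t
        = (n + 1 : ℕ) * b (n + 1) * Real.cos ((n + 1 : ℕ) * y)
          - (n + 1 : ℕ) * b (n + 1) * Real.cos ((n + 1 : ℕ) * x) := fun n => by
      have e : ∫ t in x..y, sineLp n t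
          = ∫ t in x..y, (√π)⁻¹ * Real.sin ((n + 1 : ℕ) * t) := by
        rw [intervalIntegral.integral_of_le hxy, intervalIntegral.integral_of_le hxy]
        refine integral_congr_ae ?_
        exact ae_restrict_of_ae_restrict_of_subset (Set.Ioc_subset_Ioc hx hy) (coeFn_sineLp n)
      have h0 : ((n + 1 : ℕ) : ℝ) ≠ 0 := by positivity
      have hsq : √π ≠ 0 := by positivity
      rw [e, intervalIntegral.integral_const_mul,
        intervalIntegral.integral_comp_mul_left (fun t => Real.sin t) h0, integral_sin, smul_eq_mul]
      field_simp
      ring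
    simp only [h2] at h1
    have hb1 := summable_mul_abs hb
    have h3 := (hasSum_nat_add_iff' 1).mpr ((summable_cos hb1 y).hasSum.sub
      (summable_cos hb1 x).hasSum)
    simp only [Finset.sum_range_one, Nat.cast_zero, zero_mul, sub_zero] at h3
    exact h1.unique h3

/-- The cosine series is periodic, so its derivative has mean zero over a period. The primitive of
the periodic extension is then periodic as well, and the identity valid on one period extends to the
line. -/
theorem exists_periodic_second_deriv (hb : Summable fun n : ℕ => (n : ℝ) ^ 4 * b n ^ 2) :
    ∃ w : ℝ → ℝ, LocallyIntegrable w ∧ MemL2Loc w ∧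
      ∫ x in (-π)..π, w x ^ 2 = π * ∑' n : ℕ, (n : ℝ) ^ 4 * b n ^ 2 ∧
      ∀ x, cosSeries b x = cosSeries b 0 + ∫ t in (0 : ℝ)..x, w t := by
  have hπ := Real.pi_pos
  have h2π : 0 < 2 * π := by positivity
  obtain ⟨f, hf, hf2, hfi⟩ := exists_second_deriv hb
  set w : ℝ → ℝ := fun x => f (toIocMod h2π (-π) x) with hw
  have hwp : Function.Periodic w (2 * π) := fun x => by simp only [hw, toIocMod_add_right]
  have hwf : ∀ x ∈ Set.Ioc (-π) π, w x = f x := fun x hx => by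
    simp only [hw]
    rw [(toIocMod_eq_self h2π).mpr]
    rwa [show -π + 2 * π = π by ring]
  have hπ2 : -π + 2 * π = π := by ring
  have hle : -π ≤ π := by linarith
  have hi : ∀ a b, IntervalIntegrable w volume a b := by
    refine hwp.intervalIntegrable h2π.ne' (t := -π) ?_
    rw [hπ2, intervalIntegrable_iff_integrableOn_Ioc_of_le hle]
    exact (show IntegrableOn f (Set.Ioc (-π) π) volume from hf.integrable one_le_two).congr_fun (fun x hx => (hwf x hx).symm)
      measurableSet_Ioc
  have hi2 : ∀ a b, IntervalIntegrable (fun x => w x ^ 2) volume a b := by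
    have hp : Function.Periodic (fun x => w x ^ 2) (2 * π) := fun x => by simp only [hwp x]
    refine hp.intervalIntegrable h2π.ne' (t := -π) ?_
    rw [hπ2, intervalIntegrable_iff_integrableOn_Ioc_of_le hle]
    exact (show IntegrableOn (fun x => f x ^ 2) (Set.Ioc (-π) π) volume from
      hf.integrable_sq).congr_fun (g := fun x => w x ^ 2) (fun x hx => by simp only [hwf x hx]) measurableSet_Ioc
  have hwi : ∀ x y, -π ≤ x → x ≤ y → y ≤ π → ∫ t in x..y, w t = cosSeries b y - cosSeries b x := by
    intro x y hx hxy hy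
    rw [← hfi x y hx hxy hy]
    refine intervalIntegral.integral_congr_ae (Eventually.of_forall fun t ht => ?_)
    rw [Set.uIoc_of_le hxy] at ht
    exact hwf t ⟨by linarith [ht.1], by linarith [ht.2]⟩
  refine ⟨w, ?_, memL2Loc_of_intervalIntegrable hi hi2, ?_, fun x => ?_⟩
  · exact locallyIntegrable_iff.mpr fun K hK => integrableOn_of_intervalIntegrable hi hK
  · rw [← hf2]
    refine intervalIntegral.integral_congr_ae (Eventually.of_forall fun t ht => ?_)
    rw [Set.uIoc_of_le hle] at ht
    simp only [hwf t ht]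
  · have hm : ∫ t in (-π)..π, w t = 0 := by
      rw [hwi _ _ le_rfl hle le_rfl]
      have := cosSeries_periodic b (-π)
      rw [hπ2] at this
      rw [this, sub_self]
    have hper : Function.Periodic (fun x => cosSeries b x - ∫ t in (0 : ℝ)..x, w t) (2 * π) := by
      intro x
      have e1 := hwp.intervalIntegral_add_eq x (-π)
      rw [hπ2, hm] at e1
      have e2 := intervalIntegral.integral_add_adjacent_intervals (hi 0 x) (hi x (x + 2 * π))
      simp only [cosSeries_periodic b x]
      rw [← e2, e1, add_zero]
    obtain ⟨y, hy, e⟩ := hper.exists_mem_Ioc h2π x (-π)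
    rw [hπ2] at hy
    have e1 : cosSeries b y - ∫ t in (0 : ℝ)..y, w t = cosSeries b 0 := by
      have e2 := intervalIntegral.integral_add_adjacent_intervals (hi (-π) 0) (hi 0 y)
      rw [hwi _ _ le_rfl hy.1.le hy.2, hwi _ _ le_rfl (by linarith) hπ.le] at e2
      linarith
    linarith

theorem isWeakDeriv_sineSeries (hb : Summable fun n : ℕ => (n : ℝ) * |b n|) :
    IsWeakDeriv (sineSeries b) (cosSeries b) := by
  have hc := continuous_cosSeries hb
  have e : sineSeries b = fun x => sineSeries b 0 + ∫ t in (0 : ℝ)..x, cosSeries b t := by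
    ext x
    rw [intervalIntegral.integral_eq_sub_of_hasDerivAt (fun t _ => hasDerivAt_sineSeries hb t)
      (hc.intervalIntegrable _ _)]
    ring
  rw [e]
  exact isWeakDeriv_primitive hc.locallyIntegrable _

theorem memH2Odd_sineSeries (hb : Summable fun n : ℕ => (n : ℝ) ^ 4 * b n ^ 2) :
    MemH2Odd (sineSeries b) := by
  have h1 := summable_mul_abs hb
  obtain ⟨w, hw, hw2, -, hV⟩ := exists_periodic_second_deriv hb
  have hc := continuous_sineSeries (summable_abs_of_mul h1)
  refine ⟨hc, sineSeries_odd b, sineSeries_periodic b, Continuous.memL2Loc hc, _, w,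
    isWeakDeriv_sineSeries h1, Continuous.memL2Loc (continuous_cosSeries h1), ?_, hw2⟩
  rw [funext hV]
  exact isWeakDeriv_primitive hw _

/-- The norm involves two arbitrary choices of a weak derivative. Almost everywhere uniqueness is
used for each: the first choice may be replaced by the cosine series, the second by the L² function
w. -/
theorem normH2_sineSeries (hb : Summable fun n : ℕ => (n : ℝ) ^ 4 * b n ^ 2) :
    normH2 (sineSeries b) = √(π * ∑' n : ℕ, (n : ℝ) ^ 4 * b n ^ 2) := by
  have h1 := summable_mul_abs hb
  obtain ⟨w, hw, -, hn, hV⟩ := exists_periodic_second_deriv hb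
  have d1 := isWeakDeriv_sineSeries h1
  have d2 : IsWeakDeriv (cosSeries b) w := by
    rw [funext hV]
    exact isWeakDeriv_primitive hw _
  have d3 : IsWeakDeriv (weakDeriv (sineSeries b)) w := d2.congr_left d1.weakDeriv_ae_eq.symm
  rw [normH2, ← hn]
  congr 1
  refine intervalIntegral.integral_congr_ae ?_
  filter_upwards [d3.weakDeriv_ae_eq] with x hx _
  rw [hx]

end SobolevSeries

end FracBurgers

namespace FracBurgers

open Filter MeasureTheory

/-! ### The sine expansion of functions in `H²` -/

theorem integral_eq_zero_of_odd {f : ℝ → ℝ} (h : ∀ x, f (-x) = -f x) (a : ℝ) :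
    ∫ x in (-a)..a, f x = 0 := by
  have h1 := intervalIntegral.integral_comp_neg (a := -a) (b := a) f
  simp only [h, intervalIntegral.integral_neg, neg_neg] at h1
  linarith

/-- A continuous odd periodic function is determined by its sine coefficients. -/
theorem eq_zero_of_sineCoeff_eq_zero {d : ℝ → ℝ} (hc : Continuous d) (ho : Function.Odd d)
    (hp : Function.Periodic d (2 * π)) (h : ∀ n, sineCoeff d n = 0) (x : ℝ) : d x = 0 := by
  have hπ := Real.pi_pos
  have : Fact (0 < 2 * π) := ⟨by positivity⟩
  have hpC : Function.Periodic (fun x => (d x : ℂ)) (2 * π) := fun x => by simp only [hp x]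
  let F : C(AddCircle (2 * π), ℂ) :=
    ⟨hpC.lift, continuous_coinduced_dom.mpr (Complex.continuous_ofReal.comp hc)⟩
  have hs : ∀ n : ℤ, ∫ x in (-π)..π, d x * Real.sin (n * x) = 0 := fun n => by
    have h1 : ∀ m : ℕ, ∫ x in (-π)..π, d x * Real.sin (m * x) = 0 := fun m => by
      have := h m
      rw [sineCoeff] at this
      rcases mul_eq_zero.mp this with h2 | h2
      · exact absurd h2 (by positivity)
      · exact h2
    rcases Int.eq_nat_or_neg n with ⟨m, rfl | rfl⟩
    · exact_mod_cast h1 m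
    · have := h1 m
      simp only [Int.cast_neg, Int.cast_natCast, neg_mul, Real.sin_neg, mul_neg,
        intervalIntegral.integral_neg, this, neg_zero]
  -- The cosine part vanishes by oddness and the sine part by hypothesis. A continuous function with
  -- summable Fourier coefficients is the pointwise sum of its series, here zero.
  have hF : ∀ n : ℤ, fourierCoeff F n = 0 := fun n => by
    have e : ∀ x : ℝ, fourier (-n) (x : AddCircle (2 * π)) • F x
        = ((d x * Real.cos (n * x) : ℝ) : ℂ) - ((d x * Real.sin (n * x) : ℝ) : ℂ) * Complex.I := by
      intro x
      have e1 : F x = (d x : ℂ) := rfl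
      have e2 : 2 * (π : ℂ) * Complex.I * ((-n : ℤ) : ℂ) * (x : ℂ) / ((2 * π : ℝ) : ℂ)
          = ((-(n * x) : ℝ) : ℂ) * Complex.I := by
        have : (π : ℂ) ≠ 0 := by exact_mod_cast hπ.ne'
        push_cast
        field_simp
      rw [e1, fourier_coe_apply, e2, Complex.exp_mul_I, ← Complex.ofReal_cos, ← Complex.ofReal_sin,
        Real.cos_neg, Real.sin_neg, smul_eq_mul]
      push_cast
      ring
    have c1 : Continuous fun x => ((d x * Real.cos (n * x) : ℝ) : ℂ) := by fun_prop
    have c2 : Continuous fun x => ((d x * Real.sin (n * x) : ℝ) : ℂ) * Complex.I := by fun_prop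
    rw [fourierCoeff_eq_intervalIntegral F n (-π), show -π + 2 * π = π by ring]
    simp only [e]
    rw [intervalIntegral.integral_sub (c1.intervalIntegrable _ _) (c2.intervalIntegrable _ _),
      intervalIntegral.integral_mul_const, intervalIntegral.integral_ofReal,
      intervalIntegral.integral_ofReal, hs,
      integral_eq_zero_of_odd (f := fun x => d x * Real.cos (n * x)) fun x => by
        rw [ho x, mul_neg, Real.cos_neg]; ring]
    simp
  have h1 := has_pointwise_sum_fourier_series_of_summable (f := F)
    (by rw [funext hF]; exact summable_zero) (x : AddCircle (2 * π))
  simp only [hF, zero_smul] at h1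
  have h2 : (d x : ℂ) = 0 := h1.unique hasSum_zero
  exact_mod_cast h2

theorem sineCoeff_sub {u v : ℝ → ℝ} (hu : Continuous u) (hv : Continuous v) (n : ℕ) :
    sineCoeff (u - v) n = sineCoeff u n - sineCoeff v n := by
  rw [sineCoeff, sineCoeff, sineCoeff, ← mul_sub, ← intervalIntegral.integral_sub]
  · simp only [Pi.sub_apply, sub_mul]
  all_goals
    apply Continuous.intervalIntegrable
    fun_prop

/-- The sine coefficients in terms of the second derivative. -/
theorem MemH2Odd.exists_second_deriv {u : ℝ → ℝ} (h : MemH2Odd u) :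
    ∃ w, MemLp w 2 (volume.restrict (Set.Ioc (-π) π)) ∧ ∀ n : ℕ, n ≠ 0 →
      (n : ℝ) ^ 2 * sineCoeff u n = -(π⁻¹ * ∫ x in (-π)..π, w x * Real.sin (n * x)) := by
  obtain ⟨-, v, w, huv, -, hvw, hw2⟩ := h.memH2Loc
  refine ⟨w, (hw2 _ isCompact_Icc).mono_measure
    (Measure.restrict_mono Set.Ioc_subset_Icc_self le_rfl), fun n hn => ?_⟩
  obtain ⟨C', hV⟩ := hvw.exists_ae_eq
  obtain ⟨C, hU⟩ := huv.exists_ae_eq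
  set V : ℝ → ℝ := fun x => C' + ∫ y in (0 : ℝ)..x, w y with hVdef
  have Vc : Continuous V := continuous_primitive_of_locallyIntegrable hvw.2.1 C'
  have hu : u = fun x => C + ∫ y in (0 : ℝ)..x, V y := by
    refine (h.continuous.ae_eq_iff_eq volume
      (continuous_primitive_of_locallyIntegrable Vc.locallyIntegrable C)).mp (hU.trans ?_)
    refine Eventually.of_forall fun x => ?_
    simp only
    congr 1
    exact intervalIntegral.integral_congr_ae (hV.mono fun y hy _ => hy)
  have hn0 : (n : ℝ) ≠ 0 := by exact_mod_cast hn
  have dmul : ∀ x, HasDerivAt (fun x : ℝ => (n : ℝ) * x) n x := fun x => by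
    simpa using (hasDerivAt_id x).const_mul (n : ℝ)
  have d1 : deriv (fun x => -(Real.cos (n * x) / n)) = fun x => Real.sin (n * x) := funext fun x =>
    (((dmul x).cos.div_const (n : ℝ)).neg.congr_deriv (by field_simp)).deriv
  have d2 : deriv (fun x => Real.sin (n * x) / n) = fun x => Real.cos (n * x) := funext fun x =>
    (((dmul x).sin.div_const (n : ℝ)).congr_deriv (by field_simp)).deriv
  have e1 := integral_primitive_mul_deriv Vc.locallyIntegrable
    (g := fun x => -(Real.cos (n * x) / n)) (by fun_prop) C (-π) π
  have e2 := integral_primitive_mul_deriv hvw.2.1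
    (g := fun x => Real.sin (n * x) / n) (by fun_prop) C' (-π) π
  -- Periodicity cancels the boundary terms of the first integration by parts, where the cosine is
  -- even. Those of the second vanish because sin(nπ) = 0.
  have hper : C + ∫ y in (0 : ℝ)..π, V y = C + ∫ y in (0 : ℝ)..(-π), V y := by
    have := h.periodic (-π)
    rw [show -π + 2 * π = π by ring, hu] at this
    exact this
  have eu : ∀ x, C + ∫ y in (0 : ℝ)..x, V y = u x := fun x => (congrFun hu x).symm
  have ew : ∀ x, C' + ∫ y in (0 : ℝ)..x, w y = V x := fun x => rfl
  rw [d1, hper] at e1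
  rw [d2] at e2
  simp only [eu, ew, mul_neg, Real.cos_neg, Real.sin_neg, Real.sin_nat_mul_pi, zero_div, neg_zero,
    mul_zero, sub_self, zero_sub, intervalIntegral.integral_neg, neg_neg, mul_div_assoc',
    intervalIntegral.integral_div] at e1 e2
  rw [sineCoeff, e1, e2]
  field_simp

/-- Bessel's inequality for the second derivative, whose sine coefficients are -n² times those of u.
-/
theorem MemH2Odd.summable {u : ℝ → ℝ} (h : MemH2Odd u) :
    Summable fun n : ℕ => (n : ℝ) ^ 4 * sineCoeff u n ^ 2 := by
  obtain ⟨w, hw, hn⟩ := h.exists_second_deriv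
  have h1 := orthonormal_sineLp.inner_products_summable (hw.toLp w)
  have e : ∀ n : ℕ, inner ℝ (sineLp n) (hw.toLp w)
      = (√π)⁻¹ * ∫ x in (-π)..π, w x * Real.sin ((n + 1 : ℕ) * x) := fun n => by
    rw [L2.inner_def, ← intervalIntegral.integral_const_mul,
      intervalIntegral.integral_of_le (by linarith [Real.pi_pos])]
    refine integral_congr_ae ?_
    filter_upwards [coeFn_sineLp n, hw.coeFn_toLp] with x h1 h2
    rw [h1, h2]
    simp only [RCLike.inner_apply, conj_trivial]
    ring
  rw [← summable_nat_add_iff 1]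
  refine (h1.mul_left π⁻¹).congr fun n => ?_
  have h2 := hn (n + 1) (by omega)
  have h3 : ((n + 1 : ℕ) : ℝ) ^ 4 * sineCoeff u (n + 1) ^ 2
      = (((n + 1 : ℕ) : ℝ) ^ 2 * sineCoeff u (n + 1)) ^ 2 := by ring
  rw [h3, h2, e, Real.norm_eq_abs, sq_abs, mul_pow, inv_pow, Real.sq_sqrt Real.pi_pos.le]
  ring

theorem MemH2Odd.eq_sineSeries {u : ℝ → ℝ} (h : MemH2Odd u) : u = sineSeries (sineCoeff u) := by
  have hb := summable_abs_of_mul (summable_mul_abs h.summable)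
  have hc := continuous_sineSeries hb
  ext x
  have := eq_zero_of_sineCoeff_eq_zero (h.continuous.sub hc)
    (fun x => by simp only [Pi.sub_apply, h.odd x, sineSeries_odd _ x]; ring)
    (fun x => by simp only [Pi.sub_apply, h.periodic x, sineSeries_periodic _ x])
    (fun n => by
      rw [sineCoeff_sub h.continuous hc]
      by_cases hn : n = 0
      · rw [hn, sineCoeff_zero, sineCoeff_zero, sub_zero]
      · rw [sineCoeff_sineSeries hb hn, sub_self]) x
  simp only [Pi.sub_apply] at this
  linarith

end FracBurgers

namespace FracBurgers

open Filter MeasureTheory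

/-! ### The nonlinearity in Fourier space -/

theorem hasSum_int_of_even {f : ℤ → ℝ} (he : ∀ k, f (-k) = f k) (h0 : f 0 = 0)
    (h : Summable fun n : ℕ => f n) : HasSum f (2 * ∑' n : ℕ, f n) := by
  have h1 := HasSum.of_nat_of_neg (f := f) h.hasSum (by simpa only [he] using h.hasSum)
  rwa [h0, sub_zero, ← two_mul] at h1

theorem summable_nat_of_int {f : ℤ → ℝ} (h : Summable f) : Summable fun n : ℕ => f n :=
  h.comp_injective Nat.cast_injective

/-- The signed counterpart of `tsum_conv`: the Cauchy product, regrouped by the sum of the two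
indices. -/
theorem hasSum_conv {a b : ℤ → ℝ} (ha : Summable fun k => |a k|) (hb : Summable fun k => |b k|) :
    HasSum (conv a b) ((∑' j, a j) * ∑' j, b j) := by
  have h := summable_mul_of_summable_norm (f := a) (g := b) ha hb
  have ht := tsum_mul_tsum_of_summable_norm (f := a) (g := b) ha hb
  let e : ℤ × ℤ ≃ ℤ × ℤ :=
    { toFun := fun p => (p.2, p.1 - p.2)
      invFun := fun p => (p.1 + p.2, p.1)
      left_inv := fun p => by simp
      right_inv := fun p => by simp }
  have h1 := (e.hasSum_iff (f := fun p : ℤ × ℤ => a p.1 * b p.2)).mpr h.hasSum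
  rw [← ht] at h1
  exact h1.prod_fiberwise fun k => (summable_conv_of_bdd ha (abs_le_tsum_abs hb) k).hasSum

theorem summable_int_abs {f : ℤ → ℝ} (h : Summable fun k : ℤ => (k : ℝ) ^ 4 * f k ^ 2) :
    Summable fun k : ℤ => |(k : ℝ)| * |f k| := by
  refine ((Real.summable_one_div_int_pow.mpr one_lt_two).add h).of_nonneg_of_le
    (fun k => by positivity) fun k => ?_
  by_cases hk : k = 0
  · subst hk; simp
  · have hp := abs_cast_pos hk
    have h1 : |(k : ℝ)| * |f k| = 1 / |(k : ℝ)| * (|(k : ℝ)| ^ 2 * |f k|) := by field_simp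
    have h2 : (k : ℝ) ^ 4 * f k ^ 2 = (|(k : ℝ)| ^ 2 * |f k|) ^ 2 := by
      rw [mul_pow, sq_abs, sq_abs]; ring
    have h3 : 1 / (k : ℝ) ^ 2 = (1 / |(k : ℝ)|) ^ 2 := by rw [div_pow, sq_abs, one_pow]
    rw [h1, h2, h3]
    nlinarith [sq_nonneg (1 / |(k : ℝ)| - |(k : ℝ)| ^ 2 * |f k|), sq_nonneg (1 / |(k : ℝ)|),
      sq_nonneg (|(k : ℝ)| ^ 2 * |f k|)]

section Nonlinearity

variable {f : ℤ → ℝ}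

theorem summable_pow_four_conv (ho : ∀ k, f (-k) = -f k)
    (h : Summable fun k : ℤ => (k : ℝ) ^ 4 * f k ^ 2) :
    (Summable fun k => |f k|) ∧ Summable fun k : ℤ => (k : ℝ) ^ 4 * conv f f k ^ 2 := by
  have h0 : f 0 = 0 := by have := ho 0; simp at this; linarith
  have ha : Summable fun k : ℤ => (k : ℝ) ^ 4 * |f k| ^ 2 := by simpa only [sq_abs] using h
  have h1 := sq_tsum_le (b := fun k => |f k|) (fun k => abs_nonneg _) (by simp [h0]) ha
  refine ⟨h1.1, ?_⟩
  have h2 := (tsum_pow_four_mul_conv_sq_le (b := fun k => |f k|) (fun k => abs_nonneg _)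
    (fun k => by rw [ho, abs_neg]) (by simp [h0]) ha).1
  refine h2.of_nonneg_of_le (fun k => by positivity) fun k => ?_
  refine mul_le_mul_of_nonneg_left ?_ (by positivity)
  exact sq_le_sq' (neg_le_of_abs_le (abs_conv_le (fun j => le_rfl) (fun j => le_rfl) h1.1
    (le_tsum_of_nonneg (fun _ => abs_nonneg _) h1.1) k)) (le_of_abs_le (abs_conv_le
    (fun j => le_rfl) (fun j => le_rfl) h1.1 (le_tsum_of_nonneg (fun _ => abs_nonneg _) h1.1) k))

/-- Over the integers, ∑ f_k sin(kx) is twice the sine series and ∑ f_k cos(kx) vanishes by oddness.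
The addition formula for cos(jx + (k - j)x) then gives ∑ (f * f)_k cos(kx) = 0² - (2u)². -/
theorem sineSeries_sq (ho : ∀ k, f (-k) = -f k) (hs : Summable fun k => |f k|) (x : ℝ) :
    sineSeries (fun n => f n) x ^ 2 = -(1 / 4) * ∑' k : ℤ, conv f f k * Real.cos (k * x) := by
  have h0 : f 0 = 0 := by have := ho 0; simp at this; linarith
  have s1 : Summable fun k : ℤ => |f k * Real.sin (k * x)| :=
    hs.of_nonneg_of_le (fun _ => abs_nonneg _) fun k => by
      rw [abs_mul]; exact mul_le_of_le_one_right (abs_nonneg _) (Real.abs_sin_le_one _)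
  have s2 : Summable fun k : ℤ => |f k * Real.cos (k * x)| :=
    hs.of_nonneg_of_le (fun _ => abs_nonneg _) fun k => by
      rw [abs_mul]; exact mul_le_of_le_one_right (abs_nonneg _) (Real.abs_cos_le_one _)
  have e1 : ∑' k : ℤ, f k * Real.sin (k * x) = 2 * sineSeries (fun n => f n) x := by
    have := (hasSum_int_of_even (f := fun k : ℤ => f k * Real.sin (k * x)) (fun k => by
      rw [ho]; push_cast; rw [neg_mul (k : ℝ), Real.sin_neg]; ring) (by simp)
      (summable_nat_of_int s1.of_abs)).tsum_eq
    rw [this]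
    simp [sineSeries]
  have e2 : ∑' k : ℤ, f k * Real.cos (k * x) = 0 := by
    have h := (Equiv.neg ℤ).tsum_eq fun k : ℤ => f k * Real.cos (k * x)
    simp only [Equiv.neg_apply, ho, Int.cast_neg, neg_mul, Real.cos_neg, tsum_neg] at h
    linarith
  have c1 := hasSum_conv s1 s1
  have c2 := hasSum_conv s2 s2
  have e3 : ∀ k : ℤ, conv f f k * Real.cos (k * x)
      = conv (fun j => f j * Real.cos (j * x)) (fun j => f j * Real.cos (j * x)) k
        - conv (fun j => f j * Real.sin (j * x)) (fun j => f j * Real.sin (j * x)) k := fun k => by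
    rw [conv, conv, conv, ← tsum_mul_right,
      ← (summable_conv_of_bdd s2 (abs_le_tsum_abs s2) k).tsum_sub
        (summable_conv_of_bdd s1 (abs_le_tsum_abs s1) k)]
    refine tsum_congr fun j => ?_
    have : (k : ℝ) * x = j * x + ((k - j : ℤ) : ℝ) * x := by push_cast; ring
    rw [this, Real.cos_add]
    ring
  simp only [e3]
  rw [(c2.sub c1).tsum_eq, e1, e2]
  ring

theorem hasDerivAt_sineSeries_sq (ho : ∀ k, f (-k) = -f k)
    (h : Summable fun k : ℤ => (k : ℝ) ^ 4 * f k ^ 2) (x : ℝ) :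
    HasDerivAt (fun y => sineSeries (fun n => f n) y ^ 2)
      (1 / 2 * sineSeries (fun n => n * conv f f n) x) x := by
  obtain ⟨hs, hc⟩ := summable_pow_four_conv ho h
  have hc1 := summable_int_abs hc
  have hb : ∀ (k : ℤ) (y : ℝ), ‖(k : ℝ) * conv f f k * Real.sin (k * y)‖
      ≤ |(k : ℝ)| * |conv f f k| := fun k y => by
    rw [Real.norm_eq_abs, abs_mul, abs_mul]
    exact mul_le_of_le_one_right (by positivity) (Real.abs_sin_le_one _)
  have hd := hasDerivAt_tsum (𝕜 := ℝ) (y₀ := π / 2)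
    (g := fun (k : ℤ) y => conv f f k * Real.cos (k * y))
    (g' := fun (k : ℤ) y => -(k * conv f f k * Real.sin (k * y))) hc1 (fun k y => ?_)
    (fun k y => by rw [norm_neg]; exact hb k y) ?_ x
  · have h1 := hd.const_mul (-(1 / 4) : ℝ)
    have e : (fun y => sineSeries (fun n => f n) y ^ 2)
        = fun y => -(1 / 4) * ∑' k : ℤ, conv f f k * Real.cos (k * y) :=
      funext fun y => sineSeries_sq ho hs y
    rw [e]
    refine h1.congr_deriv ?_
    have h2 := (hasSum_int_of_even (f := fun k : ℤ => k * conv f f k * Real.sin (k * x))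
      (fun k => by
        rw [conv_odd ho ho]; push_cast; rw [neg_mul, neg_mul, neg_mul, Real.sin_neg]; ring)
      (by simp) (summable_nat_of_int (Summable.of_norm_bounded hc1 fun k => hb k x))).tsum_eq
    rw [tsum_neg, h2]
    simp only [sineSeries, Int.cast_natCast]
    ring
  · have h1 : HasDerivAt (fun y : ℝ => (k : ℝ) * y) k y := by
      simpa using (hasDerivAt_id y).const_mul (k : ℝ)
    exact (h1.cos.const_mul (conv f f k)).congr_deriv (by ring)
  · refine Summable.of_norm_bounded (summable_conv (fun _ => abs_nonneg _)
      (fun _ => abs_nonneg _) hs hs) fun k => ?_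
    rw [Real.norm_eq_abs, abs_mul]
    exact (mul_le_of_le_one_right (abs_nonneg _) (Real.abs_cos_le_one _)).trans
      (abs_conv_le (fun j => le_rfl) (fun j => le_rfl) hs
        (le_tsum_of_nonneg (fun _ => abs_nonneg _) hs) k)

theorem forcing_eq (t x : ℝ) : HasSum (fun n : ℕ => force n t * Real.sin (n * x)) (forcing t x) := by
  have h := hasSum_ite_eq (1 : ℕ) (forcing t x)
  refine h.congr_fun fun n => ?_
  by_cases hn : n = 1
  · subst hn; simp [force, forcing]
  · rw [if_neg hn, force, if_neg (by omega), if_neg (by omega), zero_mul]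

theorem nonlinearity_sineSeries {v : ℤ → ℝ → ℝ} {t : ℝ} (ho : ∀ k, v (-k) t = -v k t)
    (h : Summable fun k : ℤ => (k : ℝ) ^ 4 * v k t ^ 2) :
    nonlinearity (1 / 2) forcing t (sineSeries fun n => v n t)
      = sineSeries fun n => source v n t := by
  ext x
  obtain ⟨hs, hc⟩ := summable_pow_four_conv ho h
  have hc1 := summable_nat_of_int (summable_int_abs hc)
  simp only [Int.cast_natCast, Nat.abs_cast] at hc1
  have h1 : Summable fun n : ℕ => (n : ℝ) * conv (fun j => v j t) (fun j => v j t) n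
      * Real.sin (n * x) := by
    refine Summable.of_norm_bounded hc1 fun n => ?_
    rw [Real.norm_eq_abs, abs_mul, abs_mul, Nat.abs_cast]
    exact mul_le_of_le_one_right (by positivity) (Real.abs_sin_le_one _)
  have h2 := (h1.hasSum.mul_left (1 / 4)).add (forcing_eq t x)
  rw [nonlinearity, (hasDerivAt_sineSeries_sq (f := fun k => v k t) ho h x).deriv]
  have e : sineSeries (fun n => source v n t) x = _ := (h2.congr_fun (g := fun n : ℕ =>
    source v n t * Real.sin (n * x)) fun n => by
      simp only [source, Int.cast_natCast]; ring).tsum_eq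
  rw [e, sineSeries]
  ring

end Nonlinearity

end FracBurgers

namespace FracBurgers

open Filter MeasureTheory

/-! ### From trajectories of coefficients to solutions -/

theorem rate_natCast {s : ℝ} {n : ℕ} (hn : n ≠ 0) : rate s n = (n : ℝ) ^ (1 + s) := by
  have hn0 : (0 : ℝ) < n := by exact_mod_cast Nat.pos_of_ne_zero hn
  rw [rate, symbolWeight, Int.cast_natCast, Nat.abs_cast, Real.rpow_add hn0, Real.rpow_one]

theorem semigroup_sineSeries {s α : ℝ} (hα : 2 * α = 1 + s) (t : ℝ) {c : ℕ → ℝ}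
    (hc : Summable fun n => |c n|) :
    semigroup α t (sineSeries c) = sineSeries fun n => Real.exp (-rate s n * t) * c n := by
  ext x
  refine tsum_congr fun n => ?_
  -- Mode zero carries the factor sin 0, so its multiplier is irrelevant, and `sineCoeff_sineSeries`
  -- would not apply to it.
  by_cases hn : n = 0
  · simp [hn]
  · rw [sineCoeff_sineSeries hc hn, hα]
    beta_reduce
    rw [rate_natCast hn, show -t * (n : ℝ) ^ (1 + s) = -(n : ℝ) ^ (1 + s) * t by ring]

/-- The smoothing effect of the semigroup. -/
theorem mul_exp_neg_le {p τ : ℝ} (hp : 1 ≤ p) (hτ : 0 < τ) {y : ℝ} (hy : 0 ≤ y) :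
    y * Real.exp (-(y ^ p) * τ) ≤ τ ^ (-p⁻¹) := by
  have hp0 : 0 < p := by linarith
  set z := τ ^ p⁻¹ * y with hz
  have hτp : 0 < τ ^ p⁻¹ := Real.rpow_pos_of_pos hτ _
  have hz0 : 0 ≤ z := by positivity
  have e1 : z ^ p = y ^ p * τ := by
    rw [hz, Real.mul_rpow hτp.le hy, ← Real.rpow_mul hτ.le, inv_mul_cancel₀ hp0.ne', Real.rpow_one]
    ring
  have h1 : z ≤ Real.exp (z ^ p) := by
    rcases le_or_gt z 1 with h | h
    · exact h.trans (Real.one_le_exp (by positivity))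
    · have h2 : z ≤ z ^ p := by
        conv_lhs => rw [← Real.rpow_one z]
        exact Real.rpow_le_rpow_of_exponent_le h.le hp
      linarith [Real.add_one_le_exp (z ^ p)]
  rw [neg_mul, ← e1, Real.exp_neg, Real.rpow_neg hτ.le, ← div_eq_mul_inv, ← one_div,
    div_le_div_iff₀ (Real.exp_pos _) hτp, one_mul, mul_comm]
  exact h1

theorem summable_abs_of_mul_sq {M : ℕ → ℝ} (h : Summable fun n : ℕ => (n : ℝ) ^ 2 * M n ^ 2) :
    Summable fun n => |M n| := by
  have h2 := Real.summable_one_div_nat_pow.mpr one_lt_two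
  rw [← summable_nat_add_iff 1] at h h2 ⊢
  refine (h2.add h).of_nonneg_of_le (fun n => abs_nonneg _) fun n => ?_
  set m : ℝ := ((n + 1 : ℕ) : ℝ) with hm
  have hm0 : 0 < m := by positivity
  have e1 : |M (n + 1)| = 1 / m * (m * |M (n + 1)|) := by field_simp
  have e2 : m ^ 2 * M (n + 1) ^ 2 = (m * |M (n + 1)|) ^ 2 := by rw [mul_pow, sq_abs]
  have e3 : 1 / m ^ 2 = (1 / m) ^ 2 := by rw [div_pow, one_pow]
  rw [e1, e2, e3]
  nlinarith [sq_nonneg (1 / m - m * |M (n + 1)|), sq_nonneg (1 / m), sq_nonneg (m * |M (n + 1)|)]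

/-! ### Modewise Duhamel formulas give mild solutions in H² -/

section Solution

variable {s t₀ : ℝ} {v : ℤ → ℝ → ℝ}

/-- The function on the line with coefficients `v` at time `t`. -/
noncomputable def toFunction (v : ℤ → ℝ → ℝ) (t : ℝ) : ℝ → ℝ := sineSeries fun n => v n t

namespace IsTrajectory

theorem exists_bound (h : IsTrajectory s t₀ v) : ∃ b : ℤ → ℝ, (∀ k t, |v k t| ≤ b k) ∧
    (∀ k, b (-k) = b k) ∧ b 0 = 0 ∧ Summable fun k : ℤ => (k : ℝ) ^ 4 * b k ^ 2 := by
  obtain ⟨b, hb, hs⟩ := h.majorant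
  refine ⟨fun k => supAbs (v k), fun k t => abs_le_supAbs (hb k) t, fun k => ?_, ?_, ?_⟩
  · show supAbs (v (-k)) = supAbs (v k)
    rw [show v (-k) = fun t => -v k t from funext (h.odd k), supAbs_neg]
  · have : v 0 = fun _ => 0 := funext fun t => by
      have := h.odd 0 t
      simp at this
      linarith
    simp [this, supAbs]
  · refine hs.of_nonneg_of_le (fun k => by positivity) fun k => ?_
    exact mul_le_mul_of_nonneg_left (pow_le_pow_left₀ (supAbs_nonneg _) (supAbs_le (hb k)) 2)
      (by positivity)

theorem summable (h : IsTrajectory s t₀ v) (t : ℝ) :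
    Summable fun k : ℤ => (k : ℝ) ^ 4 * v k t ^ 2 := by
  obtain ⟨b, hb, hs⟩ := h.majorant
  refine hs.of_nonneg_of_le (fun k => by positivity) fun k => ?_
  rw [← sq_abs (v k t)]
  exact mul_le_mul_of_nonneg_left (pow_le_pow_left₀ (abs_nonneg _) (hb k t) 2) (by positivity)

theorem summable_nat (h : IsTrajectory s t₀ v) (t : ℝ) :
    Summable fun n : ℕ => (n : ℝ) ^ 4 * v n t ^ 2 := by
  simpa using summable_nat_of_int (h.summable t)

theorem nonlinearity_eq (h : IsTrajectory s t₀ v) (t : ℝ) :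
    nonlinearity (1 / 2) forcing t (toFunction v t) = sineSeries fun n => source v n t :=
  nonlinearity_sineSeries (fun k => h.odd k t) (h.summable t)

theorem continuous_source (h : IsTrajectory s t₀ v) (k : ℤ) : Continuous (source v k) := by
  obtain ⟨b, hb, -, hb0, hbs⟩ := h.exists_bound
  have hbn : ∀ k, 0 ≤ b k := fun k => (abs_nonneg _).trans (hb k 0)
  have hs := (sq_tsum_le hbn hb0 hbs).1
  have hc := continuous_conv h.cont h.cont hs hb hb (le_tsum_of_nonneg hbn hs) k
  have hf := continuous_force k
  unfold source
  fun_prop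

/-- The square stays in H² by the algebra property, and the x-derivative costs one power of n. The
source is thus bounded in H¹ uniformly in time, and the semigroup must recover one derivative. -/
theorem exists_source_bound (h : IsTrajectory s t₀ v) : ∃ M : ℕ → ℝ,
    (∀ (n : ℕ) t, |source v n t| ≤ M n) ∧ Summable fun n : ℕ => (n : ℝ) ^ 2 * M n ^ 2 := by
  obtain ⟨b, hb, hbe, hb0, hbs⟩ := h.exists_bound
  have hbn : ∀ k, 0 ≤ b k := fun k => (abs_nonneg _).trans (hb k 0)
  have hs := (sq_tsum_le hbn hb0 hbs).1
  have hc := summable_nat_of_int (tsum_pow_four_mul_conv_sq_le hbn hbe hb0 hbs).1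
  have hfin : Summable fun n : ℕ => if n = 1 then (9 : ℝ) / 2 else 0 :=
    (hasSum_ite_eq 1 _).summable
  refine ⟨fun n => (n : ℝ) / 4 * conv b b n + if n = 1 then 3 / 2 else 0, fun n t => ?_, ?_⟩
  · rw [source]
    refine (abs_add_le _ _).trans (add_le_add ?_ ?_)
    · rw [abs_mul, abs_of_nonneg (by positivity), Int.cast_natCast]
      exact mul_le_mul_of_nonneg_left (abs_conv_le (fun j => hb j t) (fun j => hb j t) hs
        (le_tsum_of_nonneg hbn hs) _) (by positivity)
    · have h1 := Real.neg_one_le_sin (2 * π * t)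
      have h2 := Real.sin_le_one (2 * π * t)
      by_cases hn : n = 1
      · subst hn
        simp only [force, Nat.cast_one, if_true]
        rw [abs_le]
        constructor <;> linarith
      · rw [force, if_neg (by omega), if_neg (by omega), if_neg hn, abs_zero]
  · refine ((hc.mul_left (1 / 8)).add hfin).of_nonneg_of_le (fun n => by positivity) fun n => ?_
    simp only [Int.cast_natCast]
    by_cases hn : n = 1
    · subst hn
      simp only [if_true, Nat.cast_one]
      nlinarith [sq_nonneg (1 / 4 * conv b b 1 - 3 / 2)]
    · simp only [if_neg hn, add_zero]
      have : 0 ≤ (n : ℝ) ^ 4 * conv b b n ^ 2 := by positivity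
      linarith

theorem source_integrand (h : IsTrajectory s t₀ v) {α : ℝ} (hα : 2 * α = 1 + s) (t r : ℝ) :
    semigroup α (t - r) (nonlinearity (1 / 2) forcing r (toFunction v r))
      = sineSeries fun n => Real.exp (-rate s n * (t - r)) * source v n r := by
  obtain ⟨M, hM, hs⟩ := h.exists_source_bound
  rw [h.nonlinearity_eq]
  refine semigroup_sineSeries hα _ ?_
  exact (summable_abs_of_mul_sq hs).of_nonneg_of_le (fun _ => abs_nonneg _) fun n =>
    (hM n r).trans (le_abs_self _)

/-- The integrand in the Duhamel formula and its norm. -/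
theorem exists_integrand_bound (h : IsTrajectory s t₀ v) (hs : 0 ≤ s) : ∃ K : ℝ, ∀ t r, r < t →
    (Summable fun n : ℕ =>
      (n : ℝ) ^ 4 * (Real.exp (-rate s n * (t - r)) * source v n r) ^ 2) ∧
    √(π * ∑' n : ℕ, (n : ℝ) ^ 4 * (Real.exp (-rate s n * (t - r)) * source v n r) ^ 2)
      ≤ K * (t - r) ^ (-(1 + s)⁻¹) := by
  obtain ⟨M, hM, hMs⟩ := h.exists_source_bound
  refine ⟨√(π * ∑' n : ℕ, (n : ℝ) ^ 2 * M n ^ 2), fun t r hr => ?_⟩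
  have hτ : 0 < t - r := by linarith
  set q := (t - r) ^ (-(1 + s)⁻¹) with hq
  have hq0 : 0 ≤ q := by positivity
  have hle : ∀ n : ℕ, (n : ℝ) ^ 4 * (Real.exp (-rate s n * (t - r)) * source v n r) ^ 2
      ≤ q ^ 2 * ((n : ℝ) ^ 2 * M n ^ 2) := fun n => by
    by_cases hn : n = 0
    · simp [hn]
    · have h1 := mul_exp_neg_le (p := 1 + s) (by linarith) hτ (y := n) (by positivity)
      rw [← rate_natCast hn, ← hq] at h1
      have h2 : |source v n r| ≤ M n := hM n r
      have h3 : (n : ℝ) * Real.exp (-rate s n * (t - r)) * ((n : ℝ) * |source v n r|)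
          ≤ q * (n * M n) := by
        gcongr
      have h4 := pow_le_pow_left₀ (by positivity) h3 2
      calc _ = ((n : ℝ) * Real.exp (-rate s n * (t - r)) * ((n : ℝ) * |source v n r|)) ^ 2 := by
            rw [mul_pow _ (source v n r), ← sq_abs (source v n r)]; ring
        _ ≤ _ := h4
        _ = _ := by ring
  have hsum := (hMs.mul_left (q ^ 2)).of_nonneg_of_le (fun n => by positivity) hle
  refine ⟨hsum, ?_⟩
  have h1 := hsum.tsum_le_tsum hle (hMs.mul_left (q ^ 2))
  rw [tsum_mul_left] at h1
  have h2 : π * ∑' n : ℕ, (n : ℝ) ^ 4 * (Real.exp (-rate s n * (t - r)) * source v n r) ^ 2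
      ≤ π * (∑' n : ℕ, (n : ℝ) ^ 2 * M n ^ 2) * q ^ 2 := by
    have := mul_le_mul_of_nonneg_left h1 Real.pi_pos.le
    linarith
  refine (Real.sqrt_le_sqrt h2).trans (le_of_eq ?_)
  rw [Real.sqrt_mul' _ (sq_nonneg q), Real.sqrt_sq hq0]

/-- Each mode is continuous and the H² majorant does not depend on time, so dominated convergence
applies to the sum of squares. -/
theorem continuous_toFunction (h : IsTrajectory s t₀ v) (t : ℝ) :
    Tendsto (fun r => normH2 (toFunction v r - toFunction v t)) (𝓝 t) (𝓝 0) := by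
  obtain ⟨b, hb, hbs⟩ := h.majorant
  have hbs' := summable_nat_of_int hbs
  simp only [Int.cast_natCast] at hbs'
  have hle : ∀ r (n : ℕ), (n : ℝ) ^ 4 * (v n r - v n t) ^ 2 ≤ 4 * ((n : ℝ) ^ 4 * b n ^ 2) := by
    intro r n
    have h1 := (abs_sub (v n r) (v n t)).trans (add_le_add (hb n r) (hb n t))
    have h2 := pow_le_pow_left₀ (abs_nonneg _) h1 2
    rw [sq_abs] at h2
    have h3 := mul_le_mul_of_nonneg_left h2 (show 0 ≤ (n : ℝ) ^ 4 by positivity)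
    linarith
  have hsum : ∀ r, Summable fun n : ℕ => (n : ℝ) ^ 4 * (v n r - v n t) ^ 2 := fun r =>
    (hbs'.mul_left 4).of_nonneg_of_le (fun n => by positivity) (hle r)
  have e : ∀ r, normH2 (toFunction v r - toFunction v t)
      = √(π * ∑' n : ℕ, (n : ℝ) ^ 4 * (v n r - v n t) ^ 2) := fun r => by
    rw [← normH2_sineSeries (hsum r)]
    congr 1
    ext x
    have s1 := summable_sine (summable_abs_of_mul (summable_mul_abs (h.summable_nat r))) x
    have s2 := summable_sine (summable_abs_of_mul (summable_mul_abs (h.summable_nat t))) x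
    simp only [Pi.sub_apply, toFunction, sineSeries]
    rw [← s1.tsum_sub s2]
    exact tsum_congr fun n => by ring
  simp only [e]
  have h1 := tendsto_tsum_of_dominated_convergence (𝓕 := 𝓝 t)
    (f := fun r (n : ℕ) => (n : ℝ) ^ 4 * (v n r - v n t) ^ 2) (g := fun _ => (0 : ℝ))
    (hbs'.mul_left 4) (fun n => by
      have hc := h.cont n
      have : Continuous fun r => (n : ℝ) ^ 4 * (v n r - v n t) ^ 2 := by fun_prop
      simpa using this.tendsto t) (Eventually.of_forall fun r n => by
      rw [Real.norm_of_nonneg (by positivity)]; exact hle r n)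
  rw [tsum_zero] at h1
  simpa using (h1.const_mul π).sqrt

/-- The norm of the integrand is at most K (t - r)^(-1/(1+s)), which is integrable precisely because
s > 0. For the pointwise Duhamel formula the summable bounds M n allow sum and integral to be
exchanged. -/
theorem isSolution (h : IsTrajectory s t₀ v) (hs : 0 < s) {α : ℝ} (hα : 2 * α = 1 + s) :
    IsSolution α (1 / 2) forcing t₀ (toFunction v t₀) (toFunction v) := by
  obtain ⟨K, hK⟩ := h.exists_integrand_bound hs.le
  obtain ⟨M, hM, hMs⟩ := h.exists_source_bound
  have hMa := summable_abs_of_mul_sq hMs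
  refine ⟨fun t _ => memH2Odd_sineSeries (h.summable_nat t),
    fun t _ => (h.continuous_toFunction t).mono_left nhdsWithin_le_nhds, fun t r _ hr => ?_,
    fun t ht => ?_, rfl, fun t ht x => ?_⟩
  · rw [h.source_integrand hα]
    exact memH2Odd_sineSeries (hK t r hr).1
  · simp only [h.source_integrand hα]
    have hr : ∀ᵐ r ∂(volume.restrict (Set.uIoc t₀ t)), r < t := by
      have h1 : ∀ᵐ r : ℝ, r ≠ t := by simp [ae_iff]
      filter_upwards [ae_restrict_mem measurableSet_uIoc, ae_restrict_of_ae h1] with r h2 h3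
      rw [Set.uIoc_of_le ht] at h2
      exact lt_of_le_of_ne h2.2 h3
    have hb : IntervalIntegrable (fun r => K * (t - r) ^ (-(1 + s)⁻¹)) volume t₀ t := by
      have h1 : -1 < -(1 + s)⁻¹ := by
        rw [neg_lt_neg_iff]
        exact inv_lt_one_of_one_lt₀ (by linarith)
      have h2 := (intervalIntegral.intervalIntegrable_rpow' h1 (a := t - t₀) (b := t - t)).comp_sub_left
        t
      simpa using h2.const_mul K
    refine hb.mono_fun' ?_ ?_
    · refine aestronglyMeasurable_of_tendsto_ae atTop (f := fun N r => √(π * ∑ n ∈ Finset.range N,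
        (n : ℝ) ^ 4 * (Real.exp (-rate s n * (t - r)) * source v n r) ^ 2)) (fun N => ?_) ?_
      · have hc := fun n : ℕ => h.continuous_source n
        apply Continuous.aestronglyMeasurable
        fun_prop
      · filter_upwards [hr] with r hr
        rw [normH2_sineSeries (hK t r hr).1]
        exact ((hK t r hr).1.hasSum.tendsto_sum_nat.const_mul π).sqrt
    · filter_upwards [hr] with r hr
      rw [normH2_sineSeries (hK t r hr).1, Real.norm_of_nonneg (Real.sqrt_nonneg _)]
      exact (hK t r hr).2
  · have hinit : semigroup α (t - t₀) (toFunction v t₀)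
        = sineSeries fun n => Real.exp (-rate s n * (t - t₀)) * v n t₀ :=
      semigroup_sineSeries hα _ (summable_abs_of_mul (summable_mul_abs (h.summable_nat t₀)))
    have hbd : ∀ (n : ℕ) r, r ≤ t → ‖Real.exp (-rate s n * (t - r)) * source v n r
        * Real.sin (n * x)‖ ≤ |M n| := fun n r hr => by
      rw [Real.norm_eq_abs, abs_mul, abs_mul, abs_of_pos (Real.exp_pos _)]
      refine (mul_le_of_le_one_right (by positivity) (Real.abs_sin_le_one _)).trans ?_
      refine (mul_le_of_le_one_left (abs_nonneg _) (Real.exp_le_one_iff.mpr ?_)).trans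
        ((hM n r).trans (le_abs_self _))
      have : 0 ≤ rate s n := mul_nonneg (abs_nonneg _) (symbolWeight_nonneg s n)
      nlinarith
    have hI := intervalIntegral.hasSum_integral_of_dominated_convergence (μ := volume) (a := t₀)
      (b := t) (F := fun (n : ℕ) r => Real.exp (-rate s n * (t - r)) * source v n r
        * Real.sin (n * x))
      (f := fun r => sineSeries (fun n => Real.exp (-rate s n * (t - r)) * source v n r) x)
      (fun n _ => |M n|)
      (fun n => by
        have hc := h.continuous_source n
        apply Continuous.aestronglyMeasurable
        fun_prop)
      (fun n => Eventually.of_forall fun r hr => by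
        rw [Set.uIoc_of_le ht] at hr
        exact hbd n r hr.2)
      (Eventually.of_forall fun r _ => hMa) intervalIntegrable_const
      (Eventually.of_forall fun r hr => by
        rw [Set.uIoc_of_le ht] at hr
        exact (Summable.of_norm_bounded hMa fun n => hbd n r hr.2).hasSum)
    have h0 : Summable fun n : ℕ => Real.exp (-rate s n * (t - t₀)) * v n t₀ * Real.sin (n * x) := by
      refine Summable.of_norm_bounded (summable_abs_of_mul (summable_mul_abs
        (h.summable_nat t₀))) fun n => ?_
      rw [Real.norm_eq_abs, abs_mul, abs_mul, abs_of_pos (Real.exp_pos _)]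
      refine (mul_le_of_le_one_right (by positivity) (Real.abs_sin_le_one _)).trans
        (mul_le_of_le_one_left (abs_nonneg _) (Real.exp_le_one_iff.mpr ?_))
      have : 0 ≤ rate s n := mul_nonneg (abs_nonneg _) (symbolWeight_nonneg s n)
      nlinarith
    simp only [h.source_integrand hα]
    rw [hinit]
    have h1 := (h0.hasSum.add hI).tsum_eq
    rw [sineSeries, ← h1, toFunction, sineSeries]
    refine tsum_congr fun n => ?_
    rw [intervalIntegral.integral_mul_const, ← add_mul, ← h.duhamel n t ht]

end IsTrajectory

end Solution

end FracBurgers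

/-! ### Comparison of norms, and the theorem -/

namespace FracBurgers

theorem OrbitBox.toFunction_add_one {s : ℝ} {u : ℤ → ℝ → ℝ} (h : OrbitBox s u) (t : ℝ) :
    toFunction u (t + 1) = toFunction u t := by
  simp only [toFunction, h.periodic]

/-- The odd extension to the integers of a sequence on the naturals. -/
noncomputable def oddExtension (a : ℕ → ℝ) (k : ℤ) : ℝ := (k.sign : ℝ) * a k.natAbs

theorem oddExtension_neg (a : ℕ → ℝ) (k : ℤ) : oddExtension a (-k) = -oddExtension a k := by
  simp [oddExtension]

theorem oddExtension_natCast {a : ℕ → ℝ} (h0 : a 0 = 0) (n : ℕ) : oddExtension a n = a n := by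
  rcases Nat.eq_zero_or_pos n with rfl | hn
  · simp [oddExtension, h0]
  · simp [oddExtension, Int.sign_natCast_of_ne_zero hn.ne']

theorem sineSeries_sub {a b : ℕ → ℝ} (ha : Summable fun n => |a n|) (hb : Summable fun n => |b n|) :
    sineSeries a - sineSeries b = sineSeries fun n => a n - b n := by
  ext x
  rw [Pi.sub_apply, sineSeries, sineSeries, ← (summable_sine ha x).tsum_sub (summable_sine hb x)]
  exact tsum_congr fun n => by ring

/-- Summing over the integers doubles the square sum of an odd sequence. -/
theorem hasSum_pow_four_mul_sq {c : ℤ → ℝ} (he : ∀ k, c (-k) ^ 2 = c k ^ 2)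
    (h : Summable fun n : ℕ => (n : ℝ) ^ 4 * c n ^ 2) :
    HasSum (fun k : ℤ => (k : ℝ) ^ 4 * c k ^ 2) (2 * ∑' n : ℕ, (n : ℝ) ^ 4 * c n ^ 2) := by
  have := hasSum_int_of_even (f := fun k : ℤ => (k : ℝ) ^ 4 * c k ^ 2)
    (fun k => by simp only [he]; push_cast; ring) (by simp) (by simpa using h)
  simpa using this

theorem tsum_nat_le_tsum_int {f : ℤ → ℝ} (hf : ∀ k, 0 ≤ f k) (h : Summable f) :
    ∑' n : ℕ, f n ≤ ∑' k, f k :=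
  tsum_comp_le_tsum_of_inj h hf Nat.cast_injective

/-- The norm of the difference of two functions with close coefficients. -/
theorem normH2_sub_le {b c : ℕ → ℝ} {d : ℤ → ℝ} {E M : ℝ} (hE : 0 ≤ E)
    (hb : Summable fun n : ℕ => (n : ℝ) ^ 4 * b n ^ 2)
    (hc : Summable fun n : ℕ => (n : ℝ) ^ 4 * c n ^ 2)
    (h : ∀ n : ℕ, |b n - c n| ≤ E * d n) (hd : Summable fun k : ℤ => (k : ℝ) ^ 4 * d k ^ 2)
    (hM : ∑' k : ℤ, (k : ℝ) ^ 4 * d k ^ 2 ≤ M) :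
    normH2 (sineSeries b - sineSeries c) ≤ E * √(π * M) := by
  have hd' : Summable fun n : ℕ => (n : ℝ) ^ 4 * d n ^ 2 := by
    simpa using summable_nat_of_int hd
  have hle : ∀ n : ℕ, (n : ℝ) ^ 4 * (b n - c n) ^ 2 ≤ E ^ 2 * ((n : ℝ) ^ 4 * d n ^ 2) := fun n => by
    have := pow_le_pow_left₀ (abs_nonneg _) (h n) 2
    rw [sq_abs, mul_pow] at this
    linarith [mul_le_mul_of_nonneg_left this (show (0 : ℝ) ≤ (n : ℝ) ^ 4 by positivity)]
  have hbc : Summable fun n : ℕ => (n : ℝ) ^ 4 * (b n - c n) ^ 2 :=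
    (hd'.mul_left _).of_nonneg_of_le (fun n => by positivity) hle
  rw [sineSeries_sub (summable_abs_of_mul (summable_mul_abs hb))
    (summable_abs_of_mul (summable_mul_abs hc)), normH2_sineSeries hbc]
  have h1 : ∑' n : ℕ, (n : ℝ) ^ 4 * (b n - c n) ^ 2 ≤ E ^ 2 * M := by
    calc _ ≤ ∑' n : ℕ, E ^ 2 * ((n : ℝ) ^ 4 * d n ^ 2) := hbc.tsum_le_tsum hle (hd'.mul_left _)
      _ = E ^ 2 * ∑' n : ℕ, (n : ℝ) ^ 4 * d n ^ 2 := tsum_mul_left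
      _ ≤ E ^ 2 * M := by
          refine mul_le_mul_of_nonneg_left (le_trans ?_ hM) (sq_nonneg E)
          simpa using tsum_nat_le_tsum_int (f := fun k : ℤ => (k : ℝ) ^ 4 * d k ^ 2)
            (fun k => by positivity) hd
  rw [← Real.sqrt_sq hE, ← Real.sqrt_mul (sq_nonneg E)]
  refine Real.sqrt_le_sqrt ?_
  linarith [mul_le_mul_of_nonneg_left h1 Real.pi_pos.le]

end FracBurgers

theorem theorem2 (i : ℕ) (hi : 11 ≤ i) (hi' : i ≤ 32) (α : ℝ)
    (hα : α = 1 / 2 + (i : ℝ) / 64) :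
    ∃ uStar : ℝ → ℝ → ℝ,
      FracBurgers.IsPeriodicOrbit α (1 / 2) FracBurgers.forcing 1 uStar ∧
      ∃ δ D κ : ℝ, 0 < δ ∧ 0 < D ∧ 0 < κ ∧
        ∀ (t₀ : ℝ) (u₀ : ℝ → ℝ), FracBurgers.MemH2Odd u₀ →
          FracBurgers.normH2 (uStar t₀ - u₀) ≤ δ →
          ∃ u : ℝ → ℝ → ℝ,
            FracBurgers.IsSolution α (1 / 2) FracBurgers.forcing t₀ u₀ u ∧
            u t₀ = u₀ ∧
            ∀ t, t₀ ≤ t →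
              FracBurgers.normH2 (uStar t - u t) ≤
                D * Real.exp (-κ * (t - t₀)) * FracBurgers.normH2 (uStar t₀ - u t₀) := by
  open FracBurgers in
  obtain ⟨s, hs_def⟩ : ∃ s : ℝ, s = i / 32 := ⟨_, rfl⟩
  have hi1 : (11 : ℝ) ≤ i := by exact_mod_cast hi
  have hi2 : (i : ℝ) ≤ 32 := by exact_mod_cast hi'
  have hs : 11 / 32 ≤ s := by rw [hs_def]; linarith
  have hs1 : s ≤ 1 := by rw [hs_def]; linarith
  have hs0 : 0 < s := by linarith
  have hαs : 2 * α = 1 + s := by rw [hα, hs_def]; ring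
  obtain ⟨w, hbox, hd⟩ := exists_orbit hs hs1
  have htraj : ∀ t₀, IsTrajectory s t₀ w := hbox.isTrajectory hs hd
  refine ⟨toFunction w, ⟨fun t₀ => (htraj t₀).isSolution hs0 hαs, hbox.toFunction_add_one⟩, ?_⟩
  have hK : 0 < invSqSum * 10 ^ 66 := mul_pos invSqSum_pos (by positivity)
  -- The radius leaves ample room in the smallness condition of `exists_trajectory` for N = 2 * S,
  -- where 2 * S ≤ δ² follows from π * S ≤ δ².
  refine ⟨√(1 / (invSqSum * 10 ^ 66)), 10 ^ 15, decayRate, Real.sqrt_pos.mpr (by positivity),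
    by positivity, by norm_num [decayRate], fun t₀ u₀ hu₀ hδ => ?_⟩
  have hw0 : ∀ t, w 0 t = 0 := fun t => by
    have := hbox.odd 0 t
    rw [neg_zero] at this
    linarith
  -- The initial perturbation, mode by mode. Its odd extension to the integers is the datum for
  -- `exists_trajectory`, with twice the square sum.
  set a : ℕ → ℝ := fun n => sineCoeff u₀ n - w n t₀ with ha
  have ha0 : a 0 = 0 := by simp [ha, hw0, sineCoeff]
  have hsq : Summable fun n : ℕ => (n : ℝ) ^ 4 * a n ^ 2 := by
    refine ((hu₀.summable.add ((htraj t₀).summable_nat t₀)).mul_left 2).of_nonneg_of_le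
      (fun n => by positivity) fun n => ?_
    have hn : (0 : ℝ) ≤ (n : ℝ) ^ 4 := by positivity
    have h1 : a n ^ 2 ≤ 2 * (sineCoeff u₀ n ^ 2 + w n t₀ ^ 2) := by
      simp only [ha]
      nlinarith [sq_nonneg (sineCoeff u₀ n + w n t₀)]
    nlinarith [mul_le_mul_of_nonneg_left h1 hn]
  have hnorm : normH2 (toFunction w t₀ - u₀) ^ 2 = π * ∑' n : ℕ, (n : ℝ) ^ 4 * a n ^ 2 := by
    have hsq' : Summable fun n : ℕ => (n : ℝ) ^ 4 * (w n t₀ - sineCoeff u₀ n) ^ 2 :=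
      hsq.congr fun n => by simp only [ha]; ring
    have e : toFunction w t₀ - u₀ = sineSeries fun n => w n t₀ - sineCoeff u₀ n := by
      conv_lhs => rw [hu₀.eq_sineSeries]
      exact sineSeries_sub (summable_abs_of_mul (summable_mul_abs ((htraj t₀).summable_nat t₀)))
        (summable_abs_of_mul (summable_mul_abs hu₀.summable))
    rw [e, normH2_sineSeries hsq', Real.sq_sqrt (mul_nonneg Real.pi_pos.le
      (tsum_nonneg fun n => by positivity))]
    congr 1
    exact tsum_congr fun n => by simp only [ha]; ring
  set ρ := normH2 (toFunction w t₀ - u₀) with hρ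
  have hρ0 : 0 ≤ ρ := Real.sqrt_nonneg _
  set S := ∑' n : ℕ, (n : ℝ) ^ 4 * a n ^ 2
  have hS0 : 0 ≤ S := tsum_nonneg fun n => by positivity
  have hcast := oddExtension_natCast ha0
  have hsum : HasSum (fun k : ℤ => (k : ℝ) ^ 4 * oddExtension a k ^ 2) (2 * S) := by
    have := hasSum_pow_four_mul_sq (c := oddExtension a)
      (fun k => by rw [oddExtension_neg, neg_sq]) (by simpa only [hcast] using hsq)
    simpa only [hcast] using this
  have hsmall : invSqSum * (10 ^ 24 * (250000 * (2 * S))) ≤ 1 / 10 ^ 30 := by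
    have h1 : ρ ^ 2 ≤ 1 / (invSqSum * 10 ^ 66) := by
      rw [← Real.sq_sqrt (show 0 ≤ 1 / (invSqSum * 10 ^ 66) by positivity)]
      exact pow_le_pow_left₀ hρ0 hδ 2
    have h2 : 2 * S ≤ 1 / (invSqSum * 10 ^ 66) := by
      nlinarith [mul_le_mul_of_nonneg_right Real.pi_gt_three.le hS0]
    have h3 := mul_le_mul_of_nonneg_left h2 invSqSum_pos.le
    rw [show invSqSum * (1 / (invSqSum * 10 ^ 66)) = 1 / 10 ^ 66 by
      have := invSqSum_pos.ne'
      field_simp] at h3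
    linarith
  obtain ⟨v, hv, hv0, c, hvc, hcs, hc⟩ := exists_trajectory hbox hs hs1 hd t₀
    (oddExtension_neg a) hsum.summable hsum.tsum_eq.le hsmall
  have hinit : toFunction v t₀ = u₀ := by
    rw [hu₀.eq_sineSeries, toFunction]
    congr 1
    ext n
    rw [hv0, hcast]
    simp only [ha]
    ring
  refine ⟨toFunction v, hinit ▸ hv.isSolution hs0 hαs, hinit, fun t ht => ?_⟩
  rw [hinit, ← hρ]
  refine (normH2_sub_le (Real.exp_pos (-decayRate * (t - t₀))).le ((htraj t₀).summable_nat t)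
    (hv.summable_nat t) (fun n => ?_) hcs hc).trans ?_
  · rw [abs_sub_comm]
    exact hvc n t ht
  · rw [mul_comm (10 ^ 15 : ℝ), mul_assoc]
    refine mul_le_mul_of_nonneg_left (Real.sqrt_le_iff.mpr ⟨by positivity, ?_⟩) (Real.exp_pos _).le
    -- The amplification is π * (10^24 · 250000 · 2S) = 5 · 10^29 ρ² ≤ (10^15 ρ)², which is where D
    -- comes from.
    rw [mul_pow, hnorm]
    nlinarith [mul_nonneg Real.pi_pos.le hS0]
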